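/- Let $n\ge 2$ and let $\mathbb P=\mathrm{Trop}(\lambda)$ be the tropical semifield of Laurent monomials in $\lambda$, so that $\mathbb{ZP}=\mathbb Z[\lambda^{\pm1}]$. Let $\mathcal F=\mathbb{ZP}(x_1,\dots,x_n)$, and consider the generalised seed (in the sense of Chekhov–Shapiro) with cluster $(x_1,\dots,x_n)$, exchange polynomials $$\theta_i(u,v)=u+v\quad(1\le i\le n-1),\qquad \theta_n(u,v)=u^2+\lambda uv+v^2,$$ and exchange matrix $B=(b_{ij})$ with $b_{i,i+1}=1$ for $1\le i\le n-2$, $b_{n-1,n}=2$, $b_{i+1,i}=-1$ for $1\le i\le n-1$, and all other entries $0$; in mutations, the coefficients of the exchange polynomials are normalised (their tropical sum is preserved). A cluster variable is a member of the cluster of a seed obtained from this one by finitely many generalised mutations. Let $\mathcal A_n$ be the $\mathbb Z[\lambda]$-subalgebra of $\mathcal F$ generated by all cluster variables (the generalised cluster algebra of type $C_n$, with $\lambda$ not inverted). Number the vertices of a regular $(2n+2)$-gon cyclically by $\mathbb Z/(2n+2)\mathbb Z$, and write $\bar a=a+n+1$ for the vertex opposite to $a$. Label the initial variable $x_k$ by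 the pair of opposite diagonals $\{[-1,k],[\overline{-1},\overline{k}]\}$ (a diameter for $k=n$), $1\le k\le n$. These pairs form a centrally symmetric triangulation; let a mutation in direction $k$ correspond to the flip of the $k$-th pair (or diameter) in the current centrally symmetric triangulation, so that the variables of mutated clusters are labelled by pairs of opposite diagonals or diameters. A pair $\{[a,b],[\bar a,\bar b]\}$ is called small if the vertices strictly inside the smaller of the two arcs cut out by $[a,b]$ form exactly one orbit under $v\mapsto\bar v$; a cluster variable attached to a small pair is also called small. A cluster monomial is a monomial in the variables of a single cluster. Then each small pair is the label of exactly one cluster variable, there are exactly $n+1$ small variables, and: 1. The monomials in the small variables form a $\mathbb Z$-basis of $\mathcal A_n$. 2. Equivalently, $\mathcal A_n$ is the polynomial ring over $\mathbb Z$ in the $n+1$ small variables. 3. The cluster monomials form a $\mathbb Z[\lambda]$-basis of $\mathcal A_n$. 4. The products $\lambda^e m$, with $e\ge 0$ and $m$ a cluster monomial, form a $\mathbb Z$-basis of $\mathcal A_n$. -/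

import Mathlib

open scoped LaurentPolynomial

noncomputable section

namespace GenCluster

/-! ### Generalised seeds over the coefficient group `Trop(λ)` -/

/-- The ambient field `ℤℙ(t₁, …, tₙ)` for `ℙ = Trop(λ)`: the integer group ring of `ℙ` is the
Laurent polynomial ring `ℤ[λ, λ⁻¹]`, and we take the field of rational functions in `n`
variables over it. -/
abbrev Ambient (n : ℕ) : Type := FractionRing (MvPolynomial (Fin n) ℤ[T;T⁻¹])

/-- The embedding of the tropical semifield `Trop(λ)` in the ambient field. The semifield is
Mathlib's `Tropical ℤ`: the monomial `λ ^ a` is `Tropical.trop a`, the product is the product of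
`Tropical ℤ` and the tropical addition is `λ ^ a ⊕ λ ^ b = λ ^ (min a b)`. -/
def coeffEmb (n : ℕ) (p : Tropical ℤ) : Ambient n :=
  algebraMap (MvPolynomial (Fin n) ℤ[T;T⁻¹]) (Ambient n)
    (MvPolynomial.C (LaurentPolynomial.T (Tropical.untrop p)))

/-- The coefficient `λ` as an element of the ambient field. -/
def lam (n : ℕ) : Ambient n := coeffEmb n (Tropical.trop 1)

/-- The tropical sum `q₀ ⊕ q₁ ⊕ … ⊕ q_m` in `Trop(λ)` (the sum of `Tropical ℤ` is the minimum of
the exponents). -/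
def tropSum {m : ℕ} (q : Fin (m + 1) → Tropical ℤ) : Tropical ℤ :=
  Finset.univ.inf' ⟨0, Finset.mem_univ 0⟩ q

/-- The data `(x, p̄, B)` of a generalised seed of rank `n`, where `d k` is the degree of the
`k`-th exchange polynomial: a cluster, a tuple of coefficients of the exchange polynomials, and
an exchange matrix. (For the seeds obtained from the initial seed below, the cluster is a
free generating set of the ambient field, `B` is skew-symmetrisable and `d k` divides the `k`-th
column of `B`: this is so for the initial seed, and is preserved by mutation.) -/
structure Seed {n : ℕ} (d : Fin n → ℕ) where
  x : Fin n → Ambient n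
  p : (i : Fin n) → Fin (d i + 1) → Tropical ℤ
  B : Matrix (Fin n) (Fin n) ℤ

namespace Seed

variable {n : ℕ} {d : Fin n → ℕ}

/-- `β_{jk} = b_{jk} / d_k` (an exact division). -/
def beta (s : Seed d) (j k : Fin n) : ℤ := s.B j k / (d k : ℤ)

/-- `u_k⁺ = ∏_j x_j ^ [β_{jk}]₊`. -/
def uPlus (s : Seed d) (k : Fin n) : Ambient n := ∏ j, s.x j ^ (s.beta j k).toNat

/-- `u_k⁻ = ∏_j x_j ^ [-β_{jk}]₊`. -/
def uMinus (s : Seed d) (k : Fin n) : Ambient n := ∏ j, s.x j ^ (-s.beta j k).toNat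

/-- The exchange polynomial `θ_k(u, v) = ∑_r p_{k,r} u^r v^{d_k - r}`, evaluated at `u`, `v`. -/
def theta (s : Seed d) (k : Fin n) (u v : Ambient n) : Ambient n :=
  ∑ r : Fin (d k + 1), coeffEmb n (s.p k r) * u ^ (r : ℕ) * v ^ (d k - (r : ℕ))

/-- The common ratio by which a mutation in direction `k` multiplies `p_{i,r} / p_{i,r-1}`, for
`i ≠ k`. -/
def ratio (s : Seed d) (k i : Fin n) : Tropical ℤ :=
  if 0 ≤ s.B k i then s.p k (Fin.last (d k)) ^ s.beta k i else s.p k 0 ^ s.beta k i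

/-- The tuple `(γ ^ r p_{i,r})_r`, with `γ` the ratio above: the tuple `p'_i` up to a common
factor. -/
def preCoeff (s : Seed d) (k i : Fin n) (r : Fin (d i + 1)) : Tropical ℤ :=
  s.ratio k i ^ (r : ℕ) * s.p i r

/-- The generalised mutation in direction `k`. The prescribed ratios `p'_{i,r} / p'_{i,r-1}`
determine the tuple `p'_i`, `i ≠ k`, up to a common factor, which is fixed as usual by
normalisation: the tropical sum `⨁_r p_{i,r}` does not change (it is `1` for the initial seed
below). -/
def mutate (k : Fin n) (s : Seed d) : Seed d where
  x := Function.update s.x k (s.theta k (s.uPlus k) (s.uMinus k) / s.x k)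
  p := fun i r =>
    if i = k then s.p i r.rev
    else tropSum (s.p i) / tropSum (s.preCoeff k i) * s.preCoeff k i r
  B := fun i j =>
    if i = k ∨ j = k then -s.B i j
    else s.B i j + (|s.B i k| * s.B k j + s.B i k * |s.B k j|) / 2

/-- `s'` is obtained from `s` by a finite sequence of mutations. -/
def MutationEquiv (s s' : Seed d) : Prop :=
  Relation.ReflTransGen (fun a b : Seed d => ∃ k, b = a.mutate k) s s'

end Seed

/-! ### The generalised cluster algebra of type `Cₙ` -/

/-- The exchange degrees: `d_i = 1` for `i < n` and `d_n = 2`. -/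
def degC (n : ℕ) (i : Fin n) : ℕ := if (i : ℕ) + 1 = n then 2 else 1

/-- The initial seed of type `Cₙ`: the cluster consists of the `n` variables, the exchange
polynomials are `θ_i = u + v` for `i < n` and `θ_n = u² + λ u v + v²`, and `B` has entries
`b_{i,i+1} = 1` except `b_{n-1,n} = 2`, `b_{i+1,i} = -1`, and `0` elsewhere. -/
def initialSeed (n : ℕ) : Seed (degC n) where
  x := fun i => algebraMap (MvPolynomial (Fin n) ℤ[T;T⁻¹]) (Ambient n) (MvPolynomial.X i)
  p := fun i r => if (i : ℕ) + 1 = n ∧ (r : ℕ) = 1 then Tropical.trop 1 else 1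
  B := fun i j =>
    if (j : ℕ) = i + 1 then (if (j : ℕ) + 1 = n then 2 else 1)
    else if (i : ℕ) = j + 1 then -1 else 0

/-- The cluster variables: the members of the clusters of all seeds that are mutation-equivalent
to the initial seed. -/
def clusterVariables (n : ℕ) : Set (Ambient n) :=
  {z | ∃ s, (initialSeed n).MutationEquiv s ∧ ∃ i, z = s.x i}

/-- The cluster monomials: the monomials in the variables of a single cluster. -/
def clusterMonomials (n : ℕ) : Set (Ambient n) :=
  {z | ∃ s, (initialSeed n).MutationEquiv s ∧ ∃ a : Fin n → ℕ, z = ∏ i, s.x i ^ a i}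

/-- The subring `ℤ[λ]` of the ambient field. -/
abbrev ZLam (n : ℕ) : Subalgebra ℤ (Ambient n) := Algebra.adjoin ℤ {lam n}

/-- The algebra `𝒜ₙ`: the `ℤ[λ]`-subalgebra of the ambient field generated by the cluster
variables. -/
def clusterAlgebra (n : ℕ) : Subalgebra (ZLam n) (Ambient n) :=
  Algebra.adjoin (ZLam n) (clusterVariables n)

/-! ### Labelling of the cluster variables by diagonals of the `(2n+2)`-gon

The vertices of the regular `(2n+2)`-gon are numbered clockwise by `ZMod (2n+2)`. (In the
numbering by even numbers, the vertex `v ∈ {0, …, n}` here is the vertex `2v`, and `v + (n+1)` is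
the opposite vertex, the barred `2v`; so the barred `2n` is `2n+1 = -1`.) -/

/-- The vertices of the `(2n+2)`-gon. -/
abbrev Vertex (n : ℕ) : Type := ZMod (2 * n + 2)

/-- The opposite vertex, i.e. the image under the central symmetry `Θ`. -/
def opp {n : ℕ} (a : Vertex n) : Vertex n := a + (n + 1 : ℕ)

/-- The vertices strictly between `a` and `b`, going clockwise from `a` to `b`. -/
def openArc {n : ℕ} (a b : Vertex n) : Finset (Vertex n) :=
  Finset.univ.filter fun v => 0 < (v - a).val ∧ (v - a).val < (b - a).val

/-- `[a, b]` is a diagonal: `a`, `b` are distinct and not neighbours. -/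
def IsDiagonal {n : ℕ} (a b : Vertex n) : Prop := b ≠ a ∧ b ≠ a + 1 ∧ a ≠ b + 1

/-- The `Θ`-orbit `{[a, b], [ā, b̄]}` (a single segment if `b = ā`). -/
def segOrbit {n : ℕ} (a b : Vertex n) : Set (Sym2 (Vertex n)) := {s(a, b), s(opp a, opp b)}

/-- Two segments cross: they have a common point in the interior of the polygon. -/
def Crosses {n : ℕ} (D E : Sym2 (Vertex n)) : Prop :=
  ∃ a b c e : Vertex n, D = s(a, b) ∧ E = s(c, e) ∧ c ∈ openArc a b ∧ e ∈ openArc b a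

/-- `τ` is a labelled centrally symmetric triangulation of the `(2n+2)`-gon, given by its `n`
distinct pairwise non-crossing `Θ`-orbits of diagonals (`n - 1` pairs and one diameter). -/
def IsTriangulation {n : ℕ} (τ : Fin n → Set (Sym2 (Vertex n))) : Prop :=
  Function.Injective τ ∧
  (∀ i, ∃ a b, IsDiagonal a b ∧ τ i = segOrbit a b) ∧
  ∀ i j, ∀ D ∈ τ i, ∀ E ∈ τ j, ¬ Crosses D E

/-- `τ'` is obtained from the triangulation `τ` by flipping its `k`-th orbit of diagonals. -/
def IsFlip {n : ℕ} (k : Fin n) (τ τ' : Fin n → Set (Sym2 (Vertex n))) : Prop :=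
  IsTriangulation τ ∧ IsTriangulation τ' ∧ τ' k ≠ τ k ∧ ∀ i, i ≠ k → τ' i = τ i

/-- The labels of the initial cluster: `x_k` is attached to the orbit of `[\overline{2n}, 2k]`,
`k = 1, …, n`. -/
def initialLabels (n : ℕ) (k : Fin n) : Set (Sym2 (Vertex n)) :=
  segOrbit (-1) (((k : ℕ) + 1 : ℕ) : Vertex n)

/-- The seed `s`, with its cluster labelled by the triangulation `τ`, is obtained from the
initial seed and its labels by a finite sequence of steps, each of which mutates the seed in a
direction `k` and flips the `k`-th orbit of diagonals of the triangulation. -/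
def LabelledSeed (n : ℕ) (s : Seed (degC n)) (τ : Fin n → Set (Sym2 (Vertex n))) : Prop :=
  Relation.ReflTransGen
    (fun P Q : Seed (degC n) × (Fin n → Set (Sym2 (Vertex n))) =>
      ∃ k, Q.1 = P.1.mutate k ∧ IsFlip k P.2 Q.2)
    (initialSeed n, initialLabels n) (s, τ)

/-- `z` is the cluster variable `x_{ab}`, attached to the orbit of the diagonal `[a, b]`. -/
def IsVariableAt {n : ℕ} (a b : Vertex n) (z : Ambient n) : Prop :=
  ∃ s τ, LabelledSeed n s τ ∧ ∃ i, τ i = segOrbit a b ∧ z = s.x i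

/-- The set `𝒪_{ab}` of the `Θ`-orbits of the vertices that lie on the smaller of the two arcs
cut out by `[a, b]` (for a diameter the two arcs give the same set). -/
def arcOrbits {n : ℕ} (a b : Vertex n) : Finset (Sym2 (Vertex n)) :=
  (if (openArc a b).card ≤ (openArc b a).card then openArc a b else openArc b a).image
    fun v => s(v, opp v)

/-- The diagonal `[a, b]` is small: `𝒪_{ab}` has exactly one element. -/
def IsSmall {n : ℕ} (a b : Vertex n) : Prop := IsDiagonal a b ∧ (arcOrbits a b).card = 1

/-- The small cluster variables. -/
def smallVariables (n : ℕ) : Set (Ambient n) :=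
  {z | ∃ a b : Vertex n, IsSmall a b ∧ IsVariableAt a b z}

/-- The monomials in the small variables. -/
def smallMonomials (n : ℕ) : Set (Ambient n) :=
  (Submonoid.closure (smallVariables n) : Set (Ambient n))

/-- The set `S` is an `R`-basis of (the `R`-submodule with underlying set) `M`. -/
def IsBasisOf (R : Type*) {F : Type*} [Ring R] [AddCommGroup F] [Module R F] (S M : Set F) :
    Prop :=
  LinearIndepOn R id S ∧ (Submodule.span R S : Set F) = M

end GenCluster

end

/-! Put N = n + 1 and divide the polygon by its central symmetry. The vertices become a circle of N
points, and a pair of opposite diagonals becomes an arc (a, l) from a to a + l with 2 ≤ l ≤ N;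
diameters have l = N, small pairs l = 2. Give each point i an entry c(i), consider the recurrence
f(i+1) = c(i) f(i) − f(i−1) with these N-periodic coefficients, and attach to (a, l) the continuant
`cont c a l`: the value at a + l of the solution that is 0 at a and 1 at a + 1. A small arc carries
the entry at its middle point. The Plücker relation `cont_ptolemy` is then the exchange relation of
a pair of diagonals, and Cayley–Hamilton for the monodromy turns the relation between two diameters
into u² + tr·uv + v² (`cont_diameter`), so that λ is the trace of the monodromy.

Solving these equations for the entries gives a function `coef` into the ambient field for which the
arcs from −1 carry the initial cluster and the trace is λ. By induction along mutations, every
cluster consists of the continuants of a centrally symmetric triangulation (`exists_isTreeSeed`),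
encoded by the base point of its diameter and a binary search tree. Hence 𝒜ₙ is generated as a ring
by the n + 1 small variables. They are algebraically independent, because the n + 1 algebraically
independent elements λ, x₁, …, xₙ are polynomials in them and generate the same field
(`smallHom_injective`). This gives the polynomial ring and the basis of small monomials.

For the cluster monomials, compare top degrees. A continuant is the product of its entries plus
terms of lower degree, and λ is the product of all small variables plus terms of lower degree. So
λ^e times a product over a compatible family of arcs has a leading exponent whose value at the point
p is e plus the number of arcs over p. Every function on the circle arises in this way exactly once:
e is its minimum, and a function with a zero counts the arcs of a unique compatible family
(`IsFamily.eq_of_cover_eq`, `exists_isFamily`). Since compatible families are exactly the supports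
of cluster monomials (`mem_clusterMonomials_iff`), the products λ^e m are unitriangular against the
monomials, hence a ℤ-basis; grouping the powers of λ gives the ℤ[λ]-basis. -/

namespace GenCluster

/-! ### Continuants with periodic entries -/

section Continuant

variable {N : ℕ} {R : Type*} [CommRing R]

/-- The continuant of the `l - 1` entries `c (a + 1), …, c (a + l - 1)`. -/
def cont (c : ZMod N → R) (a : ZMod N) : ℕ → R
  | 0 => 0
  | 1 => 1
  | l + 2 => c (a + (l + 1 : ℕ)) * cont c a (l + 1) - cont c a l

@[simp] lemma cont_zero (c : ZMod N → R) (a : ZMod N) : cont c a 0 = 0 := rfl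

@[simp] lemma cont_one (c : ZMod N → R) (a : ZMod N) : cont c a 1 = 1 := rfl

lemma cont_add_two (c : ZMod N → R) (a : ZMod N) (l : ℕ) :
    cont c a (l + 2) = c (a + (l + 1 : ℕ)) * cont c a (l + 1) - cont c a l := rfl

@[simp] lemma cont_two (c : ZMod N → R) (a : ZMod N) : cont c a 2 = c (a + 1) := by
  simp [cont_add_two c a 0]

/-- Both factors solve the same recurrence in the position p + q, so their Casorati determinant does
not depend on q; q = 0 gives its value. -/
lemma cont_wronskian (c : ZMod N → R) (a : ZMod N) (p q : ℕ) :
    cont c a (p + q) * cont c (a + p) (q + 1) - cont c a (p + q + 1) * cont c (a + p) q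
      = cont c a p := by
  induction q with
  | zero => simp
  | succ q ih =>
    have h1 : cont c a (p + (q + 1) + 1) =
        c (a + (p + q + 1 : ℕ)) * cont c a (p + q + 1) - cont c a (p + q) :=
      cont_add_two c a (p + q)
    have h2 : cont c (a + p) (q + 1 + 1) =
        c (a + (p + q + 1 : ℕ)) * cont c (a + p) (q + 1) - cont c (a + p) q := by
      rw [cont_add_two]; congr 3; push_cast; ring
    rw [h1, h2, ← ih, ← add_assoc p q 1]
    ring

/-- The three-term Plücker relation for continuants. -/
lemma cont_ptolemy (c : ZMod N → R) (a : ZMod N) (p q r : ℕ) :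
    cont c a (p + q) * cont c (a + p) (q + r) =
      cont c a p * cont c (a + p + q) r + cont c a (p + q + r) * cont c (a + p) q := by
  -- As functions of r both sides satisfy the recurrence, so they agree once they agree at r = 0 and
  -- r = 1; the latter is the constancy of the Casoratian.
  induction r using Nat.twoStepInduction with
  | zero => simp
  | one => linear_combination cont_wronskian c a p q - cont c a p * cont_one c (a + p + q)
  | more r h0 h1 =>
    have e1 : cont c (a + p) (q + (r + 2)) =
        c (a + (p + q + r + 1 : ℕ)) * cont c (a + p) (q + (r + 1)) - cont c (a + p) (q + r) := by
      rw [← add_assoc, cont_add_two]; congr 3; push_cast; ring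
    have e2 : cont c (a + p + q) (r + 2) =
        c (a + (p + q + r + 1 : ℕ)) * cont c (a + p + q) (r + 1) - cont c (a + p + q) r := by
      rw [cont_add_two]; congr 3; push_cast; ring
    have e3 : cont c a (p + q + (r + 2)) =
        c (a + (p + q + r + 1 : ℕ)) * cont c a (p + q + (r + 1)) - cont c a (p + q + r) :=
      cont_add_two c a (p + q + r)
    rw [e1, e2, e3]
    linear_combination c (a + (p + q + r + 1 : ℕ)) * h1 - h0

/-- The recurrence read from the other end, a Plücker relation with p = q = 1. -/
lemma cont_add_two_left (c : ZMod N → R) (a : ZMod N) (l : ℕ) :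
    cont c a (l + 2) = c (a + 1) * cont c (a + 1) (l + 1) - cont c (a + 1 + 1) l := by
  have h := cont_ptolemy c a 1 1 l
  simp only [Nat.cast_one, cont_one, one_mul, mul_one, Nat.reduceAdd, cont_two] at h
  rw [show l + 2 = 1 + 1 + l by ring, add_comm l 1]
  linear_combination -h

/-- The trace of the monodromy of the recurrence with periodic coefficients `c`. -/
def traceCont (c : ZMod N → R) (a : ZMod N) : R :=
  cont c a (N + 1) - cont c (a + 1) (N - 1)

/-- Expanding the long continuant based at a at its left end and the one based at a + 1 at its right
end gives the same expression, since both remove the entry at a + 1. -/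
lemma traceCont_add_one [NeZero N] (c : ZMod N → R) (a : ZMod N) :
    traceCont c (a + 1) = traceCont c a := by
  have hN : N - 1 + 1 = N := Nat.sub_add_cancel (NeZero.pos N)
  have h1 := cont_add_two c (a + 1) (N - 1)
  have h2 := cont_add_two_left c a (N - 1)
  have h3 : N - 1 + 2 = N + 1 := by omega
  rw [h3, hN] at h1 h2
  rw [ZMod.natCast_self, add_zero] at h1
  rw [traceCont, traceCont, h1, h2]; ring

lemma traceCont_eq [NeZero N] (c : ZMod N → R) (a b : ZMod N) : traceCont c a = traceCont c b := by
  have h : ∀ k : ℕ, traceCont c (b + k) = traceCont c b := by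
    intro k
    induction k with
    | zero => simp
    | succ k ih => rw [← ih, ← traceCont_add_one c (b + k)]; congr 1; push_cast; ring
  have := h (a - b).val
  rwa [ZMod.natCast_zmod_val, add_sub_cancel] at this

/-- Cayley–Hamilton for the monodromy, which has determinant 1: a solution satisfies f(N+h) =
tr·f(h) − f(h−N). For f = `cont c a`, continued to the left, f(h−N) = f(−k) is minus the continuant
of length k from a − k = a + h. -/
lemma cont_add_period (c : ZMod N → R) (a : ZMod N) (h k : ℕ) (hN : h + k = N) :
    cont c a (N + h) = traceCont c a * cont c a h + cont c (a + h) k := by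
  induction h using Nat.twoStepInduction generalizing k with
  | zero => simp at hN; simp [hN]
  | one =>
    have : k = N - 1 := by omega
    simp [this, traceCont]
  | more h h0 h1 =>
    have e0 := h0 (k + 2) (by omega)
    have e1 := h1 (k + 1) (by omega)
    have e2 := cont_add_two_left c (a + h) k
    have e3 : cont c a (N + (h + 2)) =
        c (a + h + 1) * cont c a (N + (h + 1)) - cont c a (N + h) := by
      rw [← add_assoc, cont_add_two]; congr 3; push_cast; simp [add_assoc]
    have e4 : cont c a (h + 2) =
        c (a + h + 1) * cont c a (h + 1) - cont c a h := by
      rw [cont_add_two]; congr 3; push_cast; ring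
    have e5 : a + ((h + 2 : ℕ) : ZMod N) = a + h + 1 + 1 := by push_cast; ring
    have e6 : a + ((h + 1 : ℕ) : ZMod N) = a + h + 1 := by push_cast; ring
    rw [e6] at e1
    rw [e3, e4, e5, e0, e1, e2]; ring

/-- The exchange relation for diameters. -/
lemma cont_diameter (c : ZMod N → R) (a : ZMod N) (h k : ℕ) (hN : h + k = N) :
    cont c a N * cont c (a + h) N =
      cont c a h ^ 2 + traceCont c a * cont c a h * cont c (a + h) k + cont c (a + h) k ^ 2 := by
  -- The four points a, a + h, a + N, a + N + h lie on the universal cover of the circle; the third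
  -- projects to a, and the segment from the first to the last exceeds one period.
  have e := cont_ptolemy c a h k h
  have e1 : a + (h : ZMod N) + k = a := by
    rw [add_assoc, ← Nat.cast_add, hN]; simp
  rw [e1, hN, add_comm k h, hN, cont_add_period c a h k hN] at e
  rw [e]; ring

lemma map_cont {S : Type*} [CommRing S] (f : R →+* S) (c : ZMod N → R) (a : ZMod N) (l : ℕ) :
    f (cont c a l) = cont (f ∘ c) a l := by
  induction l using Nat.twoStepInduction with
  | zero => simp
  | one => simp
  | more l h0 h1 => simp [cont_add_two, h0, h1]

lemma map_traceCont {S : Type*} [CommRing S] (f : R →+* S) (c : ZMod N → R) (a : ZMod N) :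
    f (traceCont c a) = traceCont (f ∘ c) a := by
  simp [traceCont, map_cont]

lemma cont_congr (c c' : ZMod N → R) (a : ZMod N) (l : ℕ)
    (h : ∀ i, 0 < i → i < l → c (a + (i : ℕ)) = c' (a + (i : ℕ))) :
    cont c a l = cont c' a l := by
  induction l using Nat.twoStepInduction with
  | zero => rfl
  | one => rfl
  | more l h0 h1 =>
    rw [cont_add_two, cont_add_two, h0 fun i hi hl => h i hi (by omega),
      h1 fun i hi hl => h i hi (by omega), h (l + 1) (by omega) (by omega)]

end Continuant

/-! ### Polynomials with a prescribed leading monomial -/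

section Leading

variable {σ : Type*}

/-- `p` is the monomial with exponent `w` plus terms of lower degree. -/
def Leads (w : σ →₀ ℕ) (p : MvPolynomial σ ℤ) : Prop :=
  ∃ q : MvPolynomial σ ℤ, p = MvPolynomial.monomial w 1 + q ∧
    ∀ u, q.coeff u ≠ 0 → u.degree < w.degree

lemma Leads.one : Leads (0 : σ →₀ ℕ) 1 := ⟨0, by simp, by simp⟩

lemma leads_X (i : σ) : Leads (Finsupp.single i 1) (MvPolynomial.X i) :=
  ⟨0, by simp [MvPolynomial.X], by simp⟩

lemma Leads.degree_le {w : σ →₀ ℕ} {p : MvPolynomial σ ℤ} (h : Leads w p) (u : σ →₀ ℕ)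
    (hu : p.coeff u ≠ 0) : u.degree ≤ w.degree := by
  classical
  obtain ⟨q, rfl, hq⟩ := h
  rw [MvPolynomial.coeff_add, MvPolynomial.coeff_monomial] at hu
  by_cases h : w = u
  · rw [h]
  · rw [if_neg h, zero_add] at hu
    exact (hq u hu).le

lemma Leads.coeff_self {w : σ →₀ ℕ} {p : MvPolynomial σ ℤ} (h : Leads w p) : p.coeff w = 1 := by
  classical
  obtain ⟨q, rfl, hq⟩ := h
  have : q.coeff w = 0 := by
    by_contra h
    exact lt_irrefl _ (hq w h)
  simp [this]

lemma Leads.coeff_of_ne {w u : σ →₀ ℕ} {p : MvPolynomial σ ℤ} (h : Leads w p) (hne : u ≠ w)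
    (hu : w.degree ≤ u.degree) : p.coeff u = 0 := by
  classical
  obtain ⟨q, rfl, hq⟩ := h
  have : q.coeff u = 0 := by
    by_contra h
    exact absurd (hq u h) (not_lt.2 hu)
  simp [MvPolynomial.coeff_monomial, this, hne.symm]

lemma Leads.ne_zero {w : σ →₀ ℕ} {p : MvPolynomial σ ℤ} (h : Leads w p) : p ≠ 0 := by
  rintro rfl
  simpa using h.coeff_self

lemma Leads.mul {w w' : σ →₀ ℕ} {p p' : MvPolynomial σ ℤ} (h : Leads w p) (h' : Leads w' p') :
    Leads (w + w') (p * p') := by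
  classical
  have hd := h.degree_le
  obtain ⟨q', rfl, hq'⟩ := h'
  obtain ⟨q, rfl, hq⟩ := h
  refine ⟨q * MvPolynomial.monomial w' 1 + (MvPolynomial.monomial w 1 + q) * q', ?_, ?_⟩
  · rw [mul_add, add_mul, MvPolynomial.monomial_mul, mul_one]; ring
  · intro u hu
    rw [map_add]
    rw [MvPolynomial.coeff_add] at hu
    by_cases h1 : (q * MvPolynomial.monomial w' (1 : ℤ)).coeff u = 0
    · rw [h1, zero_add, MvPolynomial.coeff_mul] at hu
      obtain ⟨⟨x, y⟩, hxy, hne⟩ := Finset.exists_ne_zero_of_sum_ne_zero hu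
      rw [Finset.HasAntidiagonal.mem_antidiagonal] at hxy
      dsimp only at hxy hne
      rw [← hxy, map_add]
      have := hd x (left_ne_zero_of_mul hne)
      have := hq' y (right_ne_zero_of_mul hne)
      omega
    · rw [MvPolynomial.coeff_mul] at h1
      obtain ⟨⟨x, y⟩, hxy, hne⟩ := Finset.exists_ne_zero_of_sum_ne_zero h1
      rw [Finset.HasAntidiagonal.mem_antidiagonal] at hxy
      dsimp only at hxy hne
      rw [← hxy, map_add]
      have := hq x (left_ne_zero_of_mul hne)
      have h2 := right_ne_zero_of_mul hne
      rw [MvPolynomial.coeff_monomial] at h2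
      have : w' = y := by
        by_contra h; exact h2 (if_neg h)
      subst this
      omega

lemma Leads.pow {w : σ →₀ ℕ} {p : MvPolynomial σ ℤ} (h : Leads w p) (k : ℕ) :
    Leads (k • w) (p ^ k) := by
  induction k with
  | zero => simpa using Leads.one
  | succ k ih => rw [succ_nsmul, pow_succ]; exact ih.mul h

lemma Leads.prod {ι : Type*} (s : Finset ι) {w : ι → σ →₀ ℕ} {p : ι → MvPolynomial σ ℤ}
    (h : ∀ i ∈ s, Leads (w i) (p i)) : Leads (∑ i ∈ s, w i) (∏ i ∈ s, p i) := by
  classical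
  induction s using Finset.induction_on with
  | empty => simpa using Leads.one
  | insert a s ha ih =>
    rw [Finset.sum_insert ha, Finset.prod_insert ha]
    exact (h a (by simp)).mul (ih fun i hi => h i (by simp [hi]))

lemma Leads.sub {w : σ →₀ ℕ} {p q : MvPolynomial σ ℤ} (h : Leads w p)
    (hq : ∀ u, q.coeff u ≠ 0 → u.degree < w.degree) : Leads w (p - q) := by
  obtain ⟨r, rfl, hr⟩ := h
  refine ⟨r - q, by ring, fun u hu => ?_⟩
  rw [MvPolynomial.coeff_sub] at hu
  by_cases h : q.coeff u = 0
  · rw [h, sub_zero] at hu; exact hr u hu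
  · exact hq u h

/-- Polynomials with pairwise distinct leading monomials are linearly independent. -/
lemma linearIndependent_of_leads {f : (σ →₀ ℕ) → MvPolynomial σ ℤ} (hf : ∀ w, Leads w (f w)) :
    LinearIndependent ℤ f := by
  classical
  rw [linearIndependent_iff']
  by_contra! h
  obtain ⟨s, g, hs, i, hi, hgi⟩ := h
  -- At an exponent w of maximal degree among those in the relation, no other member contributes to
  -- the coefficient of the monomial w.
  obtain ⟨w, hw, hmax⟩ := Finset.exists_max_image (s.filter fun i => g i ≠ 0)
    (fun i => i.degree) ⟨i, by simp [hi, hgi]⟩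
  rw [Finset.mem_filter] at hw
  have h1 := congrArg (MvPolynomial.coeff w) hs
  rw [MvPolynomial.coeff_sum, Finset.sum_eq_single w] at h1
  · rw [MvPolynomial.coeff_smul, (hf w).coeff_self] at h1
    simp at h1
    exact hw.2 h1
  · intro v hv hvw
    rw [MvPolynomial.coeff_smul]
    by_cases h0 : g v = 0
    · simp [h0]
    · rw [(hf v).coeff_of_ne hvw.symm (hmax v (by simp [hv, h0])), smul_zero]
  · exact fun h => absurd hw.1 h

/-- Polynomials with all leading monomials span. -/
lemma span_of_leads {f : (σ →₀ ℕ) → MvPolynomial σ ℤ} (hf : ∀ w, Leads w (f w)) :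
    Submodule.span ℤ (Set.range f) = ⊤ := by
  have key : ∀ D : ℕ, ∀ w : σ →₀ ℕ, w.degree < D →
      MvPolynomial.monomial w 1 ∈ Submodule.span ℤ (Set.range f) := by
    intro D
    induction D with
    | zero => intro w hw; omega
    | succ D ih =>
      intro w hw
      obtain ⟨q, hq, hlt⟩ := hf w
      have h1 : q ∈ Submodule.span ℤ (Set.range f) := by
        rw [MvPolynomial.as_sum q]
        refine Submodule.sum_mem _ fun u hu => ?_
        rw [MvPolynomial.mem_support_iff] at hu
        have := ih u (by have := hlt u hu; omega)
        have h2 := Submodule.smul_mem _ (q.coeff u) this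
        rwa [MvPolynomial.smul_monomial, smul_eq_mul, mul_one] at h2
      have h2 : f w ∈ Submodule.span ℤ (Set.range f) := Submodule.subset_span ⟨w, rfl⟩
      rw [show MvPolynomial.monomial w (1 : ℤ) = f w - q by rw [hq]; ring]
      exact Submodule.sub_mem _ h2 h1
  rw [eq_top_iff]
  intro p _
  rw [MvPolynomial.as_sum p]
  refine Submodule.sum_mem _ fun u _ => ?_
  have h2 := Submodule.smul_mem _ (p.coeff u) (key _ u (Nat.lt_succ_self _))
  rwa [MvPolynomial.smul_monomial, smul_eq_mul, mul_one] at h2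

end Leading

/-! ### Leading monomials of continuants -/

section ContinuantLeading

variable {N : ℕ}

/-- The multiset of the points strictly inside the arc of length `l` starting at `a`. -/
noncomputable def arcWeight (a : ZMod N) (l : ℕ) : ZMod N →₀ ℕ :=
  ∑ i ∈ Finset.range (l - 1), Finsupp.single (a + (i + 1 : ℕ)) 1

lemma degree_arcWeight (a : ZMod N) (l : ℕ) : (arcWeight a l).degree = l - 1 := by
  simp [arcWeight]

/-- The generic continuant. -/
noncomputable abbrev genCont (a : ZMod N) (l : ℕ) : MvPolynomial (ZMod N) ℤ :=
  cont (fun i => MvPolynomial.X i) a l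

/-- The recurrence multiplies by the next entry and subtracts a continuant with two entries fewer,
so the product of all entries is the top-degree part. -/
lemma leads_genCont (a : ZMod N) (l : ℕ) : Leads (arcWeight a (l + 1)) (genCont a (l + 1)) := by
  induction l using Nat.twoStepInduction with
  | zero => simpa [arcWeight] using Leads.one
  | one => simpa [arcWeight] using leads_X (a + 1)
  | more l h0 h1 =>
    rw [genCont, cont_add_two]
    have h2 : arcWeight a (l + 2 + 1) =
        Finsupp.single (a + (l + 1 + 1 : ℕ)) 1 + arcWeight a (l + 1 + 1) := by
      simp only [arcWeight, Nat.add_sub_cancel, Finset.sum_range_succ]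
      rw [add_comm]
    rw [h2]
    refine ((leads_X _).mul h1).sub fun u hu => ?_
    have := h0.degree_le u hu
    rw [map_add, degree_arcWeight]
    rw [degree_arcWeight] at this
    simp; omega

/-- Going N + 1 steps from a passes every point exactly once strictly inside (`arcWeight_period`),
so the leading monomial of the trace is the product of all entries. -/
lemma leads_traceCont (hN : 2 ≤ N) (a : ZMod N) :
    Leads (arcWeight a (N + 1)) (traceCont (fun i => (MvPolynomial.X i : MvPolynomial _ ℤ)) a) := by
  refine (leads_genCont a N).sub fun u hu => ?_
  have h := leads_genCont (a + 1) (N - 2)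
  rw [show N - 2 + 1 = N - 1 by omega] at h
  have := h.degree_le u hu
  rw [degree_arcWeight] at this ⊢
  omega

end ContinuantLeading

/-! ### Arcs on a circle with `N` points -/

section Arcs

variable {N : ℕ}

/-- The point `p` lies strictly inside the arc `I = (a, l)` from `a` to `a + l`. -/
def Covers (I : ZMod N × ℕ) (p : ZMod N) : Prop :=
  0 < (p - I.1).val ∧ (p - I.1).val < I.2

/-- The end point of `I` lies strictly inside `J`, and `J` starts strictly inside `I`. -/
def CrossArc (I J : ZMod N × ℕ) : Prop :=
  0 < (J.1 - I.1).val ∧ (J.1 - I.1).val < I.2 ∧ I.2 < (J.1 - I.1).val + J.2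

/-- The arcs `I`, `J` do not cross in either order. -/
def CompatArc (I J : ZMod N × ℕ) : Prop := ¬ CrossArc I J ∧ ¬ CrossArc J I

/-- Arcs that contain an inner point and wind around the circle at most once. -/
def IsArc (I : ZMod N × ℕ) : Prop := 2 ≤ I.2 ∧ I.2 ≤ N

lemma CompatArc.symm {I J : ZMod N × ℕ} (h : CompatArc I J) : CompatArc J I := ⟨h.2, h.1⟩

variable [NeZero N]

lemma val_triangle (a b c : ZMod N) :
    (c - a).val = (b - a).val + (c - b).val ∨ (c - a).val + N = (b - a).val + (c - b).val := by
  rw [show c - a = (b - a) + (c - b) by ring]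
  rcases lt_or_ge ((b - a).val + (c - b).val) N with h | h
  · exact Or.inl (ZMod.val_add_of_lt h)
  · right; rw [ZMod.val_add_val_of_le h]

lemma val_sub_comm (a b : ZMod N) :
    (a - b).val + (b - a).val = N ∨ (a = b ∧ (a - b).val = 0 ∧ (b - a).val = 0) := by
  rcases val_triangle a b a with h | h
  · simp only [sub_self, ZMod.val_zero] at h
    right
    have h1 : (b - a).val = 0 := by omega
    rw [ZMod.val_eq_zero] at h1
    have : a = b := (sub_eq_zero.1 h1).symm
    simp [this]
  · simp only [sub_self, ZMod.val_zero] at h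
    omega

lemma val_natCast_cases (l : ℕ) (hl : l ≤ N) :
    (l < N ∧ (l : ZMod N).val = l) ∨ (l = N ∧ (l : ZMod N).val = 0) := by
  rcases hl.lt_or_eq with h | h
  · exact Or.inl ⟨h, ZMod.val_cast_of_lt h⟩
  · right; subst h; simp

omit [NeZero N] in
-- Without crossing, an arc that starts strictly inside J cannot leave J.
lemma covers_nested_left {I J : ZMod N × ℕ} (h : CompatArc I J) (hc : Covers J I.1) :
    0 < (I.1 - J.1).val ∧ (I.1 - J.1).val + I.2 ≤ J.2 := by
  have h2 := h.2
  simp only [CrossArc, Covers] at *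
  omega

lemma covers_nested_right {I J : ZMod N × ℕ} (hI : IsArc I) (h : CompatArc I J)
    (hc : Covers J (I.1 + (I.2 : ℕ))) : (I.1 - J.1).val + I.2 < J.2 := by
  obtain ⟨h1, h2⟩ := h
  have t := val_triangle J.1 I.1 (I.1 + (I.2 : ℕ))
  rw [add_sub_cancel_left] at t
  have := val_natCast_cases (N := N) I.2 hI.2
  have := val_sub_comm I.1 J.1
  have := ZMod.val_lt (I.1 - J.1)
  have := ZMod.val_lt (J.1 - I.1)
  simp only [CrossArc, Covers] at *
  omega

/-! ### Covering numbers of compatible families -/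

open Classical in
/-- The number of arcs of the family `c`, with multiplicity, that contain the point `p`. -/
noncomputable def cover (c : ZMod N × ℕ →₀ ℕ) (p : ZMod N) : ℕ :=
  c.sum fun I k => if Covers I p then k else 0

omit [NeZero N] in
lemma cover_add (c c' : ZMod N × ℕ →₀ ℕ) (p : ZMod N) :
    cover (c + c') p = cover c p + cover c' p := by
  classical
  rw [cover, Finsupp.sum_add_index']
  · rfl
  · simp
  · intro a b1 b2; split_ifs <;> simp

open Classical in
omit [NeZero N] in
lemma cover_single (I : ZMod N × ℕ) (p : ZMod N) :
    cover (Finsupp.single I 1) p = if Covers I p then 1 else 0 := by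
  rw [cover, Finsupp.sum_single_index]; simp

omit [NeZero N] in
lemma cover_ne_zero {c : ZMod N × ℕ →₀ ℕ} {p : ZMod N} :
    cover c p ≠ 0 ↔ ∃ I, c I ≠ 0 ∧ Covers I p := by
  classical
  rw [cover, Finsupp.sum, Ne, Finset.sum_eq_zero_iff]
  push Not
  refine exists_congr fun I => ?_
  rw [Finsupp.mem_support_iff]
  constructor
  · rintro ⟨h1, h2⟩
    exact ⟨h1, by by_contra h; exact h2 (if_neg h)⟩
  · rintro ⟨h1, h2⟩
    exact ⟨h1, by rwa [if_pos h2]⟩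

/-- The arcs of the family `c` are pairwise compatible. -/
def IsFamily (c : ZMod N × ℕ →₀ ℕ) : Prop :=
  ∀ I, c I ≠ 0 → IsArc I ∧ ∀ J, c J ≠ 0 → CompatArc I J

omit [NeZero N] in
lemma IsFamily.mono {c c' : ZMod N × ℕ →₀ ℕ} (h : IsFamily c') (hc : c ≤ c') : IsFamily c := by
  have h0 : ∀ I, c I ≠ 0 → c' I ≠ 0 := fun I hI => by have := hc I; omega
  exact fun I hI => ⟨(h I (h0 I hI)).1, fun J hJ => (h I (h0 I hI)).2 J (h0 J hJ)⟩

omit [NeZero N] in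
lemma covers_succ {I : ZMod N × ℕ} (hI : IsArc I) : Covers I (I.1 + 1) := by
  obtain ⟨h1, h2⟩ := hI
  have : Fact (1 < N) := ⟨by omega⟩
  simp only [Covers, add_sub_cancel_left, ZMod.val_one]
  omega

omit [NeZero N] in
lemma exists_longest {c : ZMod N × ℕ →₀ ℕ} {P : ZMod N × ℕ → Prop}
    (h : ∃ I, c I ≠ 0 ∧ P I) : ∃ I, c I ≠ 0 ∧ P I ∧ ∀ J, c J ≠ 0 → P J → J.2 ≤ I.2 := by
  classical
  obtain ⟨I, h1, h2⟩ := h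
  obtain ⟨J, hJ, hmax⟩ := Finset.exists_max_image (c.support.filter P) (fun I => I.2)
    ⟨I, by simp [h1, h2]⟩
  simp only [Finset.mem_filter, Finsupp.mem_support_iff] at hJ hmax
  exact ⟨J, hJ.1, hJ.2, fun K hK hPK => hmax K ⟨hK, hPK⟩⟩

omit [NeZero N] in
/-- Some point of the circle is not inside any arc of a compatible family. -/
lemma IsFamily.exists_uncovered {c : ZMod N × ℕ →₀ ℕ} (hc : IsFamily c) :
    ∃ p, cover c p = 0 := by
  by_cases h : ∃ I, c I ≠ 0 ∧ True
  · obtain ⟨I, hI, -, hmax⟩ := exists_longest h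
    -- An arc over the starting point of a longest arc I would contain I and be strictly longer.
    refine ⟨I.1, ?_⟩
    by_contra h
    obtain ⟨J, hJ, hcov⟩ := cover_ne_zero.1 h
    have := covers_nested_left ((hc I hI).2 J hJ) hcov
    have := hmax J hJ trivial
    omega
  · refine ⟨0, ?_⟩
    by_contra h'
    obtain ⟨J, hJ, -⟩ := cover_ne_zero.1 h'
    exact h ⟨J, hJ, trivial⟩

/-- A compatible family is determined by the numbers of arcs that contain the points. -/
lemma IsFamily.eq_of_cover_eq {c c' : ZMod N × ℕ →₀ ℕ} (hc : IsFamily c) (hc' : IsFamily c')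
    (h : ∀ p, cover c p = cover c' p) : c = c' := by
  -- The longest arc I of c is visible in the covering numbers: its end points are uncovered and its
  -- inner points covered. The aim is to find I in c' as well, remove it from both families and
  -- induct on the number of arcs.
  induction hd : c.degree generalizing c c' with
  | zero =>
    rw [Finsupp.degree_eq_zero_iff] at hd
    subst hd
    ext I
    by_contra hI
    have hI' : c' I ≠ 0 := fun h => hI (by simp [h])
    have h1 : cover c' (I.1 + 1) ≠ 0 := cover_ne_zero.2 ⟨I, hI', covers_succ (hc' I hI').1⟩
    rw [← h, cover_ne_zero] at h1
    obtain ⟨J, hJ, -⟩ := h1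
    simp at hJ
  | succ d ih =>
    have hne : ∃ I, c I ≠ 0 ∧ True := by
      by_contra! hcon
      have : c = 0 := by ext I; by_contra hI; exact (hcon I hI)
      simp [this] at hd
    obtain ⟨I, hI, -, hmax⟩ := exists_longest hne
    have hIarc := (hc I hI).1
    have ha : cover c' I.1 = 0 := by
      rw [← h]
      by_contra h
      obtain ⟨J, hJ, hcov⟩ := cover_ne_zero.1 h
      have := covers_nested_left ((hc I hI).2 J hJ) hcov
      have := hmax J hJ trivial
      omega
    have hb : cover c' (I.1 + (I.2 : ℕ)) = 0 := by
      rw [← h]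
      by_contra h
      obtain ⟨J, hJ, hcov⟩ := cover_ne_zero.1 h
      have := covers_nested_right hIarc ((hc I hI).2 J hJ) hcov
      have := hmax J hJ trivial
      omega
    have hin : ∀ p, Covers I p → cover c' p ≠ 0 := fun p hp => by
      rw [← h, cover_ne_zero]; exact ⟨I, hI, hp⟩
    -- An arc of c' over the first inner point of I must start at I.1, because it cannot cover the
    -- uncovered point I.1.
    have hstart : ∃ J, c' J ≠ 0 ∧ J.1 = I.1 := by
      obtain ⟨J, hJ, hcov⟩ := cover_ne_zero.1 (hin _ (covers_succ hIarc))
      refine ⟨J, hJ, ?_⟩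
      by_contra hJI
      have hna : ¬ Covers J I.1 := fun hcov => cover_ne_zero.2 ⟨J, hJ, hcov⟩ ha
      have t := val_triangle J.1 I.1 (I.1 + 1)
      have : Fact (1 < N) := ⟨by have := hIarc.1; have := hIarc.2; omega⟩
      rw [add_sub_cancel_left, ZMod.val_one] at t
      have h0 := ZMod.val_lt (I.1 - J.1)
      have : (I.1 - J.1).val ≠ 0 := by
        rw [Ne, ZMod.val_eq_zero, sub_eq_zero]; exact fun h => hJI h.symm
      simp only [Covers] at *
      omega
    obtain ⟨J, hJ, hJ1, hJmax⟩ := exists_longest hstart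
    have hJarc := (hc' J hJ).1
    have hle : J.2 ≤ I.2 := by
      by_contra hlt
      refine cover_ne_zero.2 ⟨J, hJ, ?_⟩ hb
      have := val_natCast_cases (N := N) I.2 hIarc.2
      have := hIarc.1
      have := hJarc.2
      simp only [Covers, hJ1, add_sub_cancel_left]
      omega
    -- If the longest arc J of c' from I.1 ended strictly inside I, an arc K of c' over its end
    -- would contain J strictly. As I.1 is uncovered, K would start there too and be longer than J.
    have heq : J = I := by
      refine Prod.ext hJ1 (le_antisymm hle ?_)
      by_contra hlt
      have hq : Covers I (J.1 + (J.2 : ℕ)) := by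
        have := val_natCast_cases (N := N) J.2 hJarc.2
        have := hJarc.1
        have := hIarc.2
        simp only [Covers, hJ1, add_sub_cancel_left]
        omega
      obtain ⟨K, hK, hcov⟩ := cover_ne_zero.1 (hin _ hq)
      have h1 := covers_nested_right hJarc ((hc' J hJ).2 K hK) hcov
      have h2 : K.1 = I.1 := by
        by_contra hKI
        refine cover_ne_zero.2 ⟨K, hK, ?_, ?_⟩ ha
        · rw [Nat.pos_iff_ne_zero, Ne, ZMod.val_eq_zero, sub_eq_zero]; exact fun h => hKI h.symm
        · rw [← hJ1]; omega
      have := hJmax K hK h2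
      omega
    subst heq
    have l1 : Finsupp.single J 1 ≤ c := by simpa using Nat.one_le_iff_ne_zero.2 hI
    have l2 : Finsupp.single J 1 ≤ c' := by simpa using Nat.one_le_iff_ne_zero.2 hJ
    have e1 := tsub_add_cancel_of_le l1
    have e2 := tsub_add_cancel_of_le l2
    have key : c - Finsupp.single J 1 = c' - Finsupp.single J 1 := by
      refine ih (hc.mono tsub_le_self) (hc'.mono tsub_le_self) (fun p => ?_) ?_
      · have := h p
        rw [← e1, ← e2, cover_add, cover_add] at this
        omega
      · have := congrArg Finsupp.degree e1
        rw [map_add, Finsupp.degree_single] at this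
        omega
    rw [← e1, ← e2, key]

/-- A walk along the circle from a zero of `w` meets a zero followed by a nonzero value. -/
lemma exists_zero_succ_ne_zero {w : ZMod N → ℕ} (h0 : ∃ z, w z = 0) (h1 : ∃ p, w p ≠ 0) :
    ∃ a, w a = 0 ∧ w (a + 1) ≠ 0 := by
  by_contra! hcon
  obtain ⟨z, hz⟩ := h0
  obtain ⟨p, hp⟩ := h1
  have : ∀ k : ℕ, w (z + k) = 0 := by
    intro k
    induction k with
    | zero => simpa using hz
    | succ k ih =>
      have := hcon _ ih
      rwa [add_assoc, ← Nat.cast_succ] at this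
  have := this (p - z).val
  rw [ZMod.natCast_zmod_val, add_sub_cancel] at this
  exact hp this

/-- Every function on the circle with a zero counts the arcs of a compatible family. -/
lemma exists_isFamily (w : ZMod N → ℕ) (hw : ∃ z, w z = 0) :
    ∃ c : ZMod N × ℕ →₀ ℕ, IsFamily c ∧ ∀ p, cover c p = w p := by
  classical
  induction hd : ∑ p, w p using Nat.strong_induction_on generalizing w with
  | _ d ih =>
    by_cases h1 : ∃ p, w p ≠ 0
    · obtain ⟨a, ha, ha1⟩ := exists_zero_succ_ne_zero hw h1
      have hN : 1 ≤ N := NeZero.pos N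
      -- The arc to split off runs from the zero a to the next zero of w; one turn around the circle
      -- returns to a, so its length is at most N.
      have hex : ∃ l : ℕ, 1 ≤ l ∧ w (a + l) = 0 := ⟨N, hN, by simpa using ha⟩
      obtain ⟨hl1, hl0⟩ := Nat.find_spec hex
      have hlN : Nat.find hex ≤ N := Nat.find_min' hex ⟨hN, by simpa using ha⟩
      have hmin : ∀ k, 1 ≤ k → k < Nat.find hex → w (a + k) ≠ 0 := fun k hk hlt h =>
        Nat.find_min hex hlt ⟨hk, h⟩
      set l := Nat.find hex with hl
      have hl2 : 2 ≤ l := by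
        by_contra hlt
        have : l = 1 := by omega
        rw [this] at hl0
        simp at hl0
        exact ha1 hl0
      have hIarc : IsArc ((a, l) : ZMod N × ℕ) := ⟨hl2, hlN⟩
      have hpos : ∀ p, Covers (a, l) p → w p ≠ 0 := by
        intro p hp
        have := hmin (p - a).val hp.1 hp.2
        rwa [ZMod.natCast_zmod_val, add_sub_cancel] at this
      obtain ⟨c, hc, hcov⟩ := ih (∑ p, (w p - if Covers (a, l) p then 1 else 0)) (by
        rw [← hd]
        refine Finset.sum_lt_sum (fun p _ => Nat.sub_le _ _) ⟨a + 1, Finset.mem_univ _, ?_⟩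
        rw [if_pos (covers_succ hIarc)]
        omega) (fun p => w p - if Covers (a, l) p then 1 else 0) ⟨a, by simp [ha]⟩ rfl
      -- The new arc ends at zeros of w, which no remaining arc covers; an arc crossing it would
      -- cover one of its two ends.
      have hI : ∀ J : ZMod N × ℕ, c J ≠ 0 → CompatArc (a, l) J := by
        intro J hJ
        have hz : ∀ p, w p = 0 → ¬ Covers J p := by
          intro p hp hJp
          have h2 := cover_ne_zero.2 ⟨J, hJ, hJp⟩
          rw [hcov, hp] at h2
          simp at h2
        have h2 := hz _ ha
        have h3 := hz _ hl0
        have t := val_triangle J.1 a (a + (l : ℕ))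
        rw [add_sub_cancel_left] at t
        have := val_natCast_cases (N := N) l hlN
        have := val_sub_comm a J.1
        have := ZMod.val_lt (a - J.1)
        have := ZMod.val_lt (J.1 - a)
        have := ZMod.val_lt (a + (l : ZMod N) - J.1)
        have := (hc J hJ).1.2
        simp only [CompatArc, CrossArc, Covers] at *
        omega
      refine ⟨c + Finsupp.single (a, l) 1, ?_, fun p => ?_⟩
      · have hmem : ∀ J : ZMod N × ℕ,
            (c + Finsupp.single (a, l) 1 : ZMod N × ℕ →₀ ℕ) J ≠ 0 → J = (a, l) ∨ c J ≠ 0 := by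
          intro J hJ
          by_contra! h
          rw [Finsupp.add_apply, h.2, Finsupp.single_eq_of_ne h.1] at hJ
          exact hJ rfl
        have hself : CompatArc ((a, l) : ZMod N × ℕ) (a, l) := by simp [CompatArc, CrossArc]
        intro J hJ
        rcases hmem J hJ with rfl | hJ
        · refine ⟨hIarc, fun K hK => ?_⟩
          rcases hmem K hK with rfl | hK
          · exact hself
          · exact hI K hK
        · refine ⟨(hc J hJ).1, fun K hK => ?_⟩
          rcases hmem K hK with rfl | hK
          · exact (hI J hJ).symm
          · exact (hc J hJ).2 K hK
      · rw [cover_add, cover_single, hcov]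
        by_cases h : Covers (a, l) p
        · have := hpos p h
          simp only [h, if_true]; omega
        · simp [h]
    · push Not at h1
      exact ⟨0, fun I hI => absurd rfl hI, fun p => by simp [h1, cover]⟩

/-! ### Leading exponents of families of arcs -/

open Classical in
lemma arcWeight_apply (a : ZMod N) (l : ℕ) (hl : l ≤ N) (p : ZMod N) :
    arcWeight a l p = if Covers (a, l) p then 1 else 0 := by
  rw [arcWeight, Finsupp.finsetSum_apply]
  have h : ∀ i ∈ Finset.range (l - 1),
      (Finsupp.single (a + (i + 1 : ℕ)) 1 : ZMod N →₀ ℕ) p =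
        if i + 1 = (p - a).val then 1 else 0 := by
    intro i hi
    rw [Finset.mem_range] at hi
    rw [Finsupp.single_apply]
    congr 1
    rw [eq_iff_iff]
    have hv : ((i + 1 : ℕ) : ZMod N).val = i + 1 := ZMod.val_cast_of_lt (by omega)
    constructor
    · rintro rfl
      rw [add_sub_cancel_left, hv]
    · intro h
      rw [h, ZMod.natCast_zmod_val, add_sub_cancel]
  rw [Finset.sum_congr rfl h]
  by_cases hp : Covers (a, l) p
  · rw [if_pos hp]
    obtain ⟨h1, h2⟩ := hp
    dsimp only at h1 h2
    rw [Finset.sum_eq_single ((p - a).val - 1)]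
    · rw [if_pos (by omega)]
    · intro b _ hb; rw [if_neg (by omega)]
    · intro h; rw [Finset.mem_range] at h; omega
  · rw [if_neg hp]
    refine Finset.sum_eq_zero fun i hi => if_neg fun h => hp ?_
    rw [Finset.mem_range] at hi
    simp only [Covers]; omega

lemma arcWeight_period (a p : ZMod N) : arcWeight a (N + 1) p = 1 := by
  classical
  have hN : N - 1 + 1 = N := Nat.sub_add_cancel (NeZero.pos N)
  have h : arcWeight a (N + 1) = arcWeight a N + Finsupp.single a 1 := by
    have h1 : Finset.range (N + 1 - 1) = Finset.range (N - 1 + 1) := by rw [hN]; rfl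
    rw [arcWeight, h1, Finset.sum_range_succ, arcWeight]
    rw [hN, ZMod.natCast_self, add_zero]
  rw [h, Finsupp.add_apply, arcWeight_apply a N le_rfl, Finsupp.single_apply]
  have := ZMod.val_lt (p - a)
  by_cases hap : a = p
  · subst hap; simp [Covers]
  · have : (p - a).val ≠ 0 := by
      rw [Ne, ZMod.val_eq_zero, sub_eq_zero]; exact fun h => hap h.symm
    have hc : Covers (a, N) p := ⟨by dsimp only; omega, by dsimp only; omega⟩
    rw [if_neg hap, if_pos hc, add_zero]

/-- The exponent of the leading monomial of `λ ^ e` times the product of the continuants of the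
family `c`. -/
noncomputable def familyWeight (e : ℕ) (c : ZMod N × ℕ →₀ ℕ) : ZMod N →₀ ℕ :=
  e • arcWeight 0 (N + 1) + ∑ I ∈ c.support, c I • arcWeight I.1 I.2

lemma familyWeight_apply (e : ℕ) {c : ZMod N × ℕ →₀ ℕ} (hc : IsFamily c) (p : ZMod N) :
    familyWeight e c p = e + cover c p := by
  classical
  rw [familyWeight, Finsupp.add_apply, Finsupp.smul_apply, arcWeight_period, smul_eq_mul, mul_one,
    Finsupp.finsetSum_apply, cover, Finsupp.sum]
  congr 1
  refine Finset.sum_congr rfl fun I hI => ?_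
  rw [Finsupp.smul_apply, arcWeight_apply _ _ (hc I (Finsupp.mem_support_iff.1 hI)).1.2]
  simp

/-- Each family leaves a point uncovered. The exponent there is the power of λ and is the minimum,
so e = e'; then the covering numbers agree and determine the family. -/
lemma familyWeight_injective {e e' : ℕ} {c c' : ZMod N × ℕ →₀ ℕ} (hc : IsFamily c)
    (hc' : IsFamily c') (h : familyWeight e c = familyWeight e' c') : e = e' ∧ c = c' := by
  have h0 : ∀ p, e + cover c p = e' + cover c' p := fun p => by
    rw [← familyWeight_apply e hc, ← familyWeight_apply e' hc', h]
  obtain ⟨p, hp⟩ := hc.exists_uncovered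
  obtain ⟨p', hp'⟩ := hc'.exists_uncovered
  have h1 := h0 p
  have h2 := h0 p'
  have he : e = e' := by omega
  refine ⟨he, hc.eq_of_cover_eq hc' fun q => ?_⟩
  have := h0 q
  omega

/-- The power of λ is the minimum of w; what remains after subtracting it has a zero. -/
lemma exists_familyWeight_eq (w : ZMod N →₀ ℕ) :
    ∃ e c, IsFamily c ∧ familyWeight e c = w := by
  obtain ⟨z, -, hz⟩ := Finset.exists_min_image Finset.univ (fun p => w p)
    ⟨(0 : ZMod N), Finset.mem_univ _⟩
  obtain ⟨c, hc, hcov⟩ := exists_isFamily (fun p => w p - w z) ⟨z, Nat.sub_self _⟩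
  refine ⟨w z, c, hc, ?_⟩
  ext p
  rw [familyWeight_apply _ hc, hcov]
  have := hz p (Finset.mem_univ p)
  omega

/-- The product of `λ ^ e` and the generic continuants of the family `c`. -/
noncomputable def familyCont (e : ℕ) (c : ZMod N × ℕ →₀ ℕ) : MvPolynomial (ZMod N) ℤ :=
  traceCont (fun i => MvPolynomial.X i) 0 ^ e * ∏ I ∈ c.support, genCont I.1 I.2 ^ c I

omit [NeZero N] in
lemma leads_familyCont (hN : 2 ≤ N) (e : ℕ) {c : ZMod N × ℕ →₀ ℕ} (hc : IsFamily c) :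
    Leads (familyWeight e c) (familyCont e c) := by
  refine ((leads_traceCont hN 0).pow e).mul (Leads.prod _ fun I hI => Leads.pow ?_ _)
  have := (hc I (Finsupp.mem_support_iff.1 hI)).1.1
  have h := leads_genCont I.1 (I.2 - 1)
  rwa [Nat.sub_add_cancel (by omega)] at h

end Arcs

/-! ### Labelled binary trees

A centrally symmetric triangulation is encoded by the base point of its diameter and a binary
search tree, i.e. a triangulation of the polygon with vertices `0, …, n + 1`. The node `i` is the
segment from `o i` to `e i` together with the apex `m i` of the triangle below it. -/

/-- The raw data of a labelled binary search tree. -/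
@[ext] structure Tri (n : ℕ) where
  o : Fin n → ℕ
  e : Fin n → ℕ
  m : Fin n → ℕ

namespace Tri

variable {n : ℕ}

/-- The data `T` is a binary search tree with root `r`. -/
structure Valid (T : Tri n) (r : Fin n) : Prop where
  lt_m : ∀ i, T.o i < T.m i
  m_lt : ∀ i, T.m i < T.e i
  e_le : ∀ i, T.e i ≤ n + 1
  root_o : T.o r = 0
  root_e : T.e r = n + 1
  inj : ∀ i j, T.m i = T.m j → i = j
  left : ∀ i, T.o i + 1 < T.m i → ∃ j, T.o j = T.o i ∧ T.e j = T.m i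
  right : ∀ i, T.m i + 1 < T.e i → ∃ j, T.o j = T.m i ∧ T.e j = T.e i
  nestL : ∀ i j, T.o i < T.m j → T.m j < T.m i → T.o i ≤ T.o j ∧ T.e j ≤ T.m i
  nestR : ∀ i j, T.m i < T.m j → T.m j < T.e i → T.m i ≤ T.o j ∧ T.e j ≤ T.e i

namespace Valid

variable {T : Tri n} {r : Fin n}

lemma arc_inj (h : T.Valid r) {i j : Fin n} (ho : T.o i = T.o j) (he : T.e i = T.e j) :
    i = j := by
  have := h.lt_m i; have := h.m_lt i; have := h.lt_m j; have := h.m_lt j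
  rcases lt_trichotomy (T.m i) (T.m j) with hlt | heq | hlt
  · have := h.nestL j i (by omega) hlt; omega
  · exact h.inj i j heq
  · have := h.nestL i j (by omega) hlt; omega

/-- The apexes of the n nodes are distinct elements of {1, …, n}, so every inner vertex occurs. -/
lemma exists_apex (h : T.Valid r) {p : ℕ} (h0 : 0 < p) (hp : p < n + 1) : ∃ k, T.m k = p := by
  have hm : ∀ i, 0 < T.m i ∧ T.m i < n + 1 := fun i => by
    have := h.lt_m i; have := h.m_lt i; have := h.e_le i; omega
  have hinj : Function.Injective (fun i => (⟨T.m i - 1, by have := hm i; omega⟩ : Fin n)) := by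
    intro i j hij
    have h1 := hm i; have h2 := hm j
    simp only [Fin.mk.injEq] at hij
    exact h.inj i j (by omega)
  obtain ⟨k, hk⟩ := (Finite.injective_iff_surjective.1 hinj) ⟨p - 1, by omega⟩
  refine ⟨k, ?_⟩
  have := hm k
  simp only [Fin.mk.injEq] at hk
  omega

/-- There is a smallest node among those that contain two given points. -/
lemma _root_.GenCluster.Tri.exists_smallest (T : Tri n) {r : Fin n} (P : Fin n → Prop) (hr : P r) :
    ∃ t, P t ∧ ∀ s, P s → T.e t - T.o t ≤ T.e s - T.o s := by
  classical
  obtain ⟨t, ht, hmin⟩ := Finset.exists_min_image (Finset.univ.filter P)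
    (fun t => T.e t - T.o t) ⟨r, by simp [hr]⟩
  simp only [Finset.mem_filter, Finset.mem_univ, true_and] at ht hmin
  exact ⟨t, ht, hmin⟩

/-- Take the smallest node other than i that contains the apex of i: its child on the side of that
apex is smaller, hence can only be i. -/
lemma exists_parent (h : T.Valid r) {i : Fin n} (hi : i ≠ r) :
    ∃ p, (T.o i = T.o p ∧ T.e i = T.m p) ∨ (T.o i = T.m p ∧ T.e i = T.e p) := by
  have := h.lt_m i; have := h.m_lt i; have := h.e_le i
  obtain ⟨t, ⟨hti, h1, h2⟩, hmin⟩ := T.exists_smallest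
    (fun t => t ≠ i ∧ T.o t < T.m i ∧ T.m i < T.e t)
    ⟨hi.symm, by rw [h.root_o]; omega, by rw [h.root_e]; omega⟩
  have hne : T.m i ≠ T.m t := fun h' => hti (h.inj i t h').symm
  have := h.lt_m t; have := h.m_lt t
  refine ⟨t, ?_⟩
  rcases lt_or_gt_of_ne hne with hlt | hlt
  · obtain ⟨j, hj1, hj2⟩ := h.left t (by omega)
    by_cases hji : j = i
    · subst hji; exact Or.inl ⟨hj1, hj2⟩
    · have := hmin j ⟨hji, by omega, by omega⟩; omega
  · obtain ⟨j, hj1, hj2⟩ := h.right t (by omega)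
    by_cases hji : j = i
    · subst hji; exact Or.inr ⟨hj1, hj2⟩
    · have := hmin j ⟨hji, by omega, by omega⟩; omega

/-- Consider the smallest node t around both apexes. If both lay on the same side of the apex of t,
a child of t would be smaller; so t is one of the two nodes or its apex separates their segments. In
no case do they cross. -/
lemma noncross (h : T.Valid r) (i j : Fin n) :
    ¬ (T.o i < T.o j ∧ T.o j < T.e i ∧ T.e i < T.e j) := by
  rintro ⟨h1, h2, h3⟩
  have := h.lt_m i; have := h.m_lt i; have := h.e_le i
  have := h.lt_m j; have := h.m_lt j; have := h.e_le j
  have hij : T.m i ≠ T.m j := fun h' => by have := h.inj i j h'; subst this; omega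
  obtain ⟨t, ⟨ha, hb, hc, hd⟩, hmin⟩ := T.exists_smallest
    (fun t => T.o t < T.m i ∧ T.m i < T.e t ∧ T.o t < T.m j ∧ T.m j < T.e t)
    ⟨by rw [h.root_o]; omega, by rw [h.root_e]; omega, by rw [h.root_o]; omega,
      by rw [h.root_e]; omega⟩
  have := h.lt_m t; have := h.m_lt t
  have l1 := h.nestL t i; have l2 := h.nestR t i
  have l3 := h.nestL t j; have l4 := h.nestR t j
  by_cases hti : T.m i = T.m t
  · have := h.inj i t hti; subst this; omega
  by_cases htj : T.m j = T.m t
  · have := h.inj j t htj; subst this; omega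
  by_cases c1 : T.m i < T.m t ∧ T.m j < T.m t
  · obtain ⟨s, hs1, hs2⟩ := h.left t (by omega)
    have := hmin s ⟨by omega, by omega, by omega, by omega⟩; omega
  by_cases c2 : T.m t < T.m i ∧ T.m t < T.m j
  · obtain ⟨s, hs1, hs2⟩ := h.right t (by omega)
    have := hmin s ⟨by omega, by omega, by omega, by omega⟩; omega
  omega

end Valid

/-! ### Flips as tree rotations -/

/-- `T'` is obtained from `T` by the flip of the left child `k` of `p`. -/
structure FlipLeft (T T' : Tri n) (k p : Fin n) : Prop where
  ok : T'.o k = T.m k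
  ek : T'.e k = T.e p
  m_k : T'.m k = T.m p
  op : T'.o p = T.o p
  ep : T'.e p = T.e p
  mp : T'.m p = T.m k
  oi : ∀ i, i ≠ k → i ≠ p → T'.o i = T.o i
  ei : ∀ i, i ≠ k → i ≠ p → T'.e i = T.e i
  mi : ∀ i, i ≠ k → i ≠ p → T'.m i = T.m i

/-- `T'` is obtained from `T` by the flip of the right child `k` of `p`. -/
structure FlipRight (T T' : Tri n) (k p : Fin n) : Prop where
  ok : T'.o k = T.o p
  ek : T'.e k = T.m k
  m_k : T'.m k = T.m p
  op : T'.o p = T.o p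
  ep : T'.e p = T.e p
  mp : T'.m p = T.m k
  oi : ∀ i, i ≠ k → i ≠ p → T'.o i = T.o i
  ei : ∀ i, i ≠ k → i ≠ p → T'.e i = T.e i
  mi : ∀ i, i ≠ k → i ≠ p → T'.m i = T.m i

lemma exists_flipLeft (T : Tri n) {k p : Fin n} (hkp : k ≠ p) : ∃ T', FlipLeft T T' k p := by
  refine ⟨⟨Function.update T.o k (T.m k), Function.update T.e k (T.e p),
    Function.update (Function.update T.m k (T.m p)) p (T.m k)⟩, ?_⟩
  constructor <;> simp +contextual [hkp, hkp.symm]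

lemma exists_flipRight (T : Tri n) {k p : Fin n} (hkp : k ≠ p) : ∃ T', FlipRight T T' k p := by
  refine ⟨⟨Function.update T.o k (T.o p), Function.update T.e k (T.m k),
    Function.update (Function.update T.m k (T.m p)) p (T.m k)⟩, ?_⟩
  constructor <;> simp +contextual [hkp, hkp.symm]

/-- The flip of the root `r`: the base point moves to the apex of the root, and the two subtrees of
the root are exchanged. -/
def flipRoot (T : Tri n) (r : Fin n) : Tri n where
  o i := if i = r then 0 else if T.m i < T.m r then T.o i + (n + 1 - T.m r) else T.o i - T.m r
  e i := if i = r then n + 1 else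
    if T.m i < T.m r then T.e i + (n + 1 - T.m r) else T.e i - T.m r
  m i := if i = r then n + 1 - T.m r else
    if T.m i < T.m r then T.m i + (n + 1 - T.m r) else T.m i - T.m r

variable {T T' : Tri n} {r k p : Fin n}

/-- This is the tree rotation that replaces the diagonal from `T.o p` to `T.m p` of the
quadrilateral `T.o p`, `T.m k`, `T.m p`, `T.e p` by the one from `T.m k` to `T.e p`. The node k
becomes the right child of p, the two exchange their apexes, and all other nodes stay. -/
lemma FlipLeft.valid (hF : FlipLeft T T' k p) (h : T.Valid r) (hkp : k ≠ p)
    (ho : T.o k = T.o p) (he : T.e k = T.m p) : T'.Valid r := by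
  have b1 := h.lt_m k; have b2 := h.m_lt k; have b3 := h.lt_m p; have b4 := h.m_lt p
  have b5 := h.e_le p
  obtain ⟨ok, ek, m_k, op, ep, mp, oi, ei, mi⟩ := hF
  have hkr : k ≠ r := by rintro rfl; have := h.root_e; omega
  have cases : ∀ i, i = k ∨ i = p ∨ (T'.o i = T.o i ∧ T'.e i = T.e i ∧ T'.m i = T.m i ∧
      i ≠ k ∧ i ≠ p ∧ T.m i ≠ T.m k ∧ T.m i ≠ T.m p) := by
    intro i
    by_cases h1 : i = k
    · exact Or.inl h1
    by_cases h2 : i = p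
    · exact Or.inr (Or.inl h2)
    exact Or.inr (Or.inr ⟨oi i h1 h2, ei i h1 h2, mi i h1 h2, h1, h2,
      fun h' => h1 (h.inj i k h'), fun h' => h2 (h.inj i p h')⟩)
  have arcs : ∀ i, i ≠ k → T'.o i = T.o i ∧ T'.e i = T.e i := by
    intro i hi
    rcases cases i with rfl | rfl | h1
    · exact absurd rfl hi
    · exact ⟨op, ep⟩
    · exact ⟨h1.1, h1.2.1⟩
  constructor
  · intro i
    have := h.lt_m i
    rcases cases i with rfl | rfl | h1 <;> omega
  · intro i
    have := h.m_lt i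
    rcases cases i with rfl | rfl | h1 <;> omega
  · intro i
    have := h.e_le i
    rcases cases i with rfl | rfl | h1 <;> omega
  · rw [(arcs r hkr.symm).1]; exact h.root_o
  · rw [(arcs r hkr.symm).2]; exact h.root_e
  · intro i j hij
    have h0 := h.inj i j
    rcases cases i with rfl | rfl | h1 <;> rcases cases j with rfl | rfl | h2 <;>
      first | rfl | omega
  · intro i hi
    rcases cases i with rfl | rfl | h1
    -- The old right subtree of k becomes the left subtree of k; below, the old left subtree of k
    -- becomes the left subtree of p, and the old right subtree of p the right subtree of k.
    · obtain ⟨j, hj1, hj2⟩ := h.right i (by omega)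
      have := arcs j (by rintro rfl; omega)
      exact ⟨j, by omega, by omega⟩
    · obtain ⟨j, hj1, hj2⟩ := h.left k (by omega)
      have := arcs j (by rintro rfl; omega)
      exact ⟨j, by omega, by omega⟩
    · obtain ⟨j, hj1, hj2⟩ := h.left i (by omega)
      have := arcs j (by rintro rfl; omega)
      exact ⟨j, by omega, by omega⟩
  · intro i hi
    rcases cases i with rfl | rfl | h1
    · obtain ⟨j, hj1, hj2⟩ := h.right p (by omega)
      have := arcs j (by rintro rfl; omega)
      exact ⟨j, by omega, by omega⟩
    · exact ⟨k, by omega, by omega⟩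
    · obtain ⟨j, hj1, hj2⟩ := h.right i (by omega)
      have := h.noncross i p
      have := h.lt_m i
      have := arcs j (by rintro rfl; omega)
      exact ⟨j, by omega, by omega⟩
  · intro i j h1 h2
    have := h.lt_m j; have := h.m_lt j
    rcases cases i with rfl | rfl | hi <;> rcases cases j with rfl | rfl | hj
    · omega
    · omega
    · have := h.nestR i j; omega
    · omega
    · omega
    · have := h.nestL k j; omega
    · have := h.nestL i p; omega
    · have := h.nestL i k; have := h.nestL i j; omega
    · have := h.nestL i j; omega
  · intro i j h1 h2
    have := h.lt_m j; have := h.m_lt j; have := h.lt_m i; have := h.m_lt i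
    rcases cases i with rfl | rfl | hi <;> rcases cases j with rfl | rfl | hj
    · omega
    · omega
    · have := h.nestR p j; omega
    · omega
    · omega
    · have := h.nestR k j; have := h.nestR i j; omega
    · have := h.nestR i p; omega
    · have := h.nestR i k; have := h.nestR i j; have := h.noncross i j; omega
    · have := h.nestR i j; omega

/-- The mirror image of a tree. -/
def mirror (T : Tri n) : Tri n where
  o i := n + 1 - T.e i
  e i := n + 1 - T.o i
  m i := n + 1 - T.m i

lemma Valid.mirror (h : T.Valid r) : T.mirror.Valid r := by
  have bd : ∀ i, T.o i < T.m i ∧ T.m i < T.e i ∧ T.e i ≤ n + 1 :=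
    fun i => ⟨h.lt_m i, h.m_lt i, h.e_le i⟩
  have := h.root_o; have := h.root_e
  constructor <;> simp only [Tri.mirror]
  · intro i; have := bd i; omega
  · intro i; have := bd i; omega
  · intro i; have := bd i; omega
  · omega
  · omega
  · intro i j hij; have := bd i; have := bd j; exact h.inj i j (by omega)
  · intro i hi
    have := bd i
    obtain ⟨j, h1, h2⟩ := h.right i (by omega)
    have := bd j
    exact ⟨j, by omega, by omega⟩
  · intro i hi
    have := bd i
    obtain ⟨j, h1, h2⟩ := h.left i (by omega)
    have := bd j
    exact ⟨j, by omega, by omega⟩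
  · intro i j h1 h2
    have := bd i; have := bd j; have := h.nestR i j (by omega) (by omega); omega
  · intro i j h1 h2
    have := bd i; have := bd j; have := h.nestL i j (by omega) (by omega); omega

/-- The bounds are what makes the truncated subtraction an involution here. -/
lemma mirror_mirror (h : ∀ i, T.o i < T.m i ∧ T.m i < T.e i ∧ T.e i ≤ n + 1) :
    T.mirror.mirror = T := by
  ext i <;> have := h i <;> simp only [Tri.mirror] <;> omega

lemma FlipRight.valid (hF : FlipRight T T' k p) (h : T.Valid r) (hkp : k ≠ p)
    (ho : T.o k = T.m p) (he : T.e k = T.e p) : T'.Valid r := by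
  have bd : ∀ i, T.o i < T.m i ∧ T.m i < T.e i ∧ T.e i ≤ n + 1 :=
    fun i => ⟨h.lt_m i, h.m_lt i, h.e_le i⟩
  have bd' : ∀ i, T'.o i < T'.m i ∧ T'.m i < T'.e i ∧ T'.e i ≤ n + 1 := by
    intro i
    have := bd i; have := bd k; have := bd p
    by_cases hik : i = k
    · subst hik; have := hF.ok; have := hF.ek; have := hF.m_k; omega
    by_cases hip : i = p
    · subst hip; have := hF.op; have := hF.ep; have := hF.mp; omega
    · have := hF.oi i hik hip; have := hF.ei i hik hip; have := hF.mi i hik hip; omega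
  have hF' : FlipLeft T.mirror T'.mirror k p := by
    constructor <;> simp only [mirror]
    · rw [hF.ek]
    · rw [hF.ok]
    · rw [hF.m_k]
    · rw [hF.ep]
    · rw [hF.op]
    · rw [hF.mp]
    · intro i h1 h2; rw [hF.ei i h1 h2]
    · intro i h1 h2; rw [hF.oi i h1 h2]
    · intro i h1 h2; rw [hF.mi i h1 h2]
  have := (hF'.valid h.mirror hkp (by simp only [mirror]; omega) (by simp only [mirror]; omega)).mirror
  rwa [mirror_mirror bd'] at this

/-- Every other node lies entirely on one side of the apex of the root, so each subtree is
translated as a whole and the subtraction is exact. -/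
lemma Valid.flipRoot_cases (h : T.Valid r) (i : Fin n) :
    (i = r ∧ (T.flipRoot r).o i = 0 ∧ (T.flipRoot r).e i = n + 1 ∧
      (T.flipRoot r).m i = n + 1 - T.m r) ∨
    (i ≠ r ∧ T.e i ≤ T.m r ∧ (T.flipRoot r).o i = T.o i + (n + 1 - T.m r) ∧
      (T.flipRoot r).e i = T.e i + (n + 1 - T.m r) ∧
      (T.flipRoot r).m i = T.m i + (n + 1 - T.m r)) ∨
    (i ≠ r ∧ T.m r ≤ T.o i ∧ (T.flipRoot r).o i = T.o i - T.m r ∧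
      (T.flipRoot r).e i = T.e i - T.m r ∧ (T.flipRoot r).m i = T.m i - T.m r) := by
  have := h.root_o; have := h.root_e; have := h.lt_m i; have := h.m_lt i; have := h.e_le i
  by_cases hi : i = r
  · exact Or.inl (by simp [flipRoot, hi])
  have hne : T.m i ≠ T.m r := fun h' => hi (h.inj i r h')
  by_cases hlt : T.m i < T.m r
  · have := h.nestL r i (by omega) hlt
    exact Or.inr (Or.inl ⟨hi, this.2, by simp [flipRoot, hi, hlt]⟩)
  · have := h.nestR r i (by omega) (by omega)
    exact Or.inr (Or.inr ⟨hi, this.1, by simp [flipRoot, hi, hlt]⟩)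

lemma Valid.flipRoot (h : T.Valid r) : (T.flipRoot r).Valid r := by
  have r1 := h.root_o; have r2 := h.root_e; have r3 := h.lt_m r; have r4 := h.m_lt r
  have cases := h.flipRoot_cases
  have hr := cases r
  have bd : ∀ i, T.o i < T.m i ∧ T.m i < T.e i ∧ T.e i ≤ n + 1 :=
    fun i => ⟨h.lt_m i, h.m_lt i, h.e_le i⟩
  constructor
  · intro i; have := cases i; have := bd i; omega
  · intro i; have := cases i; have := bd i; omega
  · intro i; have := cases i; have := bd i; omega
  · omega
  · omega
  · intro i j hij
    have h0 := h.inj i j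
    have := bd i; have := bd j
    rcases cases i with hi | hi | hi <;> rcases cases j with hj | hj | hj <;>
      omega
  · intro i hi
    have := bd i
    rcases cases i with ci | ci | ci
    · obtain ⟨j, hj1, hj2⟩ := h.right r (by omega)
      refine ⟨j, ?_⟩
      have := bd j
      have : j ≠ r := by rintro rfl; omega
      have := cases j
      omega
    · obtain ⟨j, hj1, hj2⟩ := h.left i (by omega)
      refine ⟨j, ?_⟩
      have := bd j
      have : j ≠ r := by rintro rfl; omega
      have := cases j
      omega
    · obtain ⟨j, hj1, hj2⟩ := h.left i (by omega)
      refine ⟨j, ?_⟩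
      have := bd j
      have : j ≠ r := by rintro rfl; omega
      have := cases j
      omega
  · intro i hi
    have := bd i
    rcases cases i with ci | ci | ci
    · obtain ⟨j, hj1, hj2⟩ := h.left r (by omega)
      refine ⟨j, ?_⟩
      have := bd j
      have : j ≠ r := by rintro rfl; omega
      have := cases j
      omega
    · obtain ⟨j, hj1, hj2⟩ := h.right i (by omega)
      refine ⟨j, ?_⟩
      have := bd j
      have : j ≠ r := by rintro rfl; omega
      have := cases j
      omega
    · obtain ⟨j, hj1, hj2⟩ := h.right i (by omega)
      refine ⟨j, ?_⟩
      have := bd j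
      have : j ≠ r := by rintro rfl; omega
      have := cases j
      omega
  · intro i j h1 h2
    have := bd i; have := bd j; have := h.nestL i j
    rcases cases i with hi | hi | hi <;> rcases cases j with hj | hj | hj <;> omega
  · intro i j h1 h2
    have := bd i; have := bd j; have := h.nestR i j
    rcases cases i with hi | hi | hi <;> rcases cases j with hj | hj | hj <;> omega

/-- If a segment is not a segment of the tree, then the node below one of its end points crosses
it. -/
lemma Valid.exists_crossing (h : T.Valid r) {p q : ℕ} (hpq : p + 2 ≤ q) (hq : q ≤ n + 1)
    (hT : ∀ i, ¬ (T.o i = p ∧ T.e i = q)) :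
    ∃ k, (T.m k = p ∧ T.e k < q) ∨ (T.m k = q ∧ p < T.o k) := by
  -- If nothing crossed, the node with apex p would reach at least to q and the node with apex q at
  -- least back to p. By nesting, one of them would end exactly at the other end point, and its
  -- child there would be the excluded segment.
  by_contra! hcon
  have hr := hT r
  have := h.root_o; have := h.root_e
  rcases Nat.eq_zero_or_pos p with rfl | hp
  · obtain ⟨s, hs⟩ := h.exists_apex (p := q) (by omega) (by omega)
    have := (hcon s).2 hs
    obtain ⟨j, hj1, hj2⟩ := h.left s (by omega)
    have := hT j
    omega
  · obtain ⟨t, ht⟩ := h.exists_apex hp (by omega)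
    have h1 := (hcon t).1 ht
    have := h.lt_m t; have := h.e_le t
    obtain ⟨j, hj1, hj2⟩ := h.right t (by omega)
    have := hT j
    obtain ⟨s, hs⟩ := h.exists_apex (p := q) (by omega) (by omega)
    have := (hcon s).2 hs
    have := h.m_lt s
    by_cases hsp : T.o s = p
    · obtain ⟨i, hi1, hi2⟩ := h.left s (by omega)
      have := hT i
      omega
    · have := h.nestL s t; have := h.nestR t s
      omega

end Tri

/-! ### The exchange matrix of a tree -/

namespace Tri

variable {n : ℕ} {T T' : Tri n} {r k p : Fin n}

/-- The indicator function of the node with end points `u`, `v`. -/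
def side (T : Tri n) (u v : ℕ) (j : Fin n) : ℤ := if T.o j = u ∧ T.e j = v then 1 else 0

/-- The contribution of the triangle below the node `t` to the signed adjacency matrix. -/
def triangle (T : Tri n) (t i j : Fin n) : ℤ :=
  (T.side (T.o t) (T.m t) i * T.side (T.o t) (T.e t) j -
    T.side (T.o t) (T.e t) i * T.side (T.o t) (T.m t) j) +
  (T.side (T.o t) (T.e t) i * T.side (T.m t) (T.e t) j -
    T.side (T.m t) (T.e t) i * T.side (T.o t) (T.e t) j) +
  (T.side (T.m t) (T.e t) i * T.side (T.o t) (T.m t) j -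
    T.side (T.o t) (T.m t) i * T.side (T.m t) (T.e t) j)

/-- The signed adjacency matrix of the nodes of `T`. -/
def adj (T : Tri n) (i j : Fin n) : ℤ := ∑ t, T.triangle t i j

lemma adj_skew (T : Tri n) (i j : Fin n) : T.adj j i = - T.adj i j := by
  rw [adj, adj, ← Finset.sum_neg_distrib]
  exact Finset.sum_congr rfl fun t _ => by simp only [triangle]; ring

lemma side_eq_zero {u v : ℕ} {j : Fin n} (h : ¬ (T.o j = u ∧ T.e j = v)) : T.side u v j = 0 :=
  if_neg h

lemma side_eq_one {u v : ℕ} {j : Fin n} (h : T.o j = u ∧ T.e j = v) : T.side u v j = 1 :=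
  if_pos h

lemma side_cases (T : Tri n) (u v : ℕ) (j : Fin n) :
    (T.side u v j = 1 ∧ T.o j = u ∧ T.e j = v) ∨
      (T.side u v j = 0 ∧ ¬ (T.o j = u ∧ T.e j = v)) := by
  by_cases h : T.o j = u ∧ T.e j = v
  · exact Or.inl ⟨side_eq_one h, h⟩
  · exact Or.inr ⟨side_eq_zero h, h⟩

lemma Valid.side_ne (h : T.Valid r) {t i : Fin n} (hti : i ≠ t) :
    T.side (T.o t) (T.e t) i = 0 :=
  side_eq_zero fun h' => hti (h.arc_inj h'.1 h'.2)

/-- The triangles that have the left child `k` of `p` as a side. -/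
lemma Valid.triangle_left (h : T.Valid r) (ho : T.o k = T.o p) (he : T.e k = T.m p)
    {t : Fin n} (htk : t ≠ k) (htp : t ≠ p) :
    T.side (T.o t) (T.m t) k = 0 ∧ T.side (T.m t) (T.e t) k = 0 ∧
      T.side (T.o t) (T.e t) k = 0 := by
  refine ⟨side_eq_zero fun h' => htp (h.inj t p (by omega)), side_eq_zero fun h' => ?_,
    h.side_ne htk.symm⟩
  have := h.noncross t p; have := h.lt_m t; have := h.m_lt t; have := h.m_lt p
  omega

/-- The triangles that have the right child `k` of `p` as a side. -/
lemma Valid.triangle_right (h : T.Valid r) (ho : T.o k = T.m p) (he : T.e k = T.e p)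
    {t : Fin n} (htk : t ≠ k) (htp : t ≠ p) :
    T.side (T.o t) (T.m t) k = 0 ∧ T.side (T.m t) (T.e t) k = 0 ∧
      T.side (T.o t) (T.e t) k = 0 := by
  refine ⟨side_eq_zero fun h' => ?_, side_eq_zero fun h' => htp (h.inj t p (by omega)),
    h.side_ne htk.symm⟩
  have := h.noncross p t; have := h.m_lt t; have := h.lt_m p; have := h.m_lt p
  omega

/-- The root is a side only of the triangle below it: the two triangles along the diameter are
identified by the symmetry. -/
lemma Valid.adj_root (h : T.Valid r) (i : Fin n) :
    T.adj i r = T.side (T.o r) (T.m r) i - T.side (T.m r) (T.e r) i := by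
  have r1 := h.root_o; have r2 := h.root_e
  have hz : ∀ t, T.side (T.o t) (T.m t) r = 0 ∧ T.side (T.m t) (T.e t) r = 0 := fun t => by
    have := h.lt_m t; have := h.m_lt t; have := h.e_le t
    exact ⟨side_eq_zero (by omega), side_eq_zero (by omega)⟩
  rw [adj, Finset.sum_eq_single r]
  · rw [triangle, (hz r).1, (hz r).2, side_eq_one ⟨rfl, rfl⟩]; ring
  · intro t _ ht
    rw [triangle, (hz t).1, (hz t).2, h.side_ne ht.symm]; ring
  · simp

/-- The node k borders exactly the triangles below k and below its parent p; the four terms are the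
sides of their union, with opposite sides of equal sign. -/
lemma Valid.adj_left (h : T.Valid r) (hkp : k ≠ p) (ho : T.o k = T.o p) (he : T.e k = T.m p)
    (i : Fin n) :
    T.adj i k = (T.side (T.o k) (T.m k) i + T.side (T.m p) (T.e p) i) -
      (T.side (T.m k) (T.e k) i + T.side (T.o p) (T.e p) i) := by
  have := h.lt_m k; have := h.m_lt k; have := h.lt_m p; have := h.m_lt p
  have k1 : T.side (T.o k) (T.m k) k = 0 := side_eq_zero (by omega)
  have k2 : T.side (T.m k) (T.e k) k = 0 := side_eq_zero (by omega)
  have k3 : T.side (T.o k) (T.e k) k = 1 := side_eq_one ⟨rfl, rfl⟩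
  have p1 : T.side (T.o p) (T.m p) k = 1 := side_eq_one ⟨ho, he⟩
  have p2 : T.side (T.m p) (T.e p) k = 0 := side_eq_zero (by omega)
  have p3 : T.side (T.o p) (T.e p) k = 0 := h.side_ne hkp
  rw [adj, Finset.sum_eq_add k p hkp]
  · rw [triangle, triangle, k1, k2, k3, p1, p2, p3]; ring
  · intro t _ ht
    obtain ⟨t1, t2, t3⟩ := h.triangle_left ho he ht.1 ht.2
    rw [triangle, t1, t2, t3]; ring
  · simp
  · simp

lemma Valid.adj_right (h : T.Valid r) (hkp : k ≠ p) (ho : T.o k = T.m p) (he : T.e k = T.e p)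
    (i : Fin n) :
    T.adj i k = (T.side (T.o k) (T.m k) i + T.side (T.o p) (T.e p) i) -
      (T.side (T.m k) (T.e k) i + T.side (T.o p) (T.m p) i) := by
  have := h.lt_m k; have := h.m_lt k; have := h.lt_m p; have := h.m_lt p
  have k1 : T.side (T.o k) (T.m k) k = 0 := side_eq_zero (by omega)
  have k2 : T.side (T.m k) (T.e k) k = 0 := side_eq_zero (by omega)
  have k3 : T.side (T.o k) (T.e k) k = 1 := side_eq_one ⟨rfl, rfl⟩
  have p1 : T.side (T.o p) (T.m p) k = 0 := side_eq_zero (by omega)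
  have p2 : T.side (T.m p) (T.e p) k = 1 := side_eq_one ⟨ho, he⟩
  have p3 : T.side (T.o p) (T.e p) k = 0 := h.side_ne hkp
  rw [adj, Finset.sum_eq_add k p hkp]
  · rw [triangle, triangle, k1, k2, k3, p1, p2, p3]; ring
  · intro t _ ht
    obtain ⟨t1, t2, t3⟩ := h.triangle_right ho he ht.1 ht.2
    rw [triangle, t1, t2, t3]; ring
  · simp
  · simp

/-- `β'` is the mutation of the skew-symmetric matrix `β` at `k`, where the positive and the
negative part of the column `k` are `P` and `M`, and `d` is the degree of the exchange
polynomial. -/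
structure MutRel (β β' : Fin n → Fin n → ℤ) (k : Fin n) (d : ℤ) (P M : Fin n → ℤ) : Prop where
  skew : ∀ i j, β j i = - β i j
  skew' : ∀ i j, β' j i = - β' i j
  col : ∀ i, β i k = P i - M i
  col' : ∀ i, β' i k = M i - P i
  ne : ∀ i j, i ≠ k → j ≠ k → β' i j = β i j + d * (P i * M j - M i * P j)
  pos : ∀ i, (P i = 0 ∧ M i = 0) ∨ (P i = 1 ∧ M i = 0) ∨ (P i = 0 ∧ M i = 1)

lemma MutRel.reverse {β β' : Fin n → Fin n → ℤ} {d : ℤ} {P M : Fin n → ℤ}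
    (h : MutRel β β' k d P M) : MutRel β' β k d M P where
  skew := h.skew'
  skew' := h.skew
  col := h.col'
  col' := h.col
  ne i j hi hj := by rw [h.ne i j hi hj]; ring
  pos i := by have := h.pos i; omega

/-- Only the triangles below k and p change. Apart from k, their sides are the same four sides of
the quadrilateral before and after. -/
lemma FlipLeft.mutRel (hF : FlipLeft T T' k p) (h : T.Valid r) (hkp : k ≠ p)
    (ho : T.o k = T.o p) (he : T.e k = T.m p) :
    MutRel T.adj T'.adj k 1 (fun i => T.side (T.o k) (T.m k) i + T.side (T.m p) (T.e p) i)
      (fun i => T.side (T.m k) (T.e k) i + T.side (T.o p) (T.e p) i) := by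
  have h' := hF.valid h hkp ho he
  obtain ⟨ok, ek, m_k, op, ep, mp, oi, ei, mi⟩ := hF
  have b1 := h.lt_m k; have b2 := h.m_lt k; have b3 := h.lt_m p; have b4 := h.m_lt p
  have hs : ∀ u v i, i ≠ k → T'.side u v i = T.side u v i := by
    intro u v i hi
    by_cases hip : i = p
    · subst hip; simp only [side, op, ep]
    · simp only [side, oi i hi hip, ei i hi hip]
  refine ⟨T.adj_skew, T'.adj_skew, h.adj_left hkp ho he, fun i => ?_, fun i j hi hj => ?_,
    fun i => ?_⟩
  · rw [h'.adj_right hkp (by omega) (by omega), ok, ek, m_k, op, ep, mp, ← ho, ← he]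
    by_cases hi : i = k
    · subst hi
      simp only [side]
      rw [if_neg (by omega), if_neg (by omega), if_neg (by omega), if_neg (by omega),
        if_neg (by omega), if_neg (by omega), if_neg (by omega), if_neg (by omega)]
    · rw [hs _ _ i hi, hs _ _ i hi, hs _ _ i hi, hs _ _ i hi]; ring
  · have hd : T'.adj i j - T.adj i j = ∑ t, (T'.triangle t i j - T.triangle t i j) := by
      rw [adj, adj, Finset.sum_sub_distrib]
    have hT : T'.adj i j = T.adj i j + ∑ t, (T'.triangle t i j - T.triangle t i j) := by
      rw [← hd]; ring
    rw [hT, Finset.sum_eq_add k p hkp]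
    · simp only [triangle, ok, ek, m_k, op, ep, mp]
      have z : ∀ i, i ≠ k → T.side (T.m k) (T.e p) i = 0 ∧ T.side (T.o k) (T.e k) i = 0 :=
        fun i hi => ⟨by rw [← hs _ _ i hi, ← ok, ← ek]; exact h'.side_ne hi, h.side_ne hi⟩
      rw [hs _ _ i hi, hs _ _ i hi, hs _ _ i hi, hs _ _ i hi, hs _ _ i hi, hs _ _ j hj,
        hs _ _ j hj, hs _ _ j hj, hs _ _ j hj, hs _ _ j hj, (z i hi).1, (z j hj).1,
        (z i hi).2, (z j hj).2, ← ho, ← he, (z i hi).2, (z j hj).2]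
      ring
    · intro t _ ht
      have e1 := oi t ht.1 ht.2
      have e2 := ei t ht.1 ht.2
      have e3 := mi t ht.1 ht.2
      simp only [triangle, e1, e2, e3, hs _ _ i hi, hs _ _ j hj, sub_self]
    · simp
    · simp
  · have := T.side_cases (T.o k) (T.m k) i; have := T.side_cases (T.m p) (T.e p) i
    have := T.side_cases (T.m k) (T.e k) i; have := T.side_cases (T.o p) (T.e p) i
    omega

lemma FlipRight.reverse (hF : FlipRight T T' k p) (ho : T.o k = T.m p) (he : T.e k = T.e p) :
    FlipLeft T' T k p where
  ok := by rw [ho, hF.m_k]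
  ek := by rw [he, hF.ep]
  m_k := hF.mp.symm
  op := hF.op.symm
  ep := hF.ep.symm
  mp := hF.m_k.symm
  oi i h1 h2 := (hF.oi i h1 h2).symm
  ei i h1 h2 := (hF.ei i h1 h2).symm
  mi i h1 h2 := (hF.mi i h1 h2).symm

lemma FlipRight.mutRel (hF : FlipRight T T' k p) (h : T.Valid r) (hkp : k ≠ p)
    (ho : T.o k = T.m p) (he : T.e k = T.e p) :
    MutRel T.adj T'.adj k 1 (fun i => T.side (T.o k) (T.m k) i + T.side (T.o p) (T.e p) i)
      (fun i => T.side (T.m k) (T.e k) i + T.side (T.o p) (T.m p) i) := by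
  have h' := hF.valid h hkp ho he
  have := hF.ok; have := hF.ek; have := hF.op; have := hF.mp
  have hR := ((hF.reverse ho he).mutRel h' hkp (by omega) (by rw [hF.ek, hF.mp])).reverse
  have hcol := h.adj_right hkp ho he
  have b1 := h.lt_m k; have b2 := h.m_lt k; have b3 := h.lt_m p; have b4 := h.m_lt p
  have hpos : ∀ i, (T.side (T.o k) (T.m k) i + T.side (T.o p) (T.e p) i = 0 ∧
        T.side (T.m k) (T.e k) i + T.side (T.o p) (T.m p) i = 0) ∨
      (T.side (T.o k) (T.m k) i + T.side (T.o p) (T.e p) i = 1 ∧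
        T.side (T.m k) (T.e k) i + T.side (T.o p) (T.m p) i = 0) ∨
      (T.side (T.o k) (T.m k) i + T.side (T.o p) (T.e p) i = 0 ∧
        T.side (T.m k) (T.e k) i + T.side (T.o p) (T.m p) i = 1) := by
    intro i
    have := T.side_cases (T.o k) (T.m k) i; have := T.side_cases (T.o p) (T.e p) i
    have := T.side_cases (T.m k) (T.e k) i; have := T.side_cases (T.o p) (T.m p) i
    omega
  -- The positive and the negative part of a column have disjoint support and values 0, 1, so they
  -- are determined by their difference, the column of k itself. This identifies them with those of
  -- the reversed left flip.
  have e1 : ∀ i, T.side (T.o k) (T.m k) i + T.side (T.o p) (T.e p) i =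
      T'.side (T'.m k) (T'.e k) i + T'.side (T'.o p) (T'.e p) i := by
    intro i
    have := hR.col i; have := hcol i; have := hpos i; have := hR.pos i
    omega
  have e2 : ∀ i, T.side (T.m k) (T.e k) i + T.side (T.o p) (T.m p) i =
      T'.side (T'.o k) (T'.m k) i + T'.side (T'.m p) (T'.e p) i := by
    intro i
    have := hR.col i; have := hcol i; have := hpos i; have := hR.pos i
    omega
  simp only [e1, e2]
  exact hR

/-- Exchanging the two subtrees reverses the sign with which the triangle below the root relates its
two children; replacing −1 by 1 produces the degree 2. -/
lemma Valid.flipRoot_mutRel (h : T.Valid r) :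
    MutRel T.adj (T.flipRoot r).adj r 2 (fun i => T.side (T.o r) (T.m r) i)
      (fun i => T.side (T.m r) (T.e r) i) := by
  have h' := h.flipRoot
  have cases := h.flipRoot_cases
  have r1 := h.root_o; have r2 := h.root_e; have r3 := h.lt_m r; have r4 := h.m_lt r
  have bd : ∀ i, T.o i < T.m i ∧ T.m i < T.e i ∧ T.e i ≤ n + 1 :=
    fun i => ⟨h.lt_m i, h.m_lt i, h.e_le i⟩
  have hiff : ∀ {P Q : Prop} [Decidable P] [Decidable Q], (P ↔ Q) →
      (if P then (1 : ℤ) else 0) = if Q then 1 else 0 := by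
    intro P Q _ _ hPQ; simp only [hPQ]
  have cr : (T.flipRoot r).o r = 0 ∧ (T.flipRoot r).e r = n + 1 ∧
      (T.flipRoot r).m r = n + 1 - T.m r := by
    rcases cases r with hr | hr | hr
    · exact hr.2
    · exact absurd rfl hr.1
    · exact absurd rfl hr.1
  have f1 : ∀ i, (T.flipRoot r).side ((T.flipRoot r).o r) ((T.flipRoot r).m r) i =
      T.side (T.m r) (T.e r) i := fun i => hiff (by
    have := bd i
    rcases cases i with ⟨rfl, hi⟩ | hi | hi <;> omega)
  have f2 : ∀ i, (T.flipRoot r).side ((T.flipRoot r).m r) ((T.flipRoot r).e r) i =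
      T.side (T.o r) (T.m r) i := fun i => hiff (by
    have := bd i
    rcases cases i with ⟨rfl, hi⟩ | hi | hi <;> omega)
  refine ⟨T.adj_skew, adj_skew _, h.adj_root, fun i => ?_, fun i j hi hj => ?_, fun i => ?_⟩
  · rw [h'.adj_root, f1, f2]
  · have hd : (T.flipRoot r).adj i j - T.adj i j =
        ∑ t, ((T.flipRoot r).triangle t i j - T.triangle t i j) := by
      rw [adj, adj, Finset.sum_sub_distrib]
    have hT : (T.flipRoot r).adj i j =
        T.adj i j + ∑ t, ((T.flipRoot r).triangle t i j - T.triangle t i j) := by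
      rw [← hd]; ring
    rw [hT, Finset.sum_eq_single r]
    · simp only [triangle, f1, f2, h.side_ne hi, h.side_ne hj, h'.side_ne hi, h'.side_ne hj]
      ring
    · intro t _ ht
      have ct := cases t
      have bt := bd t
      have g1 : ∀ i, i ≠ r → (T.flipRoot r).side ((T.flipRoot r).o t) ((T.flipRoot r).m t) i =
          T.side (T.o t) (T.m t) i := fun i hi => hiff (by
        have := bd i
        rcases cases i with hi | hi | hi <;> omega)
      have g2 : ∀ i, i ≠ r → (T.flipRoot r).side ((T.flipRoot r).m t) ((T.flipRoot r).e t) i =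
          T.side (T.m t) (T.e t) i := fun i hi => hiff (by
        have := bd i
        rcases cases i with hi | hi | hi <;> omega)
      have g3 : ∀ i, i ≠ r → (T.flipRoot r).side ((T.flipRoot r).o t) ((T.flipRoot r).e t) i =
          T.side (T.o t) (T.e t) i := fun i hi => hiff (by
        have := bd i
        rcases cases i with hi | hi | hi <;> omega)
      simp only [triangle, g1 _ hi, g2 _ hi, g3 _ hi, g1 _ hj, g2 _ hj, g3 _ hj, sub_self]
    · simp
  · have := T.side_cases (T.o r) (T.m r) i; have := T.side_cases (T.m r) (T.e r) i
    omega

end Tri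

/-! ### Mutation of the seed of a tree -/

section Mutation

variable {n : ℕ}

lemma degC_eq_two {r : Fin n} (hr : (r : ℕ) + 1 = n) : degC n r = 2 := if_pos hr

lemma degC_eq_one {r k : Fin n} (hr : (r : ℕ) + 1 = n) (hk : k ≠ r) : degC n k = 1 :=
  if_neg fun h => hk (Fin.ext (by omega))

/-- The seed `s` consists of the continuants of the arcs of the tree `T` based at `a`. -/
structure TreeSeed (c : ZMod (n + 1) → Ambient n) (s : Seed (degC n)) (a : ZMod (n + 1))
    (T : Tri n) (r : Fin n) : Prop where
  valid : T.Valid r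
  x : ∀ i, s.x i = cont c (a + (T.o i : ℕ)) (T.e i - T.o i)
  p : s.p = (initialSeed n).p
  B : ∀ i j, s.B i j = T.adj i j * degC n j

/-- The outer coefficients of each exchange polynomial are 1, so the ratio is 1 and nothing needs
normalising; in direction k itself the tuple is reversed, and (1, 1) and (1, λ, 1) are palindromic.
-/
lemma mutate_p {s : Seed (degC n)} (hp : s.p = (initialSeed n).p) (k : Fin n) :
    (s.mutate k).p = (initialSeed n).p := by
  have h0 : s.p k 0 = 1 := by rw [hp]; simp [initialSeed]
  have h1 : s.p k (Fin.last _) = 1 := by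
    rw [hp]; simp only [initialSeed, Fin.val_last]
    refine if_neg fun h => ?_
    rw [degC_eq_two h.1] at h
    omega
  funext i q
  simp only [Seed.mutate]
  split_ifs with hik
  · rw [hp]
    simp only [initialSeed]
    by_cases hi : (i : ℕ) + 1 = n
    · have hd := degC_eq_two hi
      have : ((q.rev : Fin _) : ℕ) = degC n i - q := by rw [Fin.val_rev]; omega
      have hq := q.isLt
      rw [this]
      have : (degC n i - q = 1) ↔ (q : ℕ) = 1 := by omega
      simp only [this]
    · simp [hi]
  · have hpre : s.preCoeff k i = s.p i := by
      funext r'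
      simp only [Seed.preCoeff, Seed.ratio, h0, h1]
      simp
    rw [hpre, div_self', one_mul, hp]

/-- Separates the degrees d = d_k and D = d_j from the skew entries p and q of column k. For entries
0, ±1 both integer divisions by 2 are exact. -/
lemma natAbs_mutation {p q : ℤ} (hp : p = 0 ∨ p = 1 ∨ p = -1) (hq : q = 0 ∨ q = 1 ∨ q = -1)
    {d D : ℤ} (hd : 0 ≤ d) (hD : 0 ≤ D) :
    (|p * d| * (-q * D) + p * d * |-q * D|) / 2 = d * D * ((p * |q| - |p| * q) / 2) := by
  rw [abs_mul, abs_mul, abs_neg, abs_of_nonneg hd, abs_of_nonneg hD]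
  rcases hp with rfl | rfl | rfl <;> rcases hq with rfl | rfl | rfl <;> simp
  · rw [show d * D + d * D = d * D * 2 by ring]; simp
  · rw [show -(d * D) + -(d * D) = -(d * D) * 2 by ring, Int.mul_ediv_cancel _ two_ne_zero]

lemma mutate_B {s : Seed (degC n)} {β β' : Fin n → Fin n → ℤ} {k : Fin n} {P M : Fin n → ℤ}
    (hB : ∀ i j, s.B i j = β i j * degC n j) (h : Tri.MutRel β β' k (degC n k) P M) (i j : Fin n) :
    (s.mutate k).B i j = β' i j * degC n j := by
  simp only [Seed.mutate]
  split_ifs with hij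
  · rw [hB]
    rcases hij with rfl | rfl
    · rw [h.skew j i, h.skew' j i, h.col, h.col']; ring
    · rw [h.col, h.col']; ring
  · push Not at hij
    have hpi := h.pos i
    have hpj := h.pos j
    rw [hB, hB, hB, h.skew j k, h.col, h.col, h.ne i j hij.1 hij.2,
      natAbs_mutation (by omega) (by omega) (by positivity) (by positivity)]
    rcases hpi with ⟨h1, h2⟩ | ⟨h1, h2⟩ | ⟨h1, h2⟩ <;>
      rcases hpj with ⟨h3, h4⟩ | ⟨h3, h4⟩ | ⟨h3, h4⟩ <;> simp [h1, h2, h3, h4] <;> ring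

lemma theta_of_ne {s : Seed (degC n)} (hp : s.p = (initialSeed n).p) {r k : Fin n}
    (hr : (r : ℕ) + 1 = n) (hk : k ≠ r) (u v : Ambient n) : s.theta k u v = u + v := by
  have hne : ¬ (k : ℕ) + 1 = n := fun h => hk (Fin.ext (by omega))
  have h1 : coeffEmb n 1 = 1 := by
    simp [coeffEmb]
  simp only [Seed.theta, hp, initialSeed, hne, false_and, if_false, h1, one_mul]
  rw [Fin.sum_univ_eq_sum_range (fun t => u ^ t * v ^ (degC n k - t)), degC_eq_one hr hk]
  simp [Finset.sum_range_succ, add_comm]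

lemma theta_root {s : Seed (degC n)} (hp : s.p = (initialSeed n).p) {r : Fin n}
    (hr : (r : ℕ) + 1 = n) (u v : Ambient n) :
    s.theta r u v = u ^ 2 + lam n * u * v + v ^ 2 := by
  have h1 : coeffEmb n 1 = 1 := by
    simp [coeffEmb]
  simp only [Seed.theta, hp, initialSeed, hr, true_and]
  rw [Fin.sum_univ_eq_sum_range (fun t => coeffEmb n (if t = 1 then Tropical.trop 1 else 1) *
    u ^ t * v ^ (degC n r - t)), degC_eq_two hr]
  simp [Finset.sum_range_succ, h1, lam]
  ring

variable {c : ZMod (n + 1) → Ambient n} {s : Seed (degC n)} {a : ZMod (n + 1)} {T : Tri n}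
  {r : Fin n}

/-- Treats nodes and boundary edges alike: an edge of the polygon carries no variable, and its
continuant, of length 1, equals 1. -/
lemma TreeSeed.prod_side (h : TreeSeed c s a T r) {u v : ℕ}
    (huv : v = u + 1 ∨ u + 1 < v ∧ ∃ j, T.o j = u ∧ T.e j = v) :
    ∏ j, s.x j ^ (T.side u v j).toNat = cont c (a + (u : ℕ)) (v - u) := by
  by_cases hex : ∃ j, T.o j = u ∧ T.e j = v
  · obtain ⟨j, hj⟩ := hex
    rw [Finset.prod_eq_single j]
    · rw [Tri.side_eq_one hj, h.x, hj.1, hj.2]; simp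
    · intro i _ hij
      rw [Tri.side_eq_zero fun h' => hij (h.valid.arc_inj (by omega) (by omega))]; simp
    · simp
  · rcases huv with rfl | huv
    · rw [Finset.prod_eq_one fun j _ => by
        rw [Tri.side_eq_zero fun h' => hex ⟨j, h'⟩]; simp]
      simp
    · exact absurd huv.2 hex

lemma TreeSeed.beta (h : TreeSeed c s a T r) (j k : Fin n) : s.beta j k = T.adj j k := by
  rw [Seed.beta, h.B]
  refine Int.mul_ediv_cancel _ ?_
  rw [degC]; split_ifs <;> norm_num

lemma prod_toNat_add {x : Fin n → Ambient n} {f g : Fin n → ℤ} (hf : ∀ j, 0 ≤ f j)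
    (hg : ∀ j, 0 ≤ g j) :
    ∏ j, x j ^ (f j + g j).toNat = (∏ j, x j ^ (f j).toNat) * ∏ j, x j ^ (g j).toNat := by
  rw [← Finset.prod_mul_distrib]
  exact Finset.prod_congr rfl fun j _ => by rw [Int.toNat_add (hf j) (hg j), pow_add]

lemma side_nonneg (u v : ℕ) (j : Fin n) : 0 ≤ T.side u v j := by
  rcases T.side_cases u v j with h | h <;> omega

lemma TreeSeed.uPlus_eq (h : TreeSeed c s a T r) {β' : Fin n → Fin n → ℤ} {k : Fin n} {d : ℤ}
    {P M : Fin n → ℤ} (hm : Tri.MutRel T.adj β' k d P M) :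
    s.uPlus k = ∏ j, s.x j ^ (P j).toNat := by
  refine Finset.prod_congr rfl fun j _ => ?_
  rw [h.beta, hm.col]
  have := hm.pos j
  congr 1; omega

lemma TreeSeed.uMinus_eq (h : TreeSeed c s a T r) {β' : Fin n → Fin n → ℤ} {k : Fin n} {d : ℤ}
    {P M : Fin n → ℤ} (hm : Tri.MutRel T.adj β' k d P M) :
    s.uMinus k = ∏ j, s.x j ^ (M j).toNat := by
  refine Finset.prod_congr rfl fun j _ => ?_
  rw [h.beta, hm.col]
  have := hm.pos j
  congr 1; omega

lemma Tri.Valid.left_side (h : T.Valid r) (i : Fin n) : T.m i = T.o i + 1 ∨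
    T.o i + 1 < T.m i ∧ ∃ j, T.o j = T.o i ∧ T.e j = T.m i := by
  have := h.lt_m i
  rcases Nat.lt_or_ge (T.o i + 1) (T.m i) with h1 | h1
  · exact Or.inr ⟨h1, h.left i h1⟩
  · exact Or.inl (by omega)

lemma Tri.Valid.right_side (h : T.Valid r) (i : Fin n) : T.e i = T.m i + 1 ∨
    T.m i + 1 < T.e i ∧ ∃ j, T.o j = T.m i ∧ T.e j = T.e i := by
  have := h.m_lt i
  rcases Nat.lt_or_ge (T.m i + 1) (T.e i) with h1 | h1
  · exact Or.inr ⟨h1, h.right i h1⟩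
  · exact Or.inl (by omega)

lemma Tri.Valid.self_side (h : T.Valid r) (i : Fin n) : T.e i = T.o i + 1 ∨
    T.o i + 1 < T.e i ∧ ∃ j, T.o j = T.o i ∧ T.e j = T.e i :=
  Or.inr ⟨by have := h.lt_m i; have := h.m_lt i; omega, i, rfl, rfl⟩

lemma cont_ptolemy_of_le (c : ZMod (n + 1) → Ambient n) (a : ZMod (n + 1)) {t u v w : ℕ}
    (h1 : t ≤ u) (h2 : u ≤ v) (h3 : v ≤ w) :
    cont c (a + (t : ℕ)) (v - t) * cont c (a + (u : ℕ)) (w - u) =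
      cont c (a + (t : ℕ)) (u - t) * cont c (a + (v : ℕ)) (w - v) +
        cont c (a + (t : ℕ)) (w - t) * cont c (a + (u : ℕ)) (v - u) := by
  obtain ⟨x, rfl⟩ := Nat.exists_eq_add_of_le h1
  obtain ⟨y, rfl⟩ := Nat.exists_eq_add_of_le h2
  obtain ⟨z, rfl⟩ := Nat.exists_eq_add_of_le h3
  have := cont_ptolemy c (a + (t : ℕ)) x y z
  rw [show t + x + y - t = x + y by omega, show t + x + y + z - (t + x) = y + z by omega,
    show t + x - t = x by omega, show t + x + y + z - (t + x + y) = z by omega,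
    show t + x + y + z - t = x + y + z by omega, show t + x + y - (t + x) = y by omega]
  push_cast
  simp only [← add_assoc]
  linear_combination this

lemma TreeSeed.mutate_flipLeft (h : TreeSeed c s a T r) (hr : (r : ℕ) + 1 = n)
    (hc : ∀ a l, 0 < l → l ≤ n + 1 → cont c a l ≠ 0) {k p : Fin n} {T' : Tri n}
    (hF : Tri.FlipLeft T T' k p) (hkp : k ≠ p) (ho : T.o k = T.o p) (he : T.e k = T.m p) :
    TreeSeed c (s.mutate k) a T' r := by
  have b1 := h.valid.lt_m k; have b2 := h.valid.m_lt k; have b3 := h.valid.lt_m p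
  have b4 := h.valid.m_lt p
  have b5 := h.valid.e_le p
  have hkr : k ≠ r := by rintro rfl; have := h.valid.root_e; omega
  have hm := hF.mutRel h.valid hkp ho he
  refine ⟨hF.valid h.valid hkp ho he, fun i => ?_, mutate_p h.p k,
    mutate_B h.B (by rwa [degC_eq_one hr hkr])⟩
  simp only [Seed.mutate]
  by_cases hi : i = k
  · subst hi
    rw [Function.update_self, theta_of_ne h.p hr hkr, h.uPlus_eq hm, h.uMinus_eq hm,
      prod_toNat_add (side_nonneg _ _) (side_nonneg _ _),
      prod_toNat_add (side_nonneg _ _) (side_nonneg _ _),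
      h.prod_side (h.valid.left_side i), h.prod_side (h.valid.right_side p),
      h.prod_side (h.valid.right_side i), h.prod_side (h.valid.self_side p), h.x,
      div_eq_iff (hc _ _ (by omega) (by omega)), hF.ok, hF.ek]
    -- The exchange relation is the Plücker relation of the quadrilateral around the flipped
    -- diagonal.
    have := cont_ptolemy_of_le c a (t := T.o i) (u := T.m i) (v := T.e i) (w := T.e p)
      (by omega) (by omega) (by omega)
    rw [← ho, ← he]
    linear_combination -this
  · rw [Function.update_of_ne hi, h.x]
    by_cases hip : i = p
    · subst hip; rw [hF.op, hF.ep]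
    · rw [hF.oi i hi hip, hF.ei i hi hip]

lemma TreeSeed.mutate_flipRight (h : TreeSeed c s a T r) (hr : (r : ℕ) + 1 = n)
    (hc : ∀ a l, 0 < l → l ≤ n + 1 → cont c a l ≠ 0) {k p : Fin n} {T' : Tri n}
    (hF : Tri.FlipRight T T' k p) (hkp : k ≠ p) (ho : T.o k = T.m p) (he : T.e k = T.e p) :
    TreeSeed c (s.mutate k) a T' r := by
  have b1 := h.valid.lt_m k; have b2 := h.valid.m_lt k; have b3 := h.valid.lt_m p
  have b4 := h.valid.m_lt p
  have b5 := h.valid.e_le p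
  have hkr : k ≠ r := by rintro rfl; have := h.valid.root_o; omega
  have hm := hF.mutRel h.valid hkp ho he
  refine ⟨hF.valid h.valid hkp ho he, fun i => ?_, mutate_p h.p k,
    mutate_B h.B (by rwa [degC_eq_one hr hkr])⟩
  simp only [Seed.mutate]
  by_cases hi : i = k
  · subst hi
    rw [Function.update_self, theta_of_ne h.p hr hkr, h.uPlus_eq hm, h.uMinus_eq hm,
      prod_toNat_add (side_nonneg _ _) (side_nonneg _ _),
      prod_toNat_add (side_nonneg _ _) (side_nonneg _ _),
      h.prod_side (h.valid.left_side i), h.prod_side (h.valid.self_side p),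
      h.prod_side (h.valid.right_side i), h.prod_side (h.valid.left_side p), h.x,
      div_eq_iff (hc _ _ (by omega) (by omega)), hF.ok, hF.ek]
    have := cont_ptolemy_of_le c a (t := T.o p) (u := T.o i) (v := T.m i) (w := T.e i)
      (by omega) (by omega) (by omega)
    rw [← ho, ← he]
    linear_combination -this
  · rw [Function.update_of_ne hi, h.x]
    by_cases hip : i = p
    · subst hip; rw [hF.op, hF.ep]
    · rw [hF.oi i hi hip, hF.ei i hi hip]

/-- The shift of the nodes compensates the move of the base point modulo n + 1, so on the circle
only the arc of the root changes. -/
lemma Tri.Valid.flipRoot_arc (h : T.Valid r) (a : ZMod (n + 1)) {i : Fin n} (hi : i ≠ r) :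
    a + (T.m r : ℕ) + ((T.flipRoot r).o i : ℕ) = a + (T.o i : ℕ) ∧
      (T.flipRoot r).e i - (T.flipRoot r).o i = T.e i - T.o i := by
  have r2 := h.root_e; have r4 := h.m_lt r
  rcases h.flipRoot_cases i with hc | hc | hc
  · exact absurd hc.1 hi
  · refine ⟨?_, by omega⟩
    rw [hc.2.2.1, add_assoc, ← Nat.cast_add,
      show T.m r + (T.o i + (n + 1 - T.m r)) = T.o i + (n + 1) by omega, Nat.cast_add,
      ZMod.natCast_self, add_zero]
  · refine ⟨?_, by omega⟩
    rw [hc.2.2.1, add_assoc, ← Nat.cast_add, show T.m r + (T.o i - T.m r) = T.o i by omega]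

lemma TreeSeed.mutate_flipRoot (h : TreeSeed c s a T r) (hr : (r : ℕ) + 1 = n)
    (hc : ∀ a l, 0 < l → l ≤ n + 1 → cont c a l ≠ 0) (hlam : traceCont c 0 = lam n) :
    TreeSeed c (s.mutate r) (a + (T.m r : ℕ)) (T.flipRoot r) r := by
  have r1 := h.valid.root_o; have r2 := h.valid.root_e; have r3 := h.valid.lt_m r
  have r4 := h.valid.m_lt r
  have hm := h.valid.flipRoot_mutRel
  refine ⟨h.valid.flipRoot, fun i => ?_, mutate_p h.p r,
    mutate_B h.B (by rwa [degC_eq_two hr])⟩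
  simp only [Seed.mutate]
  by_cases hi : i = r
  · subst hi
    have h1 : (T.flipRoot i).o i = 0 := by simp [Tri.flipRoot]
    have h2 : (T.flipRoot i).e i = n + 1 := by simp [Tri.flipRoot]
    rw [Function.update_self, theta_root h.p hr, h.uPlus_eq hm, h.uMinus_eq hm,
      h.prod_side (h.valid.left_side i), h.prod_side (h.valid.right_side i), h.x,
      div_eq_iff (hc _ _ (by omega) (by omega)), h1, h2, r1, r2]
    have := cont_diameter c a (T.m i) (n + 1 - T.m i) (by omega)
    rw [traceCont_eq c a 0, hlam] at this
    simp only [Nat.cast_zero, add_zero, Nat.sub_zero]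
    linear_combination -this
  · rw [Function.update_of_ne hi, h.x, (h.valid.flipRoot_arc a hi).1,
      (h.valid.flipRoot_arc a hi).2]

end Mutation

/-! ### Flips of trees -/

namespace Tri

variable {n : ℕ} {a a' : ZMod (n + 1)} {T T' : Tri n} {r k : Fin n}

/-- The arc of the node `i` of the tree `T` based at `a`. -/
def arc (a : ZMod (n + 1)) (T : Tri n) (i : Fin n) : ZMod (n + 1) × ℕ :=
  (a + (T.o i : ℕ), T.e i - T.o i)

/-- The flip of the node `k` of the tree `T` based at `a` gives `T'`, based at `a'`. -/
inductive FlipStep (r : Fin n) :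
    ZMod (n + 1) → Tri n → ZMod (n + 1) → Tri n → Fin n → Prop
  | left (a : ZMod (n + 1)) (T T' : Tri n) (k p : Fin n) (hkp : k ≠ p)
      (ho : T.o k = T.o p) (he : T.e k = T.m p) (hF : FlipLeft T T' k p) : FlipStep r a T a T' k
  | right (a : ZMod (n + 1)) (T T' : Tri n) (k p : Fin n) (hkp : k ≠ p)
      (ho : T.o k = T.m p) (he : T.e k = T.e p) (hF : FlipRight T T' k p) : FlipStep r a T a T' k
  | root (a : ZMod (n + 1)) (T : Tri n) : FlipStep r a T (a + (T.m r : ℕ)) (T.flipRoot r) r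

lemma Valid.parent_ne (h : T.Valid r) {k p : Fin n}
    (hp : (T.o k = T.o p ∧ T.e k = T.m p) ∨ (T.o k = T.m p ∧ T.e k = T.e p)) : k ≠ p := by
  rintro rfl
  have := h.lt_m k; have := h.m_lt k
  omega

lemma Valid.exists_flipStep_of_ne (h : T.Valid r) (a : ZMod (n + 1)) (hk : k ≠ r) :
    ∃ T', FlipStep r a T a T' k := by
  obtain ⟨p, hp⟩ := h.exists_parent hk
  have hkp := h.parent_ne hp
  rcases hp with ⟨ho, he⟩ | ⟨ho, he⟩
  · obtain ⟨T', hT'⟩ := T.exists_flipLeft hkp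
    exact ⟨T', .left a T T' k p hkp ho he hT'⟩
  · obtain ⟨T', hT'⟩ := T.exists_flipRight hkp
    exact ⟨T', .right a T T' k p hkp ho he hT'⟩

lemma Valid.exists_flipStep (h : T.Valid r) (a : ZMod (n + 1)) (k : Fin n) :
    ∃ a' T', FlipStep r a T a' T' k := by
  by_cases hk : k = r
  · subst hk; exact ⟨_, _, .root a T⟩
  · exact ⟨a, h.exists_flipStep_of_ne a hk⟩

lemma FlipStep.valid (hF : FlipStep r a T a' T' k) (h : T.Valid r) : T'.Valid r := by
  cases hF with
  | left _ _ p hkp ho he hF => exact hF.valid h hkp ho he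
  | right _ _ p hkp ho he hF => exact hF.valid h hkp ho he
  | root => exact h.flipRoot

lemma FlipStep.of_ne (hF : FlipStep r a T a' T' k) (hk : k ≠ r) :
    a' = a ∧ (T'.o k = T.m k ∨ T'.e k = T.m k) ∧
      ∀ i, i ≠ k → T'.o i = T.o i ∧ T'.e i = T.e i := by
  cases hF with
  | left _ _ p hkp ho he hF =>
    refine ⟨rfl, Or.inl hF.ok, fun i hi => ?_⟩
    by_cases hip : i = p
    · subst hip; exact ⟨hF.op, hF.ep⟩
    · exact ⟨hF.oi i hi hip, hF.ei i hi hip⟩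
  | right _ _ p hkp ho he hF =>
    refine ⟨rfl, Or.inr hF.ek, fun i hi => ?_⟩
    by_cases hip : i = p
    · subst hip; exact ⟨hF.op, hF.ep⟩
    · exact ⟨hF.oi i hi hip, hF.ei i hi hip⟩
  | root => exact absurd rfl hk

lemma FlipStep.of_root (hF : FlipStep r a T a' T' r) (h : T.Valid r) :
    a' = a + (T.m r : ℕ) ∧ T' = T.flipRoot r := by
  cases hF with
  | left _ _ p hkp ho he hF =>
    have := h.root_e; have := h.m_lt p; have := h.e_le p; omega
  | right _ _ p hkp ho he hF =>
    have := h.root_o; have := h.lt_m p; omega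
  | root => exact ⟨rfl, rfl⟩

lemma FlipStep.arc_of_ne (hF : FlipStep r a T a' T' k) (h : T.Valid r) {i : Fin n} (hi : i ≠ k) :
    arc a' T' i = arc a T i := by
  by_cases hk : k = r
  · subst hk
    obtain ⟨rfl, rfl⟩ := hF.of_root h
    have := h.flipRoot_arc a hi
    exact Prod.ext this.1 this.2
  · obtain ⟨rfl, -, h3⟩ := hF.of_ne hk
    simp only [arc, (h3 i hi).1, (h3 i hi).2]

/-- Cutting the circle at a point that neither arc covers turns cyclic crossing into crossing of
intervals. -/
lemma crossArc_iff (a : ZMod (n + 1)) {o e o' e' : ℕ} (h1 : o < e) (h2 : e ≤ n + 1)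
    (h3 : o' < e') (h4 : e' ≤ n + 1) :
    CrossArc (a + (o : ZMod (n + 1)), e - o) (a + (o' : ZMod (n + 1)), e' - o') ↔
      o < o' ∧ o' < e ∧ e < e' := by
  have t := val_triangle a (a + (o : ZMod (n + 1))) (a + (o' : ZMod (n + 1)))
  rw [add_sub_cancel_left, add_sub_cancel_left, ZMod.val_cast_of_lt (by omega : o < n + 1),
    ZMod.val_cast_of_lt (by omega : o' < n + 1)] at t
  have := ZMod.val_lt (a + (o' : ZMod (n + 1)) - (a + (o : ZMod (n + 1))))
  simp only [CrossArc]
  omega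

lemma Valid.isArc (h : T.Valid r) (a : ZMod (n + 1)) (i : Fin n) : IsArc (arc a T i) := by
  have := h.lt_m i; have := h.m_lt i; have := h.e_le i
  constructor <;> simp only [arc] <;> omega

lemma Valid.compatArc (h : T.Valid r) (a : ZMod (n + 1)) (i j : Fin n) :
    CompatArc (arc a T i) (arc a T j) := by
  have := h.lt_m i; have := h.m_lt i; have := h.e_le i
  have := h.lt_m j; have := h.m_lt j; have := h.e_le j
  constructor <;> simp only [arc]
  · rw [crossArc_iff a (by omega) (by omega) (by omega) (by omega)]
    exact h.noncross i j
  · rw [crossArc_iff a (by omega) (by omega) (by omega) (by omega)]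
    exact h.noncross j i

lemma Valid.arc_injective (h : T.Valid r) (a : ZMod (n + 1)) :
    Function.Injective (arc a T) := by
  intro i j hij
  have := h.lt_m i; have := h.m_lt i; have := h.e_le i
  have := h.lt_m j; have := h.m_lt j; have := h.e_le j
  simp only [arc, Prod.mk.injEq, add_right_inj] at hij
  have h1 := congrArg ZMod.val hij.1
  rw [ZMod.val_cast_of_lt (by omega), ZMod.val_cast_of_lt (by omega)] at h1
  exact h.arc_inj h1 (by omega)

lemma Valid.arc_root (h : T.Valid r) (a : ZMod (n + 1)) : arc a T r = (a, n + 1) := by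
  simp [arc, h.root_o, h.root_e]

lemma FlipStep.arc_ne (hF : FlipStep r a T a' T' k) (h : T.Valid r) :
    arc a' T' k ≠ arc a T k := by
  intro heq
  have := h.lt_m k; have := h.m_lt k; have := h.e_le k
  have h' := hF.valid h
  have := h'.lt_m k; have := h'.m_lt k; have := h'.e_le k
  by_cases hk : k = r
  · subst hk
    obtain ⟨rfl, rfl⟩ := hF.of_root h
    rw [h.arc_root, h.flipRoot.arc_root, Prod.mk.injEq, add_eq_left] at heq
    have h1 := congrArg ZMod.val heq.1
    rw [ZMod.val_cast_of_lt (by omega)] at h1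
    simp at h1; omega
  · obtain ⟨rfl, h2, h3⟩ := hF.of_ne hk
    simp only [arc, Prod.mk.injEq, add_right_inj] at heq
    have h1 := congrArg ZMod.val heq.1
    rw [ZMod.val_cast_of_lt (by omega), ZMod.val_cast_of_lt (by omega)] at h1
    omega

/-- The flip of a node is determined by the other arcs. -/
lemma FlipStep.arc_eq_of_compat (hF : FlipStep r a T a' T' k) (h : T.Valid r)
    {J : ZMod (n + 1) × ℕ} (hJ : IsArc J) (hcomp : ∀ i, i ≠ k → CompatArc (arc a T i) J)
    (hne : ∀ i, arc a T i ≠ J) : J = arc a' T' k := by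
  obtain ⟨p, hp, hp'⟩ : ∃ p : ℕ, J.1 = a + (p : ZMod (n + 1)) ∧ p < n + 1 :=
    ⟨(J.1 - a).val, by rw [ZMod.natCast_zmod_val, add_sub_cancel], ZMod.val_lt _⟩
  have hpv : (p : ZMod (n + 1)).val = p := ZMod.val_cast_of_lt hp'
  obtain ⟨b, l⟩ := J
  dsimp only at hp
  subst hp
  obtain ⟨hl2, hlN⟩ := hJ
  dsimp only at hl2 hlN
  have bd : ∀ i, T.o i < T.m i ∧ T.m i < T.e i ∧ T.e i ≤ n + 1 :=
    fun i => ⟨h.lt_m i, h.m_lt i, h.e_le i⟩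
  have r1 := h.root_o; have r2 := h.root_e
  have hT : p + l ≤ n + 1 → ∀ i, ¬ (T.o i = p ∧ T.e i = p + l) := by
    rintro hle i ⟨h1, h2⟩
    exact hne i (by simp only [arc, h1, h2]; rw [Nat.add_sub_cancel_left])
  have hcr : p + l ≤ n + 1 → ∀ i, i ≠ k →
      ¬ (T.o i < p ∧ p < T.e i ∧ T.e i < p + l) ∧
      ¬ (p < T.o i ∧ T.o i < p + l ∧ p + l < T.e i) := by
    intro hle i hi
    obtain ⟨h1, h2⟩ := hcomp i hi
    have e : l = p + l - p := by omega
    rw [arc, e] at h1 h2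
    have := bd i
    rw [crossArc_iff a (by omega) (by omega) (by omega) (by omega)] at h1 h2
    exact ⟨h1, h2⟩
  by_cases hk : k = r
  · subst hk
    obtain ⟨rfl, rfl⟩ := hF.of_root h
    rw [h.flipRoot.arc_root]
    -- Otherwise J would be an interval that is not in the tree, and would be crossed by a node. The
    -- root crosses no interval, so that node would be one of the nodes that J must not cross.
    have hwrap : n + 1 < p + l := by
      by_contra hle
      push Not at hle
      obtain ⟨i, hi⟩ := h.exists_crossing (p := p) (q := p + l) (by omega) hle (hT hle)
      have := bd i
      by_cases hik : i = k
      · subst hik; omega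
      · have := hcr hle i hik; omega
    have hchild : ∀ j, CrossArc (a + (p : ZMod (n + 1)), l) (arc a T j) ∨
        CrossArc (arc a T j) (a + (p : ZMod (n + 1)), l) → j = k := by
      intro j hj
      by_contra hjk
      have := hcomp j hjk
      rcases hj with hj | hj
      · exact this.2 hj
      · exact this.1 hj
    have bk := bd k
    have hval := val_sub_comm a (a + (p : ZMod (n + 1)))
    rw [add_sub_cancel_left, hpv] at hval
    have hleft : ∀ j, T.o j = 0 → T.e j = T.m k → ¬ (l < n + 1 - p + T.m k) := by
      intro j hj1 hj2 hlt
      have : j = k := hchild j (Or.inl (by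
        simp only [CrossArc, arc, hj1, hj2, Nat.cast_zero, add_zero]
        omega))
      subst this
      omega
    -- J now passes over the base point. If it started before the apex of the root it would cross
    -- the left child, and if it started after it, the right child; if it were shorter than n + 1,
    -- it would again cross the left child.
    have hpm : p = T.m k := by
      rcases lt_trichotomy p (T.m k) with hlt | heq | hlt
      · obtain ⟨j, hj1, hj2⟩ := h.left k (by omega)
        exact absurd (by omega) (hleft j (by omega) hj2)
      · exact heq
      · obtain ⟨j, hj1, hj2⟩ := h.right k (by omega)
        have t := val_triangle a (a + (T.m k : ZMod (n + 1))) (a + (p : ZMod (n + 1)))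
        rw [add_sub_cancel_left, add_sub_cancel_left, hpv,
          ZMod.val_cast_of_lt (by omega : T.m k < n + 1)] at t
        have := ZMod.val_lt (a + (p : ZMod (n + 1)) - (a + (T.m k : ZMod (n + 1))))
        have : j = k := hchild j (Or.inr (by
          simp only [CrossArc, arc, hj1, hj2]
          omega))
        subst this
        omega
    have hlN' : l = n + 1 := by
      by_contra hl
      obtain ⟨j, hj1, hj2⟩ := h.left k (by omega)
      exact absurd (by omega) (hleft j (by omega) hj2)
    rw [hpm, hlN']
  -- Compatibility with the diameter keeps J inside the interval. If J were not in the flipped tree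
  -- either, the node k would cross J both before and after the flip with its apex at an end of J;
  -- but the new segment of k ends at its old apex.
  · have hlin : p + l ≤ n + 1 := by
      by_contra hlt
      have := (hcomp r (Ne.symm hk)).1
      rw [h.arc_root] at this
      simp only [CrossArc, add_sub_cancel_left, hpv] at this
      omega
    have h' := hF.valid h
    obtain ⟨rfl, h2, h3⟩ := hF.of_ne hk
    have bd' : ∀ i, T'.o i < T'.m i ∧ T'.m i < T'.e i ∧ T'.e i ≤ n + 1 :=
      fun i => ⟨h'.lt_m i, h'.m_lt i, h'.e_le i⟩
    by_contra hcon
    obtain ⟨i, hi⟩ := h.exists_crossing (p := p) (q := p + l) (by omega) hlin (hT hlin)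
    have hik : i = k := by
      by_contra hik
      have := hcr hlin i hik; have := bd i; omega
    subst hik
    obtain ⟨j, hj⟩ := h'.exists_crossing (p := p) (q := p + l) (by omega) hlin (by
      rintro j ⟨h4, h5⟩
      by_cases hji : j = i
      · subst hji
        exact hcon (by simp only [arc, h4, h5]; rw [Nat.add_sub_cancel_left])
      · exact hT hlin j (by rw [← (h3 j hji).1, ← (h3 j hji).2]; exact ⟨h4, h5⟩))
    have hji : j = i := by
      by_contra hji
      have := hcr hlin j hji; have := bd' j; have := h3 j hji; omega
    subst hji
    have := bd j; have := bd' j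
    omega

/-! ### Connectivity -/

/-- The node `i` of `T` crosses the segment from `p` to `q`. -/
def CrossesNode (T : Tri n) (p q : ℕ) (i : Fin n) : Prop :=
  (T.o i < p ∧ p < T.e i ∧ T.e i < q) ∨ (p < T.o i ∧ T.o i < q ∧ q < T.e i)

/-- By flips away from the root, a segment can be made a node of the tree, without destroying
nodes that do not cross it. -/
lemma exists_flips_mem {R : Tri n → Prop} (hval : ∀ T, R T → T.Valid r)
    (hflip : ∀ T T' k, R T → k ≠ r → FlipStep r a T a T' k → R T')
    {T : Tri n} (hT : R T) {p q : ℕ} (hpq : p + 2 ≤ q) (hq : q ≤ n + 1) :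
    ∃ T', R T' ∧ (∃ i, T'.o i = p ∧ T'.e i = q) ∧
      ∀ i, ¬ T.CrossesNode p q i → ∃ j, T'.o j = T.o i ∧ T'.e j = T.e i := by
  classical
  -- Induction on the number of crossing nodes: some crossing node has its apex at p or q, and
  -- flipping it gives it that point as an end, so it no longer crosses.
  induction hd : (Finset.univ.filter (T.CrossesNode p q)).card using Nat.strong_induction_on
    generalizing T with
  | _ d ih =>
    by_cases hmem : ∃ i, T.o i = p ∧ T.e i = q
    · exact ⟨T, hT, hmem, fun i _ => ⟨i, rfl, rfl⟩⟩
    · push Not at hmem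
      have h := hval T hT
      obtain ⟨k, hk⟩ := h.exists_crossing hpq hq (fun i hi => hmem i hi.1 hi.2)
      have := h.lt_m k; have := h.m_lt k; have := h.e_le k
      have hkr : k ≠ r := by rintro rfl; have := h.root_o; have := h.root_e; omega
      have hkc : T.CrossesNode p q k := by simp only [CrossesNode]; omega
      obtain ⟨T', hT'⟩ := h.exists_flipStep_of_ne a hkr
      obtain ⟨-, h2, h3⟩ := hT'.of_ne hkr
      have hiff : ∀ i, i ≠ k → (T'.CrossesNode p q i ↔ T.CrossesNode p q i) := fun i hi => by
        simp only [CrossesNode, (h3 i hi).1, (h3 i hi).2]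
      have hk' : ¬ T'.CrossesNode p q k := by
        have h' := hT'.valid h
        have := h'.lt_m k; have := h'.m_lt k
        simp only [CrossesNode]; omega
      have hlt : (Finset.univ.filter (T'.CrossesNode p q)).card < d := by
        rw [← hd]
        refine Finset.card_lt_card ⟨fun i hi => ?_, fun hsub => ?_⟩
        · simp only [Finset.mem_filter, Finset.mem_univ, true_and] at hi ⊢
          have hik : i ≠ k := by rintro rfl; exact hk' hi
          exact (hiff i hik).1 hi
        · have := hsub (Finset.mem_filter.2 ⟨Finset.mem_univ k, hkc⟩)
          exact hk' (Finset.mem_filter.1 this).2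
      obtain ⟨T'', hR, hex, hpres⟩ := ih _ hlt (hflip T T' k hT hkr hT') rfl
      refine ⟨T'', hR, hex, fun i hi => ?_⟩
      have hik : i ≠ k := by rintro rfl; exact hi hkc
      obtain ⟨j, hj⟩ := hpres i (by rwa [hiff i hik])
      exact ⟨j, by rw [hj.1, (h3 i hik).1], by rw [hj.2, (h3 i hik).2]⟩

/-- Pairwise non-crossing segments are nodes of a tree obtained by flips away from the root. -/
lemma exists_flips_superset {R : Tri n → Prop} (hval : ∀ T, R T → T.Valid r)
    (hflip : ∀ T T' k, R T → k ≠ r → FlipStep r a T a T' k → R T')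
    {T : Tri n} (hT : R T) (S : Finset (ℕ × ℕ)) (hS : ∀ I ∈ S, I.1 + 2 ≤ I.2 ∧ I.2 ≤ n + 1)
    (hcr : ∀ I ∈ S, ∀ J ∈ S, ¬ (I.1 < J.1 ∧ J.1 < I.2 ∧ I.2 < J.2)) :
    ∃ T', R T' ∧ ∀ I ∈ S, ∃ i, T'.o i = I.1 ∧ T'.e i = I.2 := by
  classical
  induction S using Finset.induction_on with
  | empty => exact ⟨T, hT, by simp⟩
  | insert I S _ ih =>
    obtain ⟨T', hT', hsub⟩ := ih (fun J hJ => hS J (Finset.mem_insert_of_mem hJ))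
      (fun J hJ K hK => hcr J (Finset.mem_insert_of_mem hJ) K (Finset.mem_insert_of_mem hK))
    have hI := hS I (Finset.mem_insert_self _ _)
    obtain ⟨T'', hT'', hmem, hpres⟩ := exists_flips_mem hval hflip hT' hI.1 hI.2
    refine ⟨T'', hT'', fun J hJ => ?_⟩
    rcases Finset.mem_insert.1 hJ with rfl | hJS
    · exact hmem
    · obtain ⟨i, hi1, hi2⟩ := hsub J hJS
      obtain ⟨j, hj1, hj2⟩ := hpres i (by
        have h1 := hcr I (Finset.mem_insert_self _ _) J hJ
        have h2 := hcr J hJ I (Finset.mem_insert_self _ _)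
        simp only [CrossesNode, hi1, hi2]
        omega)
      exact ⟨j, by omega, by omega⟩

/-- Flips reach every base point. -/
lemma exists_flips_base (hn : 2 ≤ n) {R : ZMod (n + 1) → Tri n → Prop}
    (hval : ∀ a T, R a T → T.Valid r)
    (hflip : ∀ a T a' T' k, R a T → FlipStep r a T a' T' k → R a' T')
    (hR : ∃ a T, R a T) (b : ZMod (n + 1)) : ∃ T, R b T := by
  obtain ⟨a, T, hT⟩ := hR
  have key : ∀ a T, R a T → ∃ T', R (a + 1) T' := by
    intro a T hT
    -- Once the segment from 1 to n + 1 is a node, the apex of the root is 1, and flipping the root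
    -- advances the base point by one. The segment is a diagonal because n ≥ 2.
    obtain ⟨T', hT', hmem⟩ := exists_flips_superset (a := a) (R := R a) (hval a)
      (fun T T' k h1 _ h2 => hflip a T a T' k h1 h2) hT {(1, n + 1)} (by simp; omega) (by simp)
    obtain ⟨j, hj1, hj2⟩ := hmem (1, n + 1) (by simp)
    have h := hval a T' hT'
    have := h.root_o; have := h.root_e; have := h.lt_m r; have := h.m_lt r
    have := h.lt_m j; have := h.m_lt j
    have h1 := h.nestL r j; have h2 := h.nestR r j
    have hm : T'.m r = 1 := by
      by_cases hjr : T'.m j = T'.m r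
      · have := h.inj j r hjr; subst this; omega
      · dsimp only at *; omega
    have h3 := hflip a T' _ _ r hT' (.root a T')
    rw [hm, Nat.cast_one] at h3
    exact ⟨_, h3⟩
  have key' : ∀ k : ℕ, ∃ T, R (a + k) T := by
    intro k
    induction k with
    | zero => exact ⟨T, by simpa using hT⟩
    | succ k ih =>
      obtain ⟨T, hT⟩ := ih
      obtain ⟨T', hT'⟩ := key _ T hT
      exact ⟨T', by rwa [Nat.cast_succ, ← add_assoc]⟩
  have := key' (b - a).val
  rwa [ZMod.natCast_zmod_val, add_sub_cancel] at this

/-- Flips reach a tree that contains a given compatible family. -/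
lemma exists_flips_family (hn : 2 ≤ n) {R : ZMod (n + 1) → Tri n → Prop}
    (hval : ∀ a T, R a T → T.Valid r)
    (hflip : ∀ a T a' T' k, R a T → FlipStep r a T a' T' k → R a' T')
    (hR : ∃ a T, R a T) {c : ZMod (n + 1) × ℕ →₀ ℕ} (hc : IsFamily c) :
    ∃ a T, R a T ∧ ∀ I, c I ≠ 0 → ∃ i, arc a T i = I := by
  classical
  -- With the base at an uncovered point no arc of the family wraps around, so all are segments of
  -- the interval and can be inserted without flipping the root again.
  obtain ⟨a, ha⟩ := hc.exists_uncovered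
  obtain ⟨T, hT⟩ := exists_flips_base hn hval hflip hR a
  have hI : ∀ I, c I ≠ 0 → (I.1 - a).val + 2 ≤ (I.1 - a).val + I.2 ∧
      (I.1 - a).val + I.2 ≤ n + 1 := by
    intro I hI
    have h1 : ¬ Covers I a := fun h => cover_ne_zero.2 ⟨I, hI, h⟩ ha
    obtain ⟨h2, h3⟩ := (hc I hI).1
    have := val_sub_comm a I.1
    have := ZMod.val_lt (I.1 - a)
    simp only [Covers] at h1
    omega
  have harc : ∀ I : ZMod (n + 1) × ℕ, I = (a + ((I.1 - a).val : ZMod (n + 1)),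
      (I.1 - a).val + I.2 - (I.1 - a).val) := by
    intro I
    rw [ZMod.natCast_zmod_val, add_sub_cancel, Nat.add_sub_cancel_left]
  obtain ⟨T', hT', hmem⟩ := exists_flips_superset (a := a) (R := R a) (hval a)
    (fun T T' k h1 _ h2 => hflip a T a T' k h1 h2) hT
    (c.support.image fun I => ((I.1 - a).val, (I.1 - a).val + I.2)) (by
      intro P hP
      obtain ⟨I, hI', rfl⟩ := Finset.mem_image.1 hP
      exact hI I (Finsupp.mem_support_iff.1 hI')) (by
      intro P hP Q hQ
      obtain ⟨I, hI', rfl⟩ := Finset.mem_image.1 hP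
      obtain ⟨J, hJ', rfl⟩ := Finset.mem_image.1 hQ
      rw [Finsupp.mem_support_iff] at hI' hJ'
      have h1 := ((hc I hI').2 J hJ').1
      have := hI I hI'; have := hI J hJ'
      rw [harc I, harc J, crossArc_iff a (by omega) (by omega) (by omega) (by omega)] at h1
      exact h1)
  refine ⟨a, T', hT', fun I hI' => ?_⟩
  obtain ⟨i, hi1, hi2⟩ := hmem _ (Finset.mem_image_of_mem _ (Finsupp.mem_support_iff.2 hI'))
  dsimp only at hi1 hi2
  exact ⟨i, by rw [arc, hi1, hi2]; exact (harc I).symm⟩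

end Tri

/-! ### Orbits of diagonals and arcs -/

section Segments

variable {n : ℕ}

/-- The quotient of the vertices by the central symmetry. -/
def vertexProj (n : ℕ) : Vertex n →+* ZMod (n + 1) :=
  ZMod.castHom ⟨2, by ring⟩ (ZMod (n + 1))

lemma vertexProj_val (u : Vertex n) :
    u.val = (vertexProj n u).val ∨ u.val = (vertexProj n u).val + (n + 1) := by
  have h1 : (vertexProj n u).val = u.val % (n + 1) := by
    rw [vertexProj, ZMod.castHom_apply, ZMod.cast_eq_val, ZMod.val_natCast]
  have h2 := ZMod.val_lt u
  rcases Nat.lt_or_ge u.val (n + 1) with h | h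
  · left; rw [h1, Nat.mod_eq_of_lt h]
  · right
    have : u.val % (n + 1) = u.val - (n + 1) := by
      rw [Nat.mod_eq_sub_mod h, Nat.mod_eq_of_lt (by omega)]
    omega

lemma natCast_half : ((n + 1 : ℕ) : Vertex n).val = n + 1 := ZMod.val_cast_of_lt (by omega)

lemma opp_opp (u : Vertex n) : opp (opp u) = u := by
  have : ((n + 1 : ℕ) : Vertex n) + ((n + 1 : ℕ) : Vertex n) = 0 := by
    rw [← Nat.cast_add, show n + 1 + (n + 1) = 2 * n + 2 by ring, ZMod.natCast_self]
  rw [opp, opp, add_assoc, this, add_zero]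

lemma opp_add (u v : Vertex n) : opp (u + v) = opp u + v := by
  simp only [opp]; ring

lemma vertexProj_opp (u : Vertex n) : vertexProj n (opp u) = vertexProj n u := by
  rw [opp, map_add, map_natCast, ZMod.natCast_self, add_zero]

lemma eq_or_eq_opp {u v : Vertex n} (h : vertexProj n u = vertexProj n v) : v = u ∨ v = opp u := by
  have hd : vertexProj n (v - u) = 0 := by rw [map_sub, h, sub_self]
  have h1 := vertexProj_val (v - u)
  rw [hd, ZMod.val_zero] at h1
  rcases h1 with h1 | h1
  · left; rwa [ZMod.val_eq_zero, sub_eq_zero] at h1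
  · right
    have h2 : v - u = ((n + 1 : ℕ) : Vertex n) :=
      ZMod.val_injective _ (by rw [h1, natCast_half, zero_add])
    rw [opp, ← h2]; ring

lemma segOrbit_opp (u v : Vertex n) : segOrbit (opp u) (opp v) = segOrbit u v := by
  rw [segOrbit, segOrbit, opp_opp, opp_opp, Set.pair_comm]

lemma segOrbit_comm (u v : Vertex n) : segOrbit u v = segOrbit v u := by
  rw [segOrbit, segOrbit, Sym2.eq_swap, Sym2.eq_swap (a := opp u)]

/-- The orbit of diagonals of an arc. -/
def seg (I : ZMod (n + 1) × ℕ) : Set (Sym2 (Vertex n)) :=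
  segOrbit ((I.1.val : ℕ) : Vertex n) (((I.1.val : ℕ) : Vertex n) + (I.2 : ℕ))

lemma vertexProj_natCast_val (b : ZMod (n + 1)) :
    vertexProj n ((b.val : ℕ) : Vertex n) = b := by
  rw [map_natCast, ZMod.natCast_zmod_val]

lemma seg_eq (u : Vertex n) (l : ℕ) : seg (vertexProj n u, l) = segOrbit u (u + (l : ℕ)) := by
  rw [seg]
  rcases eq_or_eq_opp (vertexProj_natCast_val (vertexProj n u)) with h | h
  · rw [← h]
  · dsimp only
    rw [← segOrbit_opp, opp_add, ← h]

lemma exists_vertexProj_eq (b : ZMod (n + 1)) : ∃ u : Vertex n, vertexProj n u = b :=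
  ⟨_, vertexProj_natCast_val b⟩

lemma natCast_val_of_le {l : ℕ} (hl : l ≤ n + 1) : ((l : ℕ) : Vertex n).val = l :=
  ZMod.val_cast_of_lt (by omega)

/-- A match with reversed ends needs l + m to be a multiple of 2n + 2, which forces two diameters;
their starting points are then opposite. -/
lemma sym2_eq_cases {u v : Vertex n} {l m : ℕ} (hl2 : 2 ≤ l) (hl : l ≤ n + 1) (hm : m ≤ n + 1)
    (h : s(u, u + (l : Vertex n)) = s(v, v + (m : Vertex n))) :
    vertexProj n u = vertexProj n v ∧ l = m := by
  have vl := natCast_val_of_le hl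
  have vm := natCast_val_of_le hm
  rw [Sym2.eq_iff] at h
  rcases h with ⟨rfl, h⟩ | ⟨h1, h2⟩
  · refine ⟨rfl, ?_⟩
    rw [add_right_inj] at h
    rw [← vl, h, vm]
  · have h3 : (l : Vertex n) + m = 0 := by
      rw [h1] at h2
      linear_combination h2
    have h4 : ((l + m : ℕ) : Vertex n) = 0 := by rw [Nat.cast_add, h3]
    rw [ZMod.natCast_eq_zero_iff] at h4
    have h5 := Nat.le_of_dvd (by omega) h4
    have : m = n + 1 := by omega
    subst this
    refine ⟨?_, by omega⟩
    rw [h1, map_add, map_natCast, ZMod.natCast_self, add_zero]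

lemma seg_injective {I J : ZMod (n + 1) × ℕ} (hI : IsArc I) (hJ : IsArc J) (h : seg I = seg J) :
    I = J := by
  obtain ⟨b, l⟩ := I
  obtain ⟨b', m⟩ := J
  obtain ⟨u, rfl⟩ := exists_vertexProj_eq b
  obtain ⟨v, rfl⟩ := exists_vertexProj_eq b'
  rw [seg_eq, seg_eq] at h
  have h1 : s(u, u + (l : Vertex n)) ∈ segOrbit v (v + (m : Vertex n)) := by
    rw [← h]; exact Set.mem_insert _ _
  rcases h1 with h1 | h1
  · obtain ⟨h2, h3⟩ := sym2_eq_cases hI.1 hI.2 hJ.2 h1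
    exact Prod.ext h2 h3
  · rw [Set.mem_singleton_iff, opp_add] at h1
    obtain ⟨h2, h3⟩ := sym2_eq_cases hI.1 hI.2 hJ.2 h1
    rw [vertexProj_opp] at h2
    exact Prod.ext h2 h3

lemma mem_openArc {a b v : Vertex n} :
    v ∈ openArc a b ↔ 0 < (v - a).val ∧ (v - a).val < (b - a).val := by
  simp [openArc]

lemma val_lt_of_mem_openArc {a b v : Vertex n} (h : v ∈ openArc b a) :
    (b - a).val < (v - a).val := by
  rw [mem_openArc] at h
  have t1 := val_triangle a b v
  have t2 := val_sub_comm a b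
  have := ZMod.val_lt (v - a)
  omega

lemma not_compatArc_of_crosses {u v : Vertex n} {l m : ℕ} (hl : l ≤ n + 1) (hm : m ≤ n + 1)
    (h : Crosses s(u, u + (l : Vertex n)) s(v, v + (m : Vertex n))) :
    ¬ CompatArc (vertexProj n u, l) (vertexProj n v, m) := by
  have vl := natCast_val_of_le hl
  have vm := natCast_val_of_le hm
  obtain ⟨z, w, hzw, hz, hw⟩ : ∃ z w, s(v, v + (m : Vertex n)) = s(z, w) ∧
      z ∈ openArc u (u + (l : Vertex n)) ∧ w ∈ openArc (u + (l : Vertex n)) u := by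
    obtain ⟨a, b, c, e, hab, hce, hc, he⟩ := h
    rw [Sym2.eq_iff] at hab
    rcases hab with ⟨rfl, rfl⟩ | ⟨rfl, rfl⟩
    · exact ⟨c, e, hce, hc, he⟩
    · exact ⟨e, c, hce.trans Sym2.eq_swap, he, hc⟩
  have hw' := val_lt_of_mem_openArc hw
  have hz' := mem_openArc.1 hz
  rw [add_sub_cancel_left, vl] at hw' hz'
  have t1 := val_triangle u v (v + (m : Vertex n))
  rw [add_sub_cancel_left, vm] at t1
  have b1 := ZMod.val_lt (v - u)
  have b2 := ZMod.val_lt (v + (m : Vertex n) - u)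
  have p1 := vertexProj_val (v - u)
  have p2 := val_sub_comm (vertexProj n u) (vertexProj n v)
  rw [map_sub] at p1
  have b5 := ZMod.val_lt (vertexProj n v - vertexProj n u)
  rintro ⟨c1, c2⟩
  simp only [CrossArc] at c1 c2
  rw [Sym2.eq_iff] at hzw
  rcases hzw with ⟨rfl, rfl⟩ | ⟨rfl, rfl⟩
  · omega
  · omega

/-- Lift the second arc to start at u + d, where d is the distance of the starting points on the
circle; the lifts then cross in the polygon. -/
lemma crosses_of_crossArc {u : Vertex n} {l m : ℕ} {b : ZMod (n + 1)} (hl : l ≤ n + 1)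
    (hm : m ≤ n + 1) (h : CrossArc (vertexProj n u, l) (b, m)) :
    ∃ D ∈ seg (vertexProj n u, l), ∃ E ∈ seg (b, m), Crosses D E := by
  have vl := natCast_val_of_le hl
  have vm := natCast_val_of_le hm
  obtain ⟨d, hd, hd'⟩ : ∃ d : ℕ, b = vertexProj n u + (d : ZMod (n + 1)) ∧
      (b - vertexProj n u).val = d :=
    ⟨_, by rw [ZMod.natCast_zmod_val, add_sub_cancel], rfl⟩
  obtain ⟨h1, h2, h3⟩ := h
  simp only [hd'] at h1 h2 h3
  have hb : b = vertexProj n (u + (d : Vertex n)) := by rw [map_add, map_natCast, hd]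
  rw [seg_eq, hb, seg_eq]
  have vd : ((d : ℕ) : Vertex n).val = d := natCast_val_of_le (by omega)
  refine ⟨_, Set.mem_insert _ _, _, Set.mem_insert _ _,
    u, u + l, u + d, u + d + m, rfl, rfl, ?_, ?_⟩
  · rw [mem_openArc, add_sub_cancel_left, add_sub_cancel_left, vd, vl]
    exact ⟨h1, h2⟩
  · rw [mem_openArc]
    have t4 := val_sub_comm u (u + (l : Vertex n))
    rw [add_sub_cancel_left, vl] at t4
    have e1 : u + (d : Vertex n) + m - (u + l) = ((d + m - l : ℕ) : Vertex n) := by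
      rw [Nat.cast_sub h3.le]; push_cast; ring
    have e2 : ((d + m - l : ℕ) : Vertex n).val = d + m - l := ZMod.val_cast_of_lt (by omega)
    rw [e1, e2]
    omega

lemma compatArc_iff {I J : ZMod (n + 1) × ℕ} (hI : IsArc I) (hJ : IsArc J) :
    CompatArc I J ↔ (∀ D ∈ seg I, ∀ E ∈ seg J, ¬ Crosses D E) ∧
      ∀ D ∈ seg J, ∀ E ∈ seg I, ¬ Crosses D E := by
  obtain ⟨b, l⟩ := I
  obtain ⟨b', m⟩ := J
  obtain ⟨u, rfl⟩ := exists_vertexProj_eq b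
  obtain ⟨v, rfl⟩ := exists_vertexProj_eq b'
  obtain ⟨hl1, hl2⟩ := hI
  obtain ⟨hm1, hm2⟩ := hJ
  dsimp only at hl1 hl2 hm1 hm2
  have key : ∀ {u v : Vertex n} {l m : ℕ}, l ≤ n + 1 → m ≤ n + 1 →
      CompatArc (vertexProj n u, l) (vertexProj n v, m) →
      ∀ D ∈ seg (vertexProj n u, l), ∀ E ∈ seg (vertexProj n v, m), ¬ Crosses D E := by
    intro u v l m h2 h4 hc D hD E hE hDE
    rw [seg_eq] at hD hE
    simp only [segOrbit, Set.mem_insert_iff, Set.mem_singleton_iff, opp_add] at hD hE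
    rcases hD with rfl | rfl <;> rcases hE with rfl | rfl <;>
      exact not_compatArc_of_crosses h2 h4 hDE
        (by simpa only [vertexProj_opp] using hc)
  constructor
  · exact fun h => ⟨key hl2 hm2 h, key hm2 hl2 h.symm⟩
  · rintro ⟨h1, h2⟩
    constructor
    · intro hc
      obtain ⟨D, hD, E, hE, hDE⟩ := crosses_of_crossArc hl2 hm2 hc
      exact h1 D hD E hE hDE
    · intro hc
      obtain ⟨D, hD, E, hE, hDE⟩ := crosses_of_crossArc hm2 hl2 hc
      exact h2 D hD E hE hDE

/-! ### Diagonals as arcs, and small diagonals -/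

lemma vertex_eq_add (a b : Vertex n) : b = a + ((b - a).val : Vertex n) := by
  rw [ZMod.natCast_zmod_val, add_sub_cancel]

lemma IsDiagonal.val {a b : Vertex n} (h : IsDiagonal a b) :
    2 ≤ (b - a).val ∧ (b - a).val + (a - b).val = 2 * n + 2 ∧ 2 ≤ (a - b).val := by
  obtain ⟨h1, h2, h3⟩ := h
  have hc := val_sub_comm b a
  have key : ∀ {x y : Vertex n}, y ≠ x → y ≠ x + 1 → 2 ≤ (y - x).val := by
    intro x y h1 h2
    by_contra hlt
    have e := vertex_eq_add x y
    have : (y - x).val = 0 ∨ (y - x).val = 1 := by omega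
    rcases this with h | h
    · rw [h, Nat.cast_zero, add_zero] at e; exact h1 e
    · rw [h, Nat.cast_one] at e; exact h2 e
  have k1 := key h1 h2
  have k2 := key h1.symm h3
  omega

/-- Read the diagonal along its shorter side. -/
lemma IsDiagonal.exists_arc {a b : Vertex n} (h : IsDiagonal a b) :
    ∃ I : ZMod (n + 1) × ℕ, IsArc I ∧ segOrbit a b = seg I := by
  have hv := h.val
  rcases Nat.lt_or_ge (n + 1) (b - a).val with hlt | hle
  · refine ⟨(vertexProj n b, (a - b).val), ⟨hv.2.2, by dsimp only; omega⟩, ?_⟩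
    rw [seg_eq, ← vertex_eq_add b a, segOrbit_comm]
  · refine ⟨(vertexProj n a, (b - a).val), ⟨hv.1, hle⟩, ?_⟩
    rw [seg_eq, ← vertex_eq_add a b]

lemma isDiagonal_of_val {a b : Vertex n} (h : 2 ≤ (b - a).val) (h' : (b - a).val ≤ n + 1)
    (hn : 2 ≤ n) : IsDiagonal a b := by
  have v1 : ((1 : ℕ) : Vertex n).val = 1 := ZMod.val_cast_of_lt (by omega)
  rw [Nat.cast_one] at v1
  refine ⟨?_, ?_, ?_⟩
  · rintro rfl; simp at h
  · rintro rfl; rw [add_sub_cancel_left, v1] at h; omega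
  · rintro rfl
    have := val_sub_comm b (b + 1)
    rw [add_sub_cancel_left, v1] at this
    omega

lemma IsArc.exists_diagonal (hn : 2 ≤ n) {I : ZMod (n + 1) × ℕ} (hI : IsArc I) :
    ∃ a b : Vertex n, IsDiagonal a b ∧ seg I = segOrbit a b := by
  obtain ⟨b, l⟩ := I
  obtain ⟨u, rfl⟩ := exists_vertexProj_eq b
  refine ⟨u, u + (l : Vertex n), isDiagonal_of_val ?_ ?_ hn, seg_eq u l⟩
  · rw [add_sub_cancel_left, natCast_val_of_le hI.2]; exact hI.1
  · rw [add_sub_cancel_left, natCast_val_of_le hI.2]; exact hI.2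

lemma card_openArc (a b : Vertex n) : (openArc a b).card = (b - a).val - 1 := by
  classical
  have : openArc a b = (Finset.Ioo 0 (b - a).val).image fun i : ℕ => a + (i : Vertex n) := by
    ext v
    simp only [mem_openArc, Finset.mem_image, Finset.mem_Ioo]
    constructor
    · intro h
      exact ⟨(v - a).val, h, (vertex_eq_add a v).symm⟩
    · rintro ⟨i, hi, rfl⟩
      have := ZMod.val_lt (b - a)
      rw [add_sub_cancel_left, ZMod.val_cast_of_lt (by omega)]
      exact hi
  rw [this, Finset.card_image_of_injOn, Nat.card_Ioo, Nat.sub_zero]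
  intro i hi j hj hij
  simp only [Finset.coe_Ioo, Set.mem_Ioo] at hi hj
  have := ZMod.val_lt (b - a)
  simp only [add_right_inj] at hij
  have h := congrArg ZMod.val hij
  rwa [ZMod.val_cast_of_lt (by omega), ZMod.val_cast_of_lt (by omega)] at h

/-- An arc of at most half a turn has no two opposite points strictly inside. Consequently small
diagonals are those of length 2. -/
lemma card_image_openArc {a b : Vertex n} (h : (b - a).val ≤ n + 1) :
    ((openArc a b).image fun v => s(v, opp v)).card = (b - a).val - 1 := by
  rw [Finset.card_image_of_injOn, card_openArc]
  intro v hv w hw hvw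
  simp only [Finset.mem_coe, mem_openArc] at hv hw
  simp only [Sym2.eq_iff] at hvw
  rcases hvw with hvw | ⟨h1, h2⟩
  · exact hvw.1
  · exfalso
    have h3 : v - a = (w - a) + ((n + 1 : ℕ) : Vertex n) := by rw [h1, opp]; ring
    have h4 : ((w - a) + ((n + 1 : ℕ) : Vertex n)).val = (w - a).val + (n + 1) := by
      rw [ZMod.val_add_of_lt, natCast_half]
      rw [natCast_half]; omega
    rw [← h3] at h4
    omega

lemma IsSmall.exists_arc {a b : Vertex n} (h : IsSmall a b) :
    ∃ v : ZMod (n + 1), segOrbit a b = seg (v, 2) := by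
  obtain ⟨hd, hc⟩ := h
  have hv := hd.val
  rw [arcOrbits, card_openArc, card_openArc] at hc
  split_ifs at hc with hle
  · rw [card_image_openArc (by omega)] at hc
    have h2 : (b - a).val = 2 := by omega
    refine ⟨vertexProj n a, ?_⟩
    have e := vertex_eq_add a b
    rw [h2] at e
    rw [seg_eq]
    exact congrArg (segOrbit a) e
  · rw [card_image_openArc (by omega)] at hc
    have h2 : (a - b).val = 2 := by omega
    refine ⟨vertexProj n b, ?_⟩
    have e := vertex_eq_add b a
    rw [h2] at e
    rw [seg_eq, segOrbit_comm]
    exact congrArg (segOrbit b) e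

lemma exists_isSmall (hn : 2 ≤ n) (v : ZMod (n + 1)) :
    ∃ a b : Vertex n, IsSmall a b ∧ segOrbit a b = seg (v, 2) := by
  obtain ⟨u, rfl⟩ := exists_vertexProj_eq v
  have hv : (u + ((2 : ℕ) : Vertex n) - u).val = 2 := by
    rw [add_sub_cancel_left]; exact natCast_val_of_le (by omega)
  have hd : IsDiagonal u (u + ((2 : ℕ) : Vertex n)) :=
    isDiagonal_of_val (by omega) (by omega) hn
  refine ⟨u, u + ((2 : ℕ) : Vertex n), ⟨hd, ?_⟩, (seg_eq u 2).symm⟩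
  have := hd.val
  rw [arcOrbits, card_openArc, card_openArc, if_pos (by omega), card_image_openArc (by omega), hv]

end Segments

/-! ### Labels of trees -/

section Labels

variable {n : ℕ} {a a' : ZMod (n + 1)} {T T' : Tri n} {r k : Fin n}

/-- The labels of the nodes of a tree. -/
def treeLabels (a : ZMod (n + 1)) (T : Tri n) (i : Fin n) : Set (Sym2 (Vertex n)) :=
  seg (Tri.arc a T i)

lemma Tri.Valid.isTriangulation (hn : 2 ≤ n) (h : T.Valid r) (a : ZMod (n + 1)) :
    IsTriangulation (treeLabels a T) := by
  refine ⟨fun i j hij => ?_, fun i => ?_, fun i j => ?_⟩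
  · exact h.arc_injective a (seg_injective (h.isArc a i) (h.isArc a j) hij)
  · exact (h.isArc a i).exists_diagonal hn
  · exact ((compatArc_iff (h.isArc a i) (h.isArc a j)).1 (h.compatArc a i j)).1

lemma Tri.FlipStep.isFlip (hn : 2 ≤ n) (hF : Tri.FlipStep r a T a' T' k) (h : T.Valid r) :
    IsFlip k (treeLabels a T) (treeLabels a' T') := by
  have h' := hF.valid h
  refine ⟨h.isTriangulation hn a, h'.isTriangulation hn a', fun heq => ?_, fun i hi => ?_⟩
  · exact hF.arc_ne h (seg_injective (h'.isArc a' k) (h.isArc a k) heq)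
  · rw [treeLabels, treeLabels, hF.arc_of_ne h hi]

/-- Connects the geometric notion with the trees: the new label is an arc compatible with all the
others, and only one such arc is not already in the tree. -/
lemma Tri.FlipStep.eq_of_isFlip (hF : Tri.FlipStep r a T a' T' k) (h : T.Valid r)
    {τ : Fin n → Set (Sym2 (Vertex n))} (hτ : IsFlip k (treeLabels a T) τ) :
    τ = treeLabels a' T' := by
  obtain ⟨-, ⟨hinj, hdiag, hcross⟩, hne, heq⟩ := hτ
  funext i
  by_cases hi : i = k
  · subst hi
    obtain ⟨b, e, hbe, hb⟩ := hdiag i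
    obtain ⟨J, hJ, hJ'⟩ := hbe.exists_arc
    rw [hJ'] at hb
    rw [hb, treeLabels]
    congr 1
    refine hF.arc_eq_of_compat h hJ (fun j hj => ?_) fun j hj => ?_
    · rw [compatArc_iff (h.isArc a j) hJ]
      have h1 := hcross j i
      have h2 := hcross i j
      rw [heq j hj, hb] at h1 h2
      exact ⟨h1, h2⟩
    · subst hj
      by_cases hji : j = i
      · subst hji; exact hne hb
      · refine hji (hinj ?_)
        rw [hb, heq j hji]; rfl
  · rw [heq i hi, treeLabels, treeLabels, hF.arc_of_ne h hi]

end Labels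

lemma cont_mem {N : ℕ} {R : Type*} [CommRing R] (S : Subring R) (c : ZMod N → R) (a : ZMod N)
    (l : ℕ) (h : ∀ i, 0 < i → i < l → c (a + (i : ℕ)) ∈ S) : cont c a l ∈ S := by
  induction l using Nat.twoStepInduction with
  | zero => exact S.zero_mem
  | one => exact S.one_mem
  | more l h0 h1 =>
    rw [cont_add_two]
    exact S.sub_mem (S.mul_mem (h _ (by omega) (by omega))
      (h1 fun i h2 h3 => h i h2 (by omega))) (h0 fun i h2 h3 => h i h2 (by omega))

/-! ### The small variables in the ambient field -/

section Coefficients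

variable {n : ℕ}

/-- The sequence `0, 1, x₁, …, xₙ`. -/
noncomputable def initSeq (n : ℕ) : ℕ → Ambient n
  | 0 => 0
  | 1 => 1
  | l + 2 => if h : l < n then (initialSeed n).x ⟨l, h⟩ else 0

lemma initialSeed_x_ne_zero (i : Fin n) : (initialSeed n).x i ≠ 0 := by
  simp only [initialSeed]
  rw [Ne, FaithfulSMul.algebraMap_eq_zero_iff]
  exact MvPolynomial.X_ne_zero i

lemma initSeq_ne_zero {l : ℕ} (h0 : 0 < l) (hl : l ≤ n + 1) : initSeq n l ≠ 0 := by
  match l with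
  | 1 => exact one_ne_zero
  | l + 2 =>
    rw [initSeq, dif_pos (by omega)]
    exact initialSeed_x_ne_zero _

/-- The small variables, except for the one that involves `λ`. -/
noncomputable def preCoef (n : ℕ) (v : ZMod (n + 1)) : Ambient n :=
  (initSeq n ((v + 1).val + 1) + initSeq n ((v + 1).val - 1)) / initSeq n (v + 1).val

/-- The small variables, indexed by the middle vertex. -/
noncomputable def coef (n : ℕ) (v : ZMod (n + 1)) : Ambient n :=
  if v + 1 = 0 then (lam n + initSeq n n + cont (preCoef n) 0 n) / initSeq n (n + 1)
  else preCoef n v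

lemma coef_of_ne {v : ZMod (n + 1)} (h : v + 1 ≠ 0) : coef n v = preCoef n v := if_neg h

/-- The entries in `preCoef` are the recurrence solved for its coefficients: the point v is reached
from −1 in (v + 1).val steps. The exceptional entry, at v = −1, does not enter an arc from −1 of
length at most n + 1. -/
lemma cont_coef {l : ℕ} (hl : l ≤ n + 1) : cont (coef n) (-1) l = initSeq n l := by
  induction l using Nat.twoStepInduction with
  | zero => rfl
  | one => rfl
  | more l h0 h1 =>
    have hv : ((l + 1 : ℕ) : ZMod (n + 1)).val = l + 1 := ZMod.val_cast_of_lt (by omega)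
    have e : (-1 + ((l + 1 : ℕ) : ZMod (n + 1))) + 1 = ((l + 1 : ℕ) : ZMod (n + 1)) := by ring
    rw [cont_add_two, h0 (by omega), h1 (by omega), coef_of_ne, preCoef, e, hv,
      div_mul_cancel₀ _ (initSeq_ne_zero (by omega) (by omega))]
    · simp
    · rw [e, Ne, ← ZMod.val_eq_zero, hv]; omega

/-- The last entry is chosen to solve this equation. It is linear in that entry, as the subtracted
continuant has the entries at 1, …, n − 1 only; for the same reason the junk value of `preCoef` at
−1 is never used. -/
lemma traceCont_coef (hn : 2 ≤ n) : traceCont (coef n) 0 = lam n := by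
  rw [traceCont_eq _ 0 (-1), traceCont, cont_add_two, cont_coef le_rfl, cont_coef (by omega)]
  have e1 : (-1 : ZMod (n + 1)) + ((n + 1 : ℕ) : ZMod (n + 1)) = -1 := by
    rw [ZMod.natCast_self, add_zero]
  have e2 : cont (coef n) (-1 + 1) (n + 1 - 1) = cont (preCoef n) 0 n := by
    rw [neg_add_cancel, Nat.add_sub_cancel]
    refine cont_congr _ _ _ _ fun i h0 hi => coef_of_ne ?_
    rw [zero_add, ← Nat.cast_succ, Ne, ← ZMod.val_eq_zero, ZMod.val_cast_of_lt (by omega)]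
    omega
  rw [e1, e2, coef, if_pos (neg_add_cancel 1),
    div_mul_cancel₀ _ (initSeq_ne_zero (by omega) le_rfl)]
  ring

/-! ### Algebraic independence of the small variables -/

/-- The ring homomorphism that maps the variables of the polynomial ring to the small variables. -/
noncomputable def smallHom (n : ℕ) : MvPolynomial (ZMod (n + 1)) ℤ →+* Ambient n :=
  MvPolynomial.eval₂Hom (Int.castRingHom _) (coef n)

@[simp] lemma smallHom_X (v : ZMod (n + 1)) : smallHom n (MvPolynomial.X v) = coef n v := by
  simp [smallHom]

lemma smallHom_genCont (a : ZMod (n + 1)) (l : ℕ) :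
    smallHom n (genCont a l) = cont (coef n) a l := by
  rw [genCont, map_cont]
  congr 1
  funext v
  simp

lemma smallHom_traceCont (hn : 2 ≤ n) :
    smallHom n (traceCont (fun i => MvPolynomial.X i) 0) = lam n := by
  rw [map_traceCont, ← traceCont_coef hn]
  congr 1
  funext v
  simp

/-- `λ` and the initial cluster variables as polynomials in the small variables. -/
noncomputable def initPoly (n : ℕ) : Option (Fin n) → MvPolynomial (ZMod (n + 1)) ℤ
  | none => traceCont (fun i => MvPolynomial.X i) 0
  | some i => genCont (-1) (i + 2)

/-- `λ` and the initial cluster variables are algebraically independent. -/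
lemma initPoly_injective (hn : 2 ≤ n) : Function.Injective
    ((smallHom n).comp (MvPolynomial.eval₂Hom (Int.castRingHom _) (initPoly n))) := by
  -- On λ and the initial variables the composite is the natural embedding of ℤ[λ][x₁, …, xₙ] in the
  -- ambient field.
  have h : (smallHom n).comp (MvPolynomial.eval₂Hom (Int.castRingHom _) (initPoly n)) =
      ((algebraMap (MvPolynomial (Fin n) ℤ[T;T⁻¹]) (Ambient n)).comp
        (MvPolynomial.map (Polynomial.toLaurent : Polynomial ℤ →+* ℤ[T;T⁻¹]))).comp
          (MvPolynomial.optionEquivRight ℤ (Fin n) : _ →+* _) := by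
    refine MvPolynomial.ringHom_ext (fun z => by simp) fun i => ?_
    match i with
    | none =>
      simp [initPoly, smallHom_traceCont hn, lam, coeffEmb]
    | some i =>
      simp [initPoly, smallHom_genCont, cont_coef (show (i : ℕ) + 2 ≤ n + 1 by omega), initSeq,
        initialSeed]
  rw [h, RingHom.coe_comp, RingHom.coe_comp]
  refine Function.Injective.comp (Function.Injective.comp ?_ ?_) ?_
  · exact IsFractionRing.injective (MvPolynomial (Fin n) ℤ[T;T⁻¹]) (Ambient n)
  · exact MvPolynomial.map_injective _ Polynomial.toLaurent_injective
  · exact (MvPolynomial.optionEquivRight ℤ (Fin n)).injective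

/-- The generic small variables are rational functions of the initial variables and `λ`. -/
lemma algebraMap_mem_closure (n : ℕ) (f : MvPolynomial (ZMod (n + 1)) ℤ) :
    algebraMap _ (FractionRing (MvPolynomial (ZMod (n + 1)) ℤ)) f ∈
      Subfield.closure (Set.range fun i =>
        algebraMap _ (FractionRing (MvPolynomial (ZMod (n + 1)) ℤ)) (initPoly n i)) := by
  set G := FractionRing (MvPolynomial (ZMod (n + 1)) ℤ)
  set ι : MvPolynomial (ZMod (n + 1)) ℤ →+* G := algebraMap _ _
  set S := Subfield.closure (Set.range fun i => ι (initPoly n i))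
  have hY : ∀ i, ι (initPoly n i) ∈ S := fun i => Subfield.subset_closure ⟨i, rfl⟩
  have hK : ∀ l, l ≤ n + 1 → ι (genCont (-1) l) ∈ S := by
    intro l hl
    match l with
    | 0 => simp [genCont]
    | 1 => simp [genCont]
    | l + 2 => exact hY (some ⟨l, by omega⟩)
  have hK0 : ∀ l, 0 < l → ι (genCont (-1) l) ≠ 0 := by
    intro l hl
    rw [Ne, FaithfulSMul.algebraMap_eq_zero_iff]
    have := leads_genCont (-1 : ZMod (n + 1)) (l - 1)
    rw [Nat.sub_add_cancel hl] at this
    exact this.ne_zero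
  have hdiv : ∀ {x y : G}, y ≠ 0 → y ∈ S → x * y ∈ S → x ∈ S := by
    intro x y hy hyS hxy
    have := S.div_mem hxy hyS
    rwa [mul_div_cancel_right₀ _ hy] at this
  have hX1 : ∀ l, 0 < l → l ≤ n → ι (MvPolynomial.X (-1 + (l : ZMod (n + 1)))) ∈ S := by
    intro l h0 hl
    refine hdiv (hK0 l h0) (hK l (by omega)) ?_
    obtain ⟨k, rfl⟩ : ∃ k, l = k + 1 := ⟨l - 1, by omega⟩
    have h1 : genCont (-1 : ZMod (n + 1)) (k + 2) = _ := cont_add_two _ _ k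
    have h2 : MvPolynomial.X (-1 + ((k + 1 : ℕ) : ZMod (n + 1))) *
        genCont (-1 : ZMod (n + 1)) (k + 1) =
        genCont (-1 : ZMod (n + 1)) (k + 2) + genCont (-1 : ZMod (n + 1)) k := by
      rw [h1]; ring
    rw [← map_mul, h2, map_add]
    exact S.add_mem (hK _ (by omega)) (hK _ (by omega))
  -- All points but −1 are obtained from the recurrence along the arcs from −1; the variable at −1
  -- is then obtained by solving the trace equation.
  have hX : ∀ v, ι (MvPolynomial.X v) ∈ S := by
    intro v
    obtain ⟨l, hl, rfl⟩ : ∃ l : ℕ, l < n + 1 ∧ v = -1 + (l : ZMod (n + 1)) :=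
      ⟨(v + 1).val, ZMod.val_lt _, by rw [ZMod.natCast_zmod_val]; ring⟩
    rcases Nat.eq_zero_or_pos l with rfl | h0
    · refine hdiv (hK0 (n + 1) (by omega)) (hK _ le_rfl) ?_
      have h1 : genCont (-1 : ZMod (n + 1)) (n + 2) = _ := cont_add_two _ _ n
      rw [ZMod.natCast_self, add_zero] at h1
      have h2 : initPoly n none = genCont (-1) (n + 2) - genCont 0 n := by
        rw [initPoly, traceCont_eq _ 0 (-1), traceCont, neg_add_cancel]; rfl
      have h3 : (MvPolynomial.X (-1 : ZMod (n + 1)) : MvPolynomial (ZMod (n + 1)) ℤ) *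
          genCont (-1 : ZMod (n + 1)) (n + 1) =
          initPoly n none + genCont 0 n + genCont (-1 : ZMod (n + 1)) n := by
        rw [h2, h1]; ring
      rw [Nat.cast_zero, add_zero, ← map_mul, h3, map_add, map_add]
      refine S.add_mem (S.add_mem (hY none) ?_) (hK n (by omega))
      rw [genCont, map_cont]
      refine cont_mem S.toSubring _ _ _ fun i h4 h5 => ?_
      have := hX1 (i + 1) (by omega) (by omega)
      have e : (-1 : ZMod (n + 1)) + ((i + 1 : ℕ) : ZMod (n + 1)) = 0 + (i : ZMod (n + 1)) := by
        push_cast; ring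
      rw [e] at this
      exact this
    · exact hX1 l h0 (by omega)
  induction f using MvPolynomial.induction_on with
  | C z =>
    rw [show (MvPolynomial.C z : MvPolynomial (ZMod (n + 1)) ℤ) = (z : ℤ) by simp, map_intCast]
    exact intCast_mem S z
  | add p q hp hq => rw [map_add]; exact S.add_mem hp hq
  | mul_X p i hp => rw [map_mul]; exact S.mul_mem hp (hX i)

/-- Write a kernel element f as a quotient of polynomials g, h in λ and the initial variables. From
ψ g = f · ψ h follows that ψ g maps to 0, and g = 0 by the algebraic independence of λ and the
initial variables. -/
lemma smallHom_injective (hn : 2 ≤ n) : Function.Injective (smallHom n) := by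
  rw [injective_iff_map_eq_zero]
  intro f hf
  have hcl : ∀ y ∈ Subring.closure (Set.range fun i =>
      algebraMap _ (FractionRing (MvPolynomial (ZMod (n + 1)) ℤ)) (initPoly n i)),
      ∃ g, algebraMap _ (FractionRing (MvPolynomial (ZMod (n + 1)) ℤ))
        (MvPolynomial.eval₂Hom (Int.castRingHom _) (initPoly n) g) = y := by
    intro y hy
    have hle : Subring.closure (Set.range fun i =>
        algebraMap _ (FractionRing (MvPolynomial (ZMod (n + 1)) ℤ)) (initPoly n i)) ≤
        ((algebraMap _ (FractionRing (MvPolynomial (ZMod (n + 1)) ℤ))).comp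
          (MvPolynomial.eval₂Hom (Int.castRingHom _) (initPoly n))).range := by
      rw [Subring.closure_le]
      rintro _ ⟨i, rfl⟩
      exact ⟨MvPolynomial.X i, by simp⟩
    exact hle hy
  obtain ⟨y, hy, z, hz, hyz⟩ := Subfield.mem_closure_iff.1 (algebraMap_mem_closure n f)
  obtain ⟨g, rfl⟩ := hcl y hy
  obtain ⟨h, rfl⟩ := hcl z hz
  set ψ := MvPolynomial.eval₂Hom (Int.castRingHom (MvPolynomial (ZMod (n + 1)) ℤ)) (initPoly n)
  by_cases hz0 : ψ h = 0
  · rw [hz0, map_zero, div_zero, eq_comm, FaithfulSMul.algebraMap_eq_zero_iff] at hyz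
    exact hyz
  · have hz1 : algebraMap _ (FractionRing (MvPolynomial (ZMod (n + 1)) ℤ)) (ψ h) ≠ 0 := by
      rwa [Ne, FaithfulSMul.algebraMap_eq_zero_iff]
    rw [div_eq_iff hz1, ← map_mul] at hyz
    have h1 : ψ g = f * ψ h := IsFractionRing.injective _ _ hyz
    have h2 : ((smallHom n).comp ψ) g = 0 := by
      rw [RingHom.comp_apply, h1, map_mul, hf, zero_mul]
    have h3 : g = 0 := (injective_iff_map_eq_zero _).1 (initPoly_injective hn) g h2
    rw [h3, map_zero] at h1
    exact (mul_eq_zero.1 h1.symm).resolve_right hz0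

/-- Makes the division in every mutation legitimate: generic continuants are nonzero by their
leading monomials. -/
lemma cont_coef_ne_zero (hn : 2 ≤ n) (a : ZMod (n + 1)) (l : ℕ) (h0 : 0 < l) :
    cont (coef n) a l ≠ 0 := by
  rw [← smallHom_genCont, Ne, map_eq_zero_iff _ (smallHom_injective hn)]
  have := leads_genCont a (l - 1)
  rw [Nat.sub_add_cancel h0] at this
  exact this.ne_zero

end Coefficients

/-! ### The initial tree -/

section Initial

variable {n : ℕ}

/-- The tree of the initial triangulation. -/
def initTree (n : ℕ) : Tri n where
  o _ := 0
  e i := i + 2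
  m i := i + 1

/-- The initial triangulation is the fan at the vertex −1, so its tree is a chain of left children.
-/
lemma initTree_valid {r : Fin n} (hr : (r : ℕ) + 1 = n) : (initTree n).Valid r := by
  refine ⟨?_, ?_, ?_, rfl, ?_, ?_, ?_, ?_, ?_, ?_⟩ <;> simp only [initTree]
  · omega
  · omega
  · omega
  · omega
  · intro i j h; exact Fin.ext (by omega)
  · intro i hi
    obtain ⟨j, hj⟩ : ∃ j : Fin n, (j : ℕ) + 1 = i := ⟨⟨i - 1, by omega⟩, by dsimp only; omega⟩
    exact ⟨j, trivial, by omega⟩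
  · omega
  · omega
  · omega

lemma initTree_adj {r : Fin n} (hr : (r : ℕ) + 1 = n) (i j : Fin n) :
    (initTree n).adj i j =
      (if (j : ℕ) = i + 1 then 1 else 0) - (if (i : ℕ) = j + 1 then 1 else 0) := by
  have hv := initTree_valid hr
  by_cases hj : j = r
  · subst hj
    rw [hv.adj_root]
    simp only [Tri.side, initTree, true_and, (Nat.succ_ne_zero _).symm, false_and, if_false]
    split_ifs <;> omega
  · have hj' : (j : ℕ) + 1 < n := by
      have : (j : ℕ) ≠ r := fun h => hj (Fin.ext h)
      omega
    obtain ⟨p, hp⟩ : ∃ p : Fin n, (p : ℕ) = j + 1 := ⟨⟨j + 1, hj'⟩, rfl⟩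
    rw [hv.adj_left (k := j) (p := p) (by rintro rfl; omega) rfl (by simp only [initTree]; omega)]
    simp only [Tri.side, initTree, hp, true_and, (Nat.succ_ne_zero _).symm, false_and, if_false]
    split_ifs <;> omega

lemma treeSeed_initialSeed {r : Fin n} (hr : (r : ℕ) + 1 = n) :
    TreeSeed (coef n) (initialSeed n) (-1) (initTree n) r := by
  refine ⟨initTree_valid hr, fun i => ?_, rfl, fun i j => ?_⟩
  · simp only [initTree]
    rw [Nat.cast_zero, add_zero, Nat.sub_zero, cont_coef (by omega), initSeq, dif_pos i.isLt]
  · rw [initTree_adj hr]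
    simp only [initialSeed, degC]
    split_ifs <;> omega

lemma initialLabels_eq : initialLabels n = treeLabels (-1) (initTree n) := by
  funext k
  have h := seg_eq (-1 : Vertex n) (k + 2)
  rw [map_neg, map_one] at h
  simp only [initialLabels, treeLabels, Tri.arc, initTree]
  rw [Nat.cast_zero, add_zero, Nat.sub_zero, h]
  congr 1
  push_cast; ring

end Initial

/-! ### Seeds and trees -/

section Reachable

variable {n : ℕ}

lemma TreeSeed.mutate_flipStep {c : ZMod (n + 1) → Ambient n} {s : Seed (degC n)}
    {a a' : ZMod (n + 1)} {T T' : Tri n} {r k : Fin n} (h : TreeSeed c s a T r)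
    (hr : (r : ℕ) + 1 = n) (hc : ∀ a l, 0 < l → l ≤ n + 1 → cont c a l ≠ 0)
    (hlam : traceCont c 0 = lam n) (hF : Tri.FlipStep r a T a' T' k) :
    TreeSeed c (s.mutate k) a' T' r := by
  cases hF with
  | left _ _ p hkp ho he hF => exact h.mutate_flipLeft hr hc hF hkp ho he
  | right _ _ p hkp ho he hF => exact h.mutate_flipRight hr hc hF hkp ho he
  | root => exact h.mutate_flipRoot hr hc hlam

/-- The seed `s` is the seed of the tree `T` based at `a`. -/
def IsTreeSeed (s : Seed (degC n)) (a : ZMod (n + 1)) (T : Tri n) : Prop :=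
  ∃ r : Fin n, (r : ℕ) + 1 = n ∧ TreeSeed (coef n) s a T r

lemma IsTreeSeed.x {s : Seed (degC n)} {a : ZMod (n + 1)} {T : Tri n} (h : IsTreeSeed s a T)
    (i : Fin n) : s.x i = cont (coef n) (Tri.arc a T i).1 (Tri.arc a T i).2 := by
  obtain ⟨r, -, h⟩ := h
  exact h.x i

lemma isTreeSeed_initialSeed (hn : 2 ≤ n) : IsTreeSeed (initialSeed n) (-1) (initTree n) := by
  obtain ⟨r, hr⟩ : ∃ r : Fin n, (r : ℕ) + 1 = n := ⟨⟨n - 1, by omega⟩, by dsimp only; omega⟩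
  exact ⟨r, hr, treeSeed_initialSeed hr⟩

/-- Every seed is the seed of a tree. -/
lemma exists_isTreeSeed (hn : 2 ≤ n) {s : Seed (degC n)} (h : (initialSeed n).MutationEquiv s) :
    ∃ a T, IsTreeSeed s a T := by
  induction h with
  | refl => exact ⟨_, _, isTreeSeed_initialSeed hn⟩
  | tail _ hstep ih =>
    obtain ⟨k, rfl⟩ := hstep
    obtain ⟨a, T, r, hr, hT⟩ := ih
    obtain ⟨a', T', hF⟩ := hT.valid.exists_flipStep a k
    exact ⟨a', T', r, hr,
      hT.mutate_flipStep hr (fun a l h0 _ => cont_coef_ne_zero hn a l h0) (traceCont_coef hn) hF⟩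

/-- Every labelled seed is the seed of a tree, with the labels of the tree. -/
lemma LabelledSeed.exists_isTreeSeed (hn : 2 ≤ n) {s : Seed (degC n)}
    {τ : Fin n → Set (Sym2 (Vertex n))} (h : LabelledSeed n s τ) :
    ∃ a T, IsTreeSeed s a T ∧ τ = treeLabels a T := by
  have key : ∀ Q : Seed (degC n) × (Fin n → Set (Sym2 (Vertex n))), LabelledSeed n Q.1 Q.2 →
      ∃ a T, IsTreeSeed Q.1 a T ∧ Q.2 = treeLabels a T := by
    intro Q hQ
    change Relation.ReflTransGen _ _ Q at hQ
    induction hQ with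
    | refl => exact ⟨_, _, isTreeSeed_initialSeed hn, initialLabels_eq⟩
    | tail _ hstep ih =>
      obtain ⟨k, h1, h2⟩ := hstep
      obtain ⟨a, T, ⟨r, hr, hT⟩, hτ⟩ := ih
      obtain ⟨a', T', hF⟩ := hT.valid.exists_flipStep a k
      rw [hτ] at h2
      refine ⟨a', T', ⟨r, hr, ?_⟩, hF.eq_of_isFlip hT.valid h2⟩
      rw [h1]
      exact hT.mutate_flipStep hr (fun a l h0 _ => cont_coef_ne_zero hn a l h0)
        (traceCont_coef hn) hF
  exact key (s, τ) h

lemma LabelledSeed.mutationEquiv {s : Seed (degC n)} {τ : Fin n → Set (Sym2 (Vertex n))}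
    (h : LabelledSeed n s τ) : (initialSeed n).MutationEquiv s := by
  have key : ∀ Q : Seed (degC n) × (Fin n → Set (Sym2 (Vertex n))), LabelledSeed n Q.1 Q.2 →
      (initialSeed n).MutationEquiv Q.1 := by
    intro Q hQ
    change Relation.ReflTransGen _ _ Q at hQ
    induction hQ with
    | refl => exact Relation.ReflTransGen.refl
    | tail _ hstep ih => exact ih.tail ⟨_, hstep.choose_spec.1⟩
  exact key (s, τ) h

lemma IsTreeSeed.isFamily {s : Seed (degC n)} {a : ZMod (n + 1)} {T : Tri n}
    (h : IsTreeSeed s a T) {c : ZMod (n + 1) × ℕ →₀ ℕ}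
    (hc : ∀ I, c I ≠ 0 → ∃ i, Tri.arc a T i = I) : IsFamily c := by
  obtain ⟨r, -, h⟩ := h
  intro I hI
  obtain ⟨i, rfl⟩ := hc I hI
  refine ⟨h.valid.isArc a i, fun J hJ => ?_⟩
  obtain ⟨j, rfl⟩ := hc J hJ
  exact h.valid.compatArc a i j

/-- Every compatible family of arcs is contained in the labels of a seed. -/
lemma exists_labelledSeed (hn : 2 ≤ n) {c : ZMod (n + 1) × ℕ →₀ ℕ} (hc : IsFamily c) :
    ∃ s a T, LabelledSeed n s (treeLabels a T) ∧ IsTreeSeed s a T ∧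
      ∀ I, c I ≠ 0 → ∃ i, Tri.arc a T i = I := by
  obtain ⟨r, hr, h0⟩ := isTreeSeed_initialSeed hn
  obtain ⟨a, T, ⟨s, h1, h2⟩, h3⟩ := Tri.exists_flips_family (r := r) hn
    (R := fun a T => ∃ s, LabelledSeed n s (treeLabels a T) ∧ TreeSeed (coef n) s a T r)
    (fun a T ⟨s, _, h⟩ => h.valid)
    (fun a T a' T' k ⟨s, h1, h2⟩ hF => ⟨s.mutate k,
      Relation.ReflTransGen.tail h1 ⟨k, rfl, hF.isFlip hn h2.valid⟩,
      h2.mutate_flipStep hr (fun a l h0 _ => cont_coef_ne_zero hn a l h0) (traceCont_coef hn) hF⟩)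
    ⟨-1, initTree n, initialSeed n, by rw [← initialLabels_eq]; exact Relation.ReflTransGen.refl, h0⟩
    hc
  exact ⟨s, a, T, h1, ⟨r, hr, h2⟩, h3⟩

lemma isFamily_single {I : ZMod (n + 1) × ℕ} (hI : IsArc I) : IsFamily (Finsupp.single I 1) := by
  have h : ∀ J, Finsupp.single I 1 J ≠ 0 → J = I := fun J hJ => by
    by_contra hne
    exact hJ (Finsupp.single_eq_of_ne hne)
  intro J hJ
  rw [h J hJ]
  refine ⟨hI, fun K hK => ?_⟩
  rw [h K hK]
  simp [CompatArc, CrossArc]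

/-- The cluster variables attached to a diagonal. -/
lemma isVariableAt_iff (hn : 2 ≤ n) {a b : Vertex n} {I : ZMod (n + 1) × ℕ} (hI : IsArc I)
    (h : segOrbit a b = seg I) (z : Ambient n) :
    IsVariableAt a b z ↔ z = cont (coef n) I.1 I.2 := by
  constructor
  · rintro ⟨s, τ, hs, i, hi, rfl⟩
    obtain ⟨a', T, hT, rfl⟩ := hs.exists_isTreeSeed hn
    rw [h] at hi
    rw [hT.x]
    obtain ⟨r, -, hT⟩ := hT
    rw [seg_injective (hT.valid.isArc a' i) hI hi]
  · rintro rfl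
    obtain ⟨s, a', T, hs, hT, hmem⟩ := exists_labelledSeed hn (isFamily_single hI)
    obtain ⟨i, hi⟩ := hmem I (by simp)
    exact ⟨s, _, hs, i, by rw [h, treeLabels, hi], by rw [hT.x, hi]⟩

lemma isArc_two (hn : 2 ≤ n) (v : ZMod (n + 1)) : IsArc (v, 2) :=
  ⟨le_rfl, by dsimp only; omega⟩

lemma smallVariables_eq (hn : 2 ≤ n) : smallVariables n = Set.range (coef n) := by
  ext z
  constructor
  · rintro ⟨a, b, hab, hz⟩
    obtain ⟨v, hv⟩ := hab.exists_arc
    rw [isVariableAt_iff hn (isArc_two hn v) hv] at hz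
    exact ⟨v + 1, by rw [hz, cont_two]⟩
  · rintro ⟨v, rfl⟩
    obtain ⟨a, b, hab, hv⟩ := exists_isSmall hn (v - 1)
    refine ⟨a, b, hab, ?_⟩
    rw [isVariableAt_iff hn (isArc_two hn _) hv, cont_two, sub_add_cancel]

lemma coef_injective (hn : 2 ≤ n) : Function.Injective (coef n) := by
  intro v w h
  rw [← smallHom_X, ← smallHom_X] at h
  exact MvPolynomial.X_injective (smallHom_injective hn h)

/-! ### Cluster monomials -/

lemma smallHom_familyCont (hn : 2 ≤ n) (e : ℕ) (c : ZMod (n + 1) × ℕ →₀ ℕ) :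
    smallHom n (familyCont e c) = lam n ^ e * smallHom n (familyCont 0 c) := by
  rw [familyCont, familyCont, map_mul, map_mul, map_pow, smallHom_traceCont hn, pow_zero, map_one,
    one_mul]

lemma smallHom_familyCont_zero (c : ZMod (n + 1) × ℕ →₀ ℕ) :
    smallHom n (familyCont 0 c) = ∏ I ∈ c.support, cont (coef n) I.1 I.2 ^ c I := by
  rw [familyCont, pow_zero, one_mul, map_prod]
  exact Finset.prod_congr rfl fun I _ => by rw [map_pow, smallHom_genCont]

lemma prod_x_pow {s : Seed (degC n)} {a : ZMod (n + 1)} {T : Tri n} (h : IsTreeSeed s a T)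
    {c : ZMod (n + 1) × ℕ →₀ ℕ} (hc : ∀ I, c I ≠ 0 → ∃ i, Tri.arc a T i = I) :
    ∏ i, s.x i ^ c (Tri.arc a T i) = smallHom n (familyCont 0 c) := by
  classical
  have hinj : Function.Injective (Tri.arc a T) := by
    obtain ⟨r, -, h⟩ := h
    exact h.valid.arc_injective a
  rw [smallHom_familyCont_zero]
  have hsub : c.support ⊆ Finset.univ.image (Tri.arc a T) := fun I hI => by
    obtain ⟨i, hi⟩ := hc I (Finsupp.mem_support_iff.1 hI)
    exact Finset.mem_image.2 ⟨i, Finset.mem_univ i, hi⟩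
  rw [Finset.prod_subset hsub fun I _ hI => by rw [Finsupp.notMem_support_iff.1 hI, pow_zero],
    Finset.prod_image fun i _ j _ hij => hinj hij]
  exact Finset.prod_congr rfl fun i _ => by rw [h.x]

/-- The arcs of a seed form a compatible family; conversely the flips reach a tree containing any
given compatible family. -/
lemma mem_clusterMonomials_iff (hn : 2 ≤ n) (z : Ambient n) :
    z ∈ clusterMonomials n ↔ ∃ c, IsFamily c ∧ z = smallHom n (familyCont 0 c) := by
  constructor
  · rintro ⟨s, hs, k, rfl⟩
    obtain ⟨a, T, hT⟩ := exists_isTreeSeed hn hs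
    have hinj : Function.Injective (Tri.arc a T) := by
      obtain ⟨r, -, h⟩ := hT
      exact h.valid.arc_injective a
    have hc : ∀ I, (Finsupp.embDomain ⟨Tri.arc a T, hinj⟩ (Finsupp.equivFunOnFinite.symm k)) I ≠ 0 →
        ∃ i, Tri.arc a T i = I := by
      intro I hI
      by_contra hne
      exact hI (Finsupp.embDomain_of_notMem_range _ _ _ fun ⟨i, hi⟩ => hne ⟨i, hi⟩)
    refine ⟨_, hT.isFamily hc, ?_⟩
    rw [← prod_x_pow hT hc]
    refine Finset.prod_congr rfl fun i _ => ?_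
    have := Finsupp.embDomain_apply_self ⟨Tri.arc a T, hinj⟩ (Finsupp.equivFunOnFinite.symm k) i
    simp only [Function.Embedding.coeFn_mk] at this
    rw [this]
    rfl
  · rintro ⟨c, hc, rfl⟩
    obtain ⟨s, a, T, hs, hT, hmem⟩ := exists_labelledSeed hn hc
    exact ⟨s, hs.mutationEquiv, fun i => c (Tri.arc a T i), (prod_x_pow hT hmem).symm⟩

/-! ### The cluster algebra as a polynomial ring -/

lemma zlam_le_range (hn : 2 ≤ n) (z : ZLam n) : (z : Ambient n) ∈ (smallHom n).range := by
  obtain ⟨z, hz⟩ := z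
  induction hz using Algebra.adjoin_induction with
  | mem x hx =>
    exact ⟨_, (smallHom_traceCont hn).trans (Set.mem_singleton_iff.1 hx).symm⟩
  | algebraMap r => exact ⟨r, by simp⟩
  | add x y _ _ hx hy => exact (smallHom n).range.add_mem hx hy
  | mul x y _ _ hx hy => exact (smallHom n).range.mul_mem hx hy

/-- Cluster variables are continuants and λ is a trace, hence integer polynomials in the small
variables; conversely each small variable occurs in a cluster. -/
lemma mem_clusterAlgebra_iff (hn : 2 ≤ n) (z : Ambient n) :
    z ∈ clusterAlgebra n ↔ z ∈ (smallHom n).range := by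
  constructor
  · intro hz
    induction hz using Algebra.adjoin_induction with
    | mem x hx =>
      obtain ⟨s, hs, i, rfl⟩ := hx
      obtain ⟨a, T, hT⟩ := exists_isTreeSeed hn hs
      exact ⟨_, by rw [hT.x, ← smallHom_genCont]⟩
    | algebraMap r => exact zlam_le_range hn r
    | add x y _ _ hx hy => exact (smallHom n).range.add_mem hx hy
    | mul x y _ _ hx hy => exact (smallHom n).range.mul_mem hx hy
  · rintro ⟨p, rfl⟩
    induction p using MvPolynomial.induction_on with
    | C k =>
      rw [show (MvPolynomial.C k : MvPolynomial (ZMod (n + 1)) ℤ) = (k : ℤ) by simp, map_intCast]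
      exact intCast_mem _ k
    | add p q hp hq => rw [map_add]; exact add_mem hp hq
    | mul_X p v hp =>
      rw [map_mul]
      refine mul_mem hp (Algebra.subset_adjoin ?_)
      obtain ⟨s, a, T, hs, hT, hmem⟩ :=
        exists_labelledSeed hn (isFamily_single (isArc_two hn (v - 1)))
      obtain ⟨i, hi⟩ := hmem (v - 1, 2) (by simp)
      exact ⟨s, hs.mutationEquiv, i, by rw [hT.x, hi, smallHom_X, cont_two, sub_add_cancel]⟩

lemma clusterAlgebra_eq_range (hn : 2 ≤ n) :
    (clusterAlgebra n : Set (Ambient n)) = Set.range (smallHom n) := by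
  ext z
  exact mem_clusterAlgebra_iff hn z

/-! ### Bases of the cluster algebra -/

/-- The homomorphism `smallHom` as a linear map. -/
noncomputable def smallLin (n : ℕ) : MvPolynomial (ZMod (n + 1)) ℤ →ₗ[ℤ] Ambient n where
  toFun := smallHom n
  map_add' := map_add _
  map_smul' k p := by
    rw [RingHom.id_apply, Algebra.smul_def, zsmul_eq_mul, map_mul]
    simp

/-- The images of a basis of the polynomial ring form a basis of the cluster algebra. -/
lemma isBasisOf_range (hn : 2 ≤ n) {ι : Type*} {f : ι → MvPolynomial (ZMod (n + 1)) ℤ}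
    (hf : LinearIndependent ℤ f) (hs : Submodule.span ℤ (Set.range f) = ⊤) :
    IsBasisOf ℤ (Set.range fun i => smallHom n (f i)) (clusterAlgebra n : Set (Ambient n)) := by
  have hlin : LinearIndependent ℤ fun i => smallHom n (f i) :=
    hf.map_injOn (smallLin n) (smallHom_injective hn).injOn
  refine ⟨hlin.linearIndepOn_id, ?_⟩
  have h : (Set.range fun i => smallHom n (f i)) = smallLin n '' Set.range f := by
    rw [← Set.range_comp]; rfl
  rw [h, Submodule.span_image, hs, clusterAlgebra_eq_range hn, Submodule.map_top,
    LinearMap.coe_range]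
  rfl

lemma smallMonomials_eq (hn : 2 ≤ n) : smallMonomials n =
    Set.range fun w => smallHom n (MvPolynomial.monomial w 1) := by
  ext z
  rw [smallMonomials, smallVariables_eq hn]
  constructor
  · intro hz
    induction hz using Submonoid.closure_induction with
    | mem x hx =>
      obtain ⟨v, rfl⟩ := hx
      exact ⟨Finsupp.single v 1, by dsimp only; rw [← smallHom_X]; rfl⟩
    | one => exact ⟨0, by simp⟩
    | mul x y _ _ hx hy =>
      obtain ⟨w, rfl⟩ := hx
      obtain ⟨w', rfl⟩ := hy
      exact ⟨w + w', by dsimp only; rw [← map_mul, MvPolynomial.monomial_mul, mul_one]⟩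
  · rintro ⟨w, rfl⟩
    simp only [smallHom, MvPolynomial.coe_eval₂Hom, MvPolynomial.eval₂_monomial, map_one, one_mul]
    exact Submonoid.prod_mem _ fun v _ =>
      Submonoid.pow_mem _ (Submonoid.subset_closure (Set.mem_range_self v)) _

lemma isBasisOf_smallMonomials (hn : 2 ≤ n) :
    IsBasisOf ℤ (smallMonomials n) (clusterAlgebra n : Set (Ambient n)) := by
  rw [smallMonomials_eq hn]
  have h : ∀ w : ZMod (n + 1) →₀ ℕ, Leads w (MvPolynomial.monomial w 1) :=
    fun w => ⟨0, by simp, by simp⟩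
  exact isBasisOf_range hn (linearIndependent_of_leads h) (span_of_leads h)

/-- The products of powers of `λ` and generic cluster monomials, indexed by their leading
exponents. -/
lemma exists_leading_family (hn : 2 ≤ n) :
    ∃ f : (ZMod (n + 1) →₀ ℕ) → MvPolynomial (ZMod (n + 1)) ℤ, (∀ w, Leads w (f w)) ∧
      (∀ e c, IsFamily c → f (familyWeight e c) = familyCont e c) ∧
      ∀ w, ∃ e c, IsFamily c ∧ f w = familyCont e c := by
  choose e c hc hw using exists_familyWeight_eq (N := n + 1)
  refine ⟨fun w => familyCont (e w) (c w), fun w => ?_, fun e' c' hc' => ?_,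
    fun w => ⟨e w, c w, hc w, rfl⟩⟩
  · have := leads_familyCont (N := n + 1) (by omega) (e w) (hc w)
    rwa [hw] at this
  · obtain ⟨h1, h2⟩ := familyWeight_injective (hc (familyWeight e' c')) hc'
      (hw (familyWeight e' c'))
    dsimp only
    rw [h1, h2]

lemma isBasisOf_lam_mul_clusterMonomials (hn : 2 ≤ n) :
    IsBasisOf ℤ {z : Ambient n | ∃ e : ℕ, ∃ m ∈ clusterMonomials n, z = lam n ^ e * m}
      (clusterAlgebra n : Set (Ambient n)) := by
  obtain ⟨f, hf, h1, h2⟩ := exists_leading_family hn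
  have heq : {z : Ambient n | ∃ e : ℕ, ∃ m ∈ clusterMonomials n, z = lam n ^ e * m} =
      Set.range fun w => smallHom n (f w) := by
    ext z
    constructor
    · rintro ⟨e, m, hm, rfl⟩
      obtain ⟨c, hc, rfl⟩ := (mem_clusterMonomials_iff hn m).1 hm
      exact ⟨familyWeight e c, by dsimp only; rw [h1 e c hc, smallHom_familyCont hn]⟩
    · rintro ⟨w, rfl⟩
      obtain ⟨e, c, hc, hw⟩ := h2 w
      exact ⟨e, _, (mem_clusterMonomials_iff hn _).2 ⟨c, hc, rfl⟩, by
        dsimp only; rw [hw, smallHom_familyCont hn]⟩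
  rw [heq]
  exact isBasisOf_range hn (linearIndependent_of_leads hf) (span_of_leads hf)

/-- The products of powers of `λ` and cluster monomials are linearly independent, as a family. -/
lemma linearIndependent_lam_mul (hn : 2 ≤ n) :
    LinearIndependent ℤ fun x : ℕ × clusterMonomials n => lam n ^ x.1 * (x.2 : Ambient n) := by
  obtain ⟨f, hf, h1, -⟩ := exists_leading_family hn
  choose c hc hm using fun m : clusterMonomials n => (mem_clusterMonomials_iff hn m).1 m.2
  have hlin : LinearIndependent ℤ fun w => smallHom n (f w) :=
    (linearIndependent_of_leads hf).map_injOn (smallLin n) (smallHom_injective hn).injOn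
  -- Injectivity of the leading exponents also shows that distinct pairs (e, m) give distinct
  -- products, which the statement about the set of products does not record.
  have hinj : Function.Injective fun x : ℕ × clusterMonomials n => familyWeight x.1 (c x.2) := by
    rintro ⟨e, m⟩ ⟨e', m'⟩ h
    obtain ⟨rfl, h4⟩ := familyWeight_injective (hc m) (hc m') h
    have : m = m' := Subtype.ext (by rw [hm m, hm m', h4])
    rw [this]
  have := hlin.comp _ hinj
  convert this using 1
  funext x
  simp only [Function.comp_apply]
  rw [h1 _ _ (hc x.2), smallHom_familyCont hn, ← hm]

lemma exists_polynomial_zlam (z : ZLam n) :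
    ∃ q : Polynomial ℤ, (z : Ambient n) = Polynomial.aeval (lam n) q := by
  have : (z : Ambient n) ∈ Algebra.adjoin ℤ {lam n} := z.2
  rw [Algebra.adjoin_singleton_eq_range_aeval] at this
  obtain ⟨q, hq⟩ := this
  exact ⟨q, hq.symm⟩

/-- A relation with coefficients in ℤ[λ] expands into an integer relation between the products λ^e
m, so both halves reduce to the statement over ℤ. -/
lemma isBasisOf_clusterMonomials (hn : 2 ≤ n) :
    IsBasisOf (ZLam n) (clusterMonomials n) (clusterAlgebra n : Set (Ambient n)) := by
  constructor
  · rw [LinearIndepOn, linearIndependent_iff']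
    intro s g hg i hi
    choose q hq using fun m => exists_polynomial_zlam (g m)
    -- A common degree bound, so that the coefficients of all the polynomials in λ are indexed by
    -- one finite product.
    have hD : ∀ m ∈ s, (q m).natDegree < (s.sup fun m => (q m).natDegree) + 1 := fun m hm =>
      Nat.lt_succ_of_le (Finset.le_sup (f := fun m => (q m).natDegree) hm)
    set D := (s.sup fun m => (q m).natDegree) + 1
    have h := linearIndependent_iff'.1 (linearIndependent_lam_mul hn)
      (Finset.range D ×ˢ s) (fun x => (q x.2).coeff x.1) (by
        rw [Finset.sum_product_right, ← hg]
        refine Finset.sum_congr rfl fun m hm => ?_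
        have : g m • id (m : Ambient n) = (g m : Ambient n) * m := rfl
        rw [this, hq m, Polynomial.aeval_eq_sum_range' (hD m hm), Finset.sum_mul]
        exact Finset.sum_congr rfl fun e _ => by
          dsimp only
          rw [Algebra.smul_def, zsmul_eq_mul, eq_intCast, mul_assoc])
    have hq0 : q i = 0 := by
      ext e
      by_cases he : e < D
      · exact h (e, i) (Finset.mem_product.2 ⟨Finset.mem_range.2 he, hi⟩)
      · rw [Polynomial.coeff_zero]
        exact Polynomial.coeff_eq_zero_of_natDegree_lt (by have := hD i hi; omega)
    refine Subtype.ext ?_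
    rw [hq i, hq0, map_zero]; rfl
  · refine Set.Subset.antisymm ?_ ?_
    · intro z hz
      refine Submodule.span_induction (p := fun z _ => z ∈ clusterAlgebra n) ?_ ?_ ?_ ?_ hz
      · intro m hm
        obtain ⟨c, -, rfl⟩ := (mem_clusterMonomials_iff hn m).1 hm
        exact (mem_clusterAlgebra_iff hn _).2 ⟨_, rfl⟩
      · exact zero_mem _
      · exact fun x y _ _ hx hy => add_mem hx hy
      · exact fun r x _ hx => Subalgebra.smul_mem _ hx r
    · rw [← (isBasisOf_lam_mul_clusterMonomials hn).2]
      intro z hz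
      refine Submodule.span_induction
        (p := fun z _ => z ∈ Submodule.span (ZLam n) (clusterMonomials n)) ?_ ?_ ?_ ?_ hz
      · rintro z ⟨e, m, hm, rfl⟩
        exact Submodule.smul_mem _ (⟨lam n, Algebra.self_mem_adjoin_singleton ℤ _⟩ ^ e : ZLam n)
          (Submodule.subset_span hm)
      · exact zero_mem _
      · exact fun x y _ _ hx hy => add_mem hx hy
      · intro k x _ hx
        rw [zsmul_eq_mul, ← map_intCast (algebraMap (ZLam n) (Ambient n)), ← Algebra.smul_def]
        exact Submodule.smul_mem _ _ hx

lemma exists_ringEquiv (hn : 2 ≤ n) :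
    ∃ e : MvPolynomial (smallVariables n) ℤ ≃+* clusterAlgebra n,
      ∀ z : smallVariables n, (e (MvPolynomial.X z) : Ambient n) = (z : Ambient n) := by
  let σ : ZMod (n + 1) ≃ smallVariables n :=
    (Equiv.ofInjective _ (coef_injective hn)).trans (Equiv.setCongr (smallVariables_eq hn).symm)
  have hmem : ∀ p, smallHom n p ∈ clusterAlgebra n :=
    fun p => (mem_clusterAlgebra_iff hn _).2 ⟨p, rfl⟩
  let φ : MvPolynomial (ZMod (n + 1)) ℤ ≃+* clusterAlgebra n :=
    RingEquiv.ofBijective ((smallHom n).codRestrict (clusterAlgebra n) hmem) ⟨fun p q h =>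
      smallHom_injective hn (congrArg Subtype.val h), fun z => by
        obtain ⟨p, hp⟩ := (mem_clusterAlgebra_iff hn _).1 z.2
        exact ⟨p, Subtype.ext hp⟩⟩
  refine ⟨(MvPolynomial.renameEquiv ℤ σ.symm).toRingEquiv.trans φ, fun z => ?_⟩
  have h1 : ((MvPolynomial.renameEquiv ℤ σ.symm).toRingEquiv.trans φ) (MvPolynomial.X z) =
      φ (MvPolynomial.X (σ.symm z)) := by
    simp
  have h2 : coef n (σ.symm z) = (σ (σ.symm z) : Ambient n) := rfl
  rw [h1]
  change smallHom n (MvPolynomial.X (σ.symm z)) = z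
  rw [smallHom_X, h2, Equiv.apply_symm_apply]

lemma ncard_smallVariables (hn : 2 ≤ n) : (smallVariables n).ncard = n + 1 := by
  rw [smallVariables_eq hn, ← Set.image_univ, Set.ncard_image_of_injective _ (coef_injective hn),
    Set.ncard_univ, Nat.card_zmod]

lemma existsUnique_isVariableAt (hn : 2 ≤ n) {a b : Vertex n} (h : IsSmall a b) :
    ∃! z : Ambient n, IsVariableAt a b z := by
  obtain ⟨v, hv⟩ := h.exists_arc
  simp only [isVariableAt_iff hn (isArc_two hn v) hv]
  exact ⟨_, rfl, fun _ h => h⟩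

end Reachable

end GenCluster

theorem proposition2p9 (n : ℕ) (hn : 2 ≤ n) :
    -- every small diagonal is the label of exactly one variable; there are `n + 1` small variables
    (∀ a b : GenCluster.Vertex n, GenCluster.IsSmall a b →
      ∃! z : GenCluster.Ambient n, GenCluster.IsVariableAt a b z) ∧
    (GenCluster.smallVariables n).ncard = n + 1 ∧
    -- the monomials in the small variables form a `ℤ`-basis
    GenCluster.IsBasisOf ℤ (GenCluster.smallMonomials n)
      (GenCluster.clusterAlgebra n : Set (GenCluster.Ambient n)) ∧
    -- the algebra is the polynomial ring over `ℤ` in the small variables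
    (∃ e : MvPolynomial (GenCluster.smallVariables n) ℤ ≃+* GenCluster.clusterAlgebra n,
      ∀ z : GenCluster.smallVariables n,
        (e (MvPolynomial.X z) : GenCluster.Ambient n) = (z : GenCluster.Ambient n)) ∧
    -- the cluster monomials form a `ℤ[λ]`-basis
    GenCluster.IsBasisOf (GenCluster.ZLam n) (GenCluster.clusterMonomials n)
      (GenCluster.clusterAlgebra n : Set (GenCluster.Ambient n)) ∧
    -- the products of a power of `λ` and a cluster monomial form a `ℤ`-basis
    GenCluster.IsBasisOf ℤ
      {z : GenCluster.Ambient n |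
        ∃ e : ℕ, ∃ m ∈ GenCluster.clusterMonomials n, z = GenCluster.lam n ^ e * m}
      (GenCluster.clusterAlgebra n : Set (GenCluster.Ambient n)) :=
  ⟨fun _ _ h => GenCluster.existsUnique_isVariableAt hn h, GenCluster.ncard_smallVariables hn,
    GenCluster.isBasisOf_smallMonomials hn, GenCluster.exists_ringEquiv hn,
    GenCluster.isBasisOf_clusterMonomials hn, GenCluster.isBasisOf_lam_mul_clusterMonomials hn⟩
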